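/- A \emph{polyhedron} is a surface in $\mathbb{R}^3$ formed of finitely many planar faces, each a simple polygon, such that any two faces are disjoint, share exactly one vertex, or share exactly one edge; each edge belongs to exactly two faces; and the link of each vertex is a cycle. It is \emph{orthogonal} if all its dihedral angles are integer multiples of $\pi/2$, and it has \emph{genus} $g$ if its surface is connected and its numbers $V,E,F$ of vertices, edges and faces satisfy $V-E+F=2-2g$. \textbf{Theorem.} (1) For every integer $g\ge 7$ there is a nonorthogonal polyhedron of genus $g$ all of whose faces are rectangles. (2) Let $L>0$ and $h=L/\sqrt2$. Replace each vertex $v\in\{\pm e_1,\pm e_2,\pm e_3\}$ of the regular octahedron by a cluster of five vertices: the four corners of the unit square centred at $(h+\frac12)v$, perpendicular to $v$ and with sides parallel to the other two axes, and the apex $hv$ of a pyramid over that square. Replace each edge $vw$ of the octahedron by the three lateral faces of a triangular prism of length $L$ with cross-section sides $1,\frac{\sqrt3}2,\frac{\sqrt3}2$, joining the triangular faces of the two pyramids that face each other along $vw$. The six unit squares, twelve $L\times 1$ rectangles and twenty-four $L\times\frac{\sqrt3}{2}$ rectangles so obtained are the faces of a polyhedron $P_L$ that is invariant under all symmetries of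 the octahedron. It has $V=30$, $E=84$, $F=42$, hence genus $7$, and none of its dihedral angles is a multiple of $\pi/2$; in particular it is nonorthogonal. (3) For every $L>0$ and every $g\ge 7$, a nonorthogonal polyhedron of genus $g$ with only rectangular faces is obtained from $P_L$ by attaching an orthogonal structure along one of its six unit squares: all the other faces of $P_L$ are faces of it, and each of its remaining faces is a rectangle with sides parallel to the coordinate axes. -/

import Mathlib

open scoped Topology

noncomputable section

namespace RectangularPolyhedra

/-- Euclidean three-space. -/
abbrev E3 : Type := EuclideanSpace ℝ (Fin 3)

/-- A (closed) polygonal path in space, with any number of vertices in cyclic order. -/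
abbrev Face : Type := Σ n : ℕ, Polygon E3 n

namespace Face

/-- The `i`-th vertex. -/
def vert (f : Face) (i : Fin f.1) : E3 := f.2.vertices i

/-- The vertex following the `i`-th one in cyclic order. -/
def next (f : Face) (i : Fin f.1) : E3 := f.2.vertices (finRotate f.1 i)

/-- The vertex preceding the `i`-th one in cyclic order. -/
def prev (f : Face) (i : Fin f.1) : E3 := f.2.vertices ((finRotate f.1).symm i)

/-- The set of vertices. -/
def vertexSet (f : Face) : Set E3 := Set.range f.vert

/-- The edges, each recorded as the unordered pair of its endpoints. -/
def edges (f : Face) : Set (Sym2 E3) := {e | ∃ i, e = s(f.vert i, f.next i)}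

/-- A simple planar polygon: at least three vertices, all distinct and coplanar, such that two
different edges meet at most in a common endpoint (the end of one, the start of the next). -/
structure IsSimplePlanar (f : Face) : Prop where
  three_le : 3 ≤ f.1
  injective : Function.Injective f.vert
  coplanar : Coplanar ℝ f.vertexSet
  simple : ∀ i j : Fin f.1, i ≠ j → ∀ x ∈ f.2.edgeSet ℝ i ∩ f.2.edgeSet ℝ j,
    (j = finRotate f.1 i ∧ x = f.vert j) ∨ (i = finRotate f.1 j ∧ x = f.vert i)

/-- The closed planar region bounded by the polygon: the points of its plane that are on the
boundary (where `connectedComponentIn` is empty) or in a bounded component of the complement of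
the boundary in the plane. -/
def region (f : Face) : Set E3 :=
  {p | p ∈ affineSpan ℝ f.vertexSet ∧
    Bornology.IsBounded
      (connectedComponentIn ((affineSpan ℝ f.vertexSet : Set E3) \ f.2.boundary ℝ) p)}

/-- A rectangle: four vertices and a right angle at each of them. -/
def IsRectangle (f : Face) : Prop :=
  f.1 = 4 ∧ ∀ i : Fin f.1, EuclideanGeometry.angle (f.prev i) (f.vert i) (f.next i) = Real.pi / 2

/-- An `a` by `b` rectangle: two consecutive sides have lengths `a` and `b`. -/
def IsRectangleOfSize (f : Face) (a b : ℝ) : Prop :=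
  f.IsRectangle ∧ ∃ i : Fin f.1, dist (f.prev i) (f.vert i) = a ∧ dist (f.vert i) (f.next i) = b

/-- All edges are parallel to coordinate axes. -/
def IsAxisParallel (f : Face) : Prop :=
  ∀ i : Fin f.1, ∃ k : Fin 3, ∀ l : Fin 3, l ≠ k → f.next i l = f.vert i l

/-- `u` is the unit vector perpendicular to the edge `ab` of the face that points from the midpoint
of the edge into the face. -/
def IsInward (f : Face) (a b u : E3) : Prop :=
  ‖u‖ = 1 ∧ inner ℝ u (b - a) = 0 ∧
    ∀ᶠ t : ℝ in 𝓝[>] 0, midpoint ℝ a b + t • u ∈ f.region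

end Face

variable {ι : Type}

/-- The vertices of a family of faces. -/
def vertices (P : ι → Face) : Set E3 := ⋃ i, (P i).vertexSet

/-- The edges of a family of faces. -/
def edges (P : ι → Face) : Set (Sym2 E3) := ⋃ i, (P i).edges

/-- The surface formed by a family of faces. -/
def surface (P : ι → Face) : Set E3 := ⋃ i, (P i).region

/-- The link of `v`: its nodes are the edges at `v`, and two of them are joined when they are
consecutive edges (at `v`) of one face. -/
def link (P : ι → Face) (v : E3) : SimpleGraph {e : Sym2 E3 // e ∈ edges P ∧ v ∈ e} where
  Adj e e' := e ≠ e' ∧ ∃ i, e.1 ∈ (P i).edges ∧ e'.1 ∈ (P i).edges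
  symm := ⟨fun _ _ h => ⟨h.1.symm, h.2.imp fun _ hi => ⟨hi.2, hi.1⟩⟩⟩
  loopless := ⟨fun _ h => h.1 rfl⟩

/-- A polyhedron: a surface formed of finitely many planar faces, each a simple polygon, such that
any two are disjoint, share one vertex, or share an edge; such that each edge is shared by exactly
two faces; and such that the link of each vertex is a cycle (a finite connected graph, all of
whose nodes have degree two). -/
structure IsPolyhedron (P : ι → Face) : Prop where
  finite : Finite ι
  simple : ∀ i, (P i).IsSimplePlanar
  inter : ∀ i j, i ≠ j →
    Disjoint (P i).region (P j).region ∨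
    (∃ v, v ∈ (P i).vertexSet ∧ v ∈ (P j).vertexSet ∧ (P i).region ∩ (P j).region = {v}) ∨
    (∃ a b, s(a, b) ∈ (P i).edges ∧ s(a, b) ∈ (P j).edges ∧
      (P i).region ∩ (P j).region = segment ℝ a b)
  two_faces : ∀ e ∈ edges P, {i | e ∈ (P i).edges}.ncard = 2
  link_cycle : ∀ v ∈ vertices P,
    (link P v).Connected ∧ ∀ e, ((link P v).neighborSet e).ncard = 2

/-- The surface of a polyhedron is connected and has genus `g`, where `V - E + F = 2 - 2g`. -/
def HasGenus (P : ι → Face) (g : ℕ) : Prop :=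
  IsConnected (surface P) ∧
    ((vertices P).ncard : ℤ) - (edges P).ncard + Nat.card ι = 2 - 2 * g

/-- `θ` is the angle, in `[0, π]`, between the two faces that meet at some edge of `P`. (The dihedral
angle measured on the inner side of the surface is `θ` or `2π - θ`; this does not affect whether
it is an integer multiple of `π / 2`.) -/
def IsDihedralAngle (P : ι → Face) (θ : ℝ) : Prop :=
  ∃ i j, i ≠ j ∧ ∃ a b u w : E3, s(a, b) ∈ (P i).edges ∧ s(a, b) ∈ (P j).edges ∧
    (P i).IsInward a b u ∧ (P j).IsInward a b w ∧ θ = InnerProductGeometry.angle u w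

/-- An integer multiple of a right angle. -/
def IsRectilinear (θ : ℝ) : Prop := ∃ k : ℤ, θ = k * (Real.pi / 2)

/-- All dihedral angles are multiples of `π / 2`. -/
def IsOrthogonal (P : ι → Face) : Prop := ∀ θ, IsDihedralAngle P θ → IsRectilinear θ

/-- The real number `1` or `-1` given by a sign. -/
def sgn (a : ℤˣ) : ℝ := ((a : ℤ) : ℝ)

/-- The point with the given coordinates along the axes `k`, `k + 1`, `k + 2` (modulo 3). -/
def pt (k : Fin 3) (x y z : ℝ) : E3 :=
  WithLp.toLp 2 fun i => if i = k then x else if i = k + 1 then y else z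

/-- A quadrilateral. -/
def quad (p q r s : E3) : Face := ⟨4, ⟨![p, q, r, s]⟩⟩

/-- The vertices `±e₁, ±e₂, ±e₃` of the regular octahedron. -/
def octahedron : Set E3 := {v | ∃ (k : Fin 3) (a : ℤˣ), v = pt k (sgn a) 0 0}

/-- The faces of the octahedral example: six squares, one for each octahedron vertex `a e_k`; and for
each of the twelve octahedron edges, which joins `a e_{m+1}` to `b e_{m+2}`, one outer prism
face and two inner prism faces (on the sides `c = ±1` of the plane of the two vertices). -/
abbrev OctIndex : Type :=
  (Fin 3 × ℤˣ) ⊕ (Fin 3 × ℤˣ × ℤˣ) ⊕ (Fin 3 × ℤˣ × ℤˣ × ℤˣ)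

/-- The octahedral example with prisms of length `L`. With `h = L / √2`, the octahedron vertex `a e_k`
is replaced by the pyramid whose base is the unit square centred at `a (h + 1/2) e_k`,
perpendicular to `e_k` and parallel to the other axes, and whose apex is `a h e_k`. The
octahedron edge from `a e_{m+1}` to `b e_{m+2}` is replaced by the lateral surface of the prism
that joins two triangular pyramid faces. -/
def octopus (L : ℝ) : OctIndex → Face
  | .inl (k, a) =>
      let t := sgn a * (L / √2 + 1 / 2)
      quad (pt k t (1 / 2) (1 / 2)) (pt k t (1 / 2) (-1 / 2))
        (pt k t (-1 / 2) (-1 / 2)) (pt k t (-1 / 2) (1 / 2))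
  | .inr (.inl (m, a, b)) =>
      let t := L / √2 + 1 / 2
      quad (pt m (1 / 2) (sgn a * t) (sgn b / 2)) (pt m (-1 / 2) (sgn a * t) (sgn b / 2))
        (pt m (-1 / 2) (sgn a / 2) (sgn b * t)) (pt m (1 / 2) (sgn a / 2) (sgn b * t))
  | .inr (.inr (m, a, b, c)) =>
      let h := L / √2
      let t := L / √2 + 1 / 2
      quad (pt m (sgn c / 2) (sgn a * t) (sgn b / 2)) (pt m (sgn c / 2) (sgn a / 2) (sgn b * t))
        (pt m 0 0 (sgn b * h)) (pt m 0 (sgn a * h) 0)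

end RectangularPolyhedra

end

open RectangularPolyhedra

/-!
# Nonorthogonal polyhedra with rectangular faces

A surface made of quadrilaterals is described by its incidence structure, a family `F i : Fin 4 → V`
of vertex cycles, and by the positions `ρ : V → E3` of the vertices. If each quadrilateral is a
rectangle, its region is the convex hull of its vertices (`rect_region_eq_convexHull`), and if two
of them are separated by a plane that meets one of them only in common vertices, they intersect in
the convex hull of the common vertices (`convexHull_inter_of_separated`). Therefore
`IsRectangular.isPolyhedron` reduces the definition of a polyhedron to finitely many incidence
conditions (`IsClosedQuadSurface`) and finitely many linear conditions (`IsRectangular`).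

The vertices of the octahedral example have the form `P / 2 + h Q` with integral vectors `P` and
`Q`, and all conditions can be stated separately for the coefficients of `1 / 2` and of `h`
(`IsIntRectangular`). Then they do not depend on `h > 0`, and they are decidable. The separating
planes are found as follows. The squares and the outer prism faces lie in the boundary of the convex
hull, so their own planes separate them from all other faces. The inner prism faces lie in the
cones of a fan on which a convex function is linear, with different linear pieces on different
cones; two of them are separated by the plane on which the corresponding linear functions agree. The
dihedral angles are found from the directions that adjacent faces take at a common side: their
inner product does not vanish and does not attain the Cauchy–Schwarz bound. Symmetry follows since
the symmetries of the octahedron are the signed permutations of the coordinates.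

For higher genus, an orthogonal torus made of 36 unit squares, the boundary of nine cubes, is placed
on the top square. `IsPolyhedron.glue` shows that two polyhedra whose surfaces have exactly one
face in common form a polyhedron when that face is removed: at a vertex of that face the two links
are cycles with one common edge, and the removal of this edge joins them into one cycle
(`IsGluing.isLinkCycle_of_mem`). The top of the torus contains a unit square of the same kind, so
the construction can be iterated (`IsTower.glue_torus`), and the genus increases by one each time.
All faces are quadrilaterals, so there are twice as many edges as faces, and the genus is determined
by `V - F`, which is `30 - 42` for the octahedral example and changes by `(36 - 4) - (36 - 2) = -2`
with each torus. The two prism faces at some edge are kept, so the polyhedron is not orthogonal.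
-/

noncomputable section

namespace RectangularPolyhedra

/-! ### Rectangles in space -/

/-- The parallelogram with corner `p` and side vectors `u` and `v`. -/
def rect (p u v : E3) : Face := quad p (p + u) (p + (u + v)) (p + v)

/-- The point with coordinates `s`, `t` in the affine frame `p`, `u`, `v`. -/
def framePt (p u v : E3) (s t : ℝ) : E3 := p + (s • u + t • v)

section Rect

variable {p u v : E3}

theorem framePt_inj (hu : u ≠ 0) (hv : v ≠ 0) (huv : inner ℝ u v = 0) {s t s' t' : ℝ}
    (h : framePt p u v s t = framePt p u v s' t') : s = s' ∧ t = t' := by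
  have h := add_left_cancel h
  have h1 := congrArg (fun x => inner ℝ u x) h
  have h2 := congrArg (fun x => inner ℝ v x) h
  have huv' : inner ℝ v u = 0 := by rw [real_inner_comm]; exact huv
  simp only [inner_add_right, inner_smul_right, huv, huv', mul_zero, add_zero, zero_add] at h1 h2
  exact ⟨mul_right_cancel₀ (inner_self_ne_zero.mpr hu) h1,
    mul_right_cancel₀ (inner_self_ne_zero.mpr hv) h2⟩

theorem rect_vertexSet :
    (rect p u v).vertexSet = {p, p + u, p + (u + v), p + v} := by
  ext x
  simp only [Face.vertexSet, Set.mem_range, Set.mem_insert_iff, Set.mem_singleton_iff]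
  constructor
  · rintro ⟨i, rfl⟩
    change Fin 4 at i
    fin_cases i <;> simp [Face.vert, rect, quad]
  · rintro (rfl | rfl | rfl | rfl)
    exacts [⟨(0 : Fin 4), rfl⟩, ⟨(1 : Fin 4), rfl⟩, ⟨(2 : Fin 4), rfl⟩, ⟨(3 : Fin 4), rfl⟩]

theorem mem_affineSpan_rect {x : E3} :
    x ∈ affineSpan ℝ (rect p u v).vertexSet ↔ ∃ s t, x = framePt p u v s t := by
  rw [rect_vertexSet]
  constructor
  · intro h
    refine affineSpan_induction h ?_ ?_
    · rintro x (rfl | rfl | rfl | rfl)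
      · exact ⟨0, 0, by simp [framePt]⟩
      · exact ⟨1, 0, by simp [framePt]⟩
      · exact ⟨1, 1, by simp [framePt]⟩
      · exact ⟨0, 1, by simp [framePt]⟩
    · rintro c _ _ _ ⟨s, t, rfl⟩ ⟨s', t', rfl⟩ ⟨s'', t'', rfl⟩
      refine ⟨c * (s - s') + s'', c * (t - t') + t'', ?_⟩
      simp only [framePt, vsub_eq_sub, vadd_eq_add]
      module
  · rintro ⟨s, t, rfl⟩
    have hp : p ∈ affineSpan ℝ ({p, p + u, p + (u + v), p + v} : Set E3) :=
      subset_affineSpan _ _ (by simp)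
    have hu : p + u ∈ affineSpan ℝ ({p, p + u, p + (u + v), p + v} : Set E3) :=
      subset_affineSpan _ _ (by simp)
    have hv : p + v ∈ affineSpan ℝ ({p, p + u, p + (u + v), p + v} : Set E3) :=
      subset_affineSpan _ _ (by simp)
    have h1 := AffineSubspace.smul_vsub_vadd_mem _ s hu hp hp
    have h2 := AffineSubspace.smul_vsub_vadd_mem _ t hv hp h1
    convert h2 using 1
    simp only [framePt, vsub_eq_sub, vadd_eq_add]
    module

/-- The sides of a parallelogram, in the coordinates of its frame. -/
theorem mem_edgeSet_rect {x : E3} (i : Fin 4) :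
    x ∈ (rect p u v).2.edgeSet ℝ i ↔ ∃ a : ℝ, 0 ≤ a ∧ a ≤ 1 ∧
      x = framePt p u v (![a, 1, 1 - a, 0] i) (![0, a, 1, 1 - a] i) := by
  have key : ∀ a : ℝ, (rect p u v).2.edgePath ℝ i a =
      framePt p u v (![a, 1, 1 - a, 0] i) (![0, a, 1, 1 - a] i) := by
    intro a
    fin_cases i
    · change AffineMap.lineMap p (p + u) a = p + (a • u + (0 : ℝ) • v)
      rw [AffineMap.lineMap_apply_module]; module
    · change AffineMap.lineMap (p + u) (p + (u + v)) a = p + ((1 : ℝ) • u + a • v)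
      rw [AffineMap.lineMap_apply_module]; module
    · change AffineMap.lineMap (p + (u + v)) (p + v) a = p + ((1 - a) • u + (1 : ℝ) • v)
      rw [AffineMap.lineMap_apply_module]; module
    · change AffineMap.lineMap (p + v) p a = p + ((0 : ℝ) • u + (1 - a) • v)
      rw [AffineMap.lineMap_apply_module]; module
  change x ∈ (rect p u v).2.edgePath ℝ i '' Set.Icc (0 : ℝ) 1 ↔ _
  constructor
  · rintro ⟨a, ⟨h0, h1⟩, rfl⟩
    exact ⟨a, h0, h1, key a⟩
  · rintro ⟨a, h0, h1, rfl⟩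
    exact ⟨a, ⟨h0, h1⟩, key a⟩

theorem mem_boundary_rect {x : E3} :
    x ∈ (rect p u v).2.boundary ℝ ↔ ∃ s t : ℝ, x = framePt p u v s t ∧
      0 ≤ s ∧ s ≤ 1 ∧ 0 ≤ t ∧ t ≤ 1 ∧ (s = 0 ∨ s = 1 ∨ t = 0 ∨ t = 1) := by
  simp only [Polygon.boundary, Set.mem_iUnion]
  constructor
  · rintro ⟨i, hi⟩
    obtain ⟨a, h0, h1, rfl⟩ := (mem_edgeSet_rect i).1 hi
    refine ⟨_, _, rfl, ?_⟩
    revert i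
    change ∀ i : Fin 4, _ → _
    intro i _
    fin_cases i <;> simp [h0, h1]
  · rintro ⟨s, t, rfl, hs0, hs1, ht0, ht1, rfl | rfl | rfl | rfl⟩
    · exact ⟨(3 : Fin 4), (mem_edgeSet_rect _).2
        ⟨1 - t, by linarith, by linarith, by simp⟩⟩
    · exact ⟨(1 : Fin 4), (mem_edgeSet_rect _).2 ⟨t, by linarith, by linarith, by simp⟩⟩
    · exact ⟨(0 : Fin 4), (mem_edgeSet_rect _).2 ⟨s, by linarith, by linarith, by simp⟩⟩
    · exact ⟨(2 : Fin 4), (mem_edgeSet_rect _).2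
        ⟨1 - s, by linarith, by linarith, by simp⟩⟩

theorem rect_vert (i : Fin 4) :
    (rect p u v).vert i = framePt p u v (![0, 1, 1, 0] i) (![0, 0, 1, 1] i) := by
  fin_cases i
  · change p = p + ((0 : ℝ) • u + (0 : ℝ) • v); module
  · change p + u = p + ((1 : ℝ) • u + (0 : ℝ) • v); module
  · change p + (u + v) = p + ((1 : ℝ) • u + (1 : ℝ) • v); module
  · change p + v = p + ((0 : ℝ) • u + (1 : ℝ) • v); module

/-- The coordinates of the corners in the frame determine the corner. -/
theorem rect_corner_inj : ∀ i j : Fin 4,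
    (![0, 1, 1, 0] i : ℝ) = ![0, 1, 1, 0] j ∧ (![0, 0, 1, 1] i : ℝ) = ![0, 0, 1, 1] j → i = j := by
  intro i j h
  fin_cases i <;> fin_cases j <;> simp at h ⊢

/-- Two sides meet only in a common corner, in the coordinates of the frame. -/
theorem rect_side_inter (i j : Fin 4) (hij : i ≠ j) (a b : ℝ)
    (h : (![a, 1, 1 - a, 0] i : ℝ) = ![b, 1, 1 - b, 0] j ∧
      (![0, a, 1, 1 - a] i : ℝ) = ![0, b, 1, 1 - b] j) :
    (j = finRotate 4 i ∧ (![a, 1, 1 - a, 0] i : ℝ) = ![0, 1, 1, 0] j ∧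
      (![0, a, 1, 1 - a] i : ℝ) = ![0, 0, 1, 1] j) ∨
    (i = finRotate 4 j ∧ (![a, 1, 1 - a, 0] i : ℝ) = ![0, 1, 1, 0] i ∧
      (![0, a, 1, 1 - a] i : ℝ) = ![0, 0, 1, 1] i) := by
  fin_cases i <;> fin_cases j <;> simp at h hij ⊢ <;> tauto

theorem rect_isSimplePlanar (hu : u ≠ 0) (hv : v ≠ 0) (huv : inner ℝ u v = 0) :
    (rect p u v).IsSimplePlanar where
  three_le := by change 3 ≤ 4; norm_num
  injective := by
    intro i j h
    exact rect_corner_inj i j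
      (framePt_inj hu hv huv ((rect_vert i).symm.trans (h.trans (rect_vert j))))
  coplanar := by
    have hsub : (rect p u v).vertexSet ⊆ (affineSpan ℝ {p, p + u, p + v} : Set E3) := by
      rw [rect_vertexSet]
      have hp : p ∈ affineSpan ℝ ({p, p + u, p + v} : Set E3) :=
        subset_affineSpan _ _ (by simp)
      have hu : p + u ∈ affineSpan ℝ ({p, p + u, p + v} : Set E3) :=
        subset_affineSpan _ _ (by simp)
      have hv : p + v ∈ affineSpan ℝ ({p, p + u, p + v} : Set E3) :=
        subset_affineSpan _ _ (by simp)
      rintro x (rfl | rfl | rfl | rfl)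
      · exact hp
      · exact hu
      · have h2 := AffineSubspace.smul_vsub_vadd_mem _ (1 : ℝ) hv hp hu
        have e : p + (u + v) = (1 : ℝ) • (p + v -ᵥ p) +ᵥ (p + u) := by
          simp only [vsub_eq_sub, vadd_eq_add]
          module
        rw [e]
        exact h2
      · exact hv
    have h3 : Coplanar ℝ ({p, p + u, p + v} : Set E3) := coplanar_triple ℝ p (p + u) (p + v)
    have h4 : vectorSpan ℝ (rect p u v).vertexSet ≤ vectorSpan ℝ {p, p + u, p + v} := by
      have := vectorSpan_mono ℝ hsub
      rwa [← AffineSubspace.direction_eq_vectorSpan, direction_affineSpan] at this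
    exact (Submodule.rank_mono h4).trans h3
  simple := by
    rintro i j hij x ⟨hi, hj⟩
    obtain ⟨a, -, -, rfl⟩ := (mem_edgeSet_rect i).1 hi
    obtain ⟨b, -, -, hb⟩ := (mem_edgeSet_rect j).1 hj
    have h := framePt_inj hu hv huv hb
    rcases rect_side_inter i j hij a b h with ⟨h1, h2, h3⟩ | ⟨h1, h2, h3⟩
    · exact Or.inl ⟨h1, (congrArg₂ (framePt p u v) h2 h3).trans (rect_vert j).symm⟩
    · exact Or.inr ⟨h1, (congrArg₂ (framePt p u v) h2 h3).trans (rect_vert i).symm⟩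

theorem framePt_mem_compl_boundary (hu : u ≠ 0) (hv : v ≠ 0) (huv : inner ℝ u v = 0) {s t : ℝ}
    (h : ¬ (0 ≤ s ∧ s ≤ 1 ∧ 0 ≤ t ∧ t ≤ 1)) :
    framePt p u v s t ∈
      (affineSpan ℝ (rect p u v).vertexSet : Set E3) \ (rect p u v).2.boundary ℝ := by
  refine ⟨mem_affineSpan_rect.2 ⟨s, t, rfl⟩, fun hb => h ?_⟩
  obtain ⟨s', t', e, h1, h2, h3, h4, -⟩ := mem_boundary_rect.1 hb
  obtain ⟨rfl, rfl⟩ := framePt_inj hu hv huv e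
  exact ⟨h1, h2, h3, h4⟩

/-- From a point of the plane of a rectangle that lies outside the rectangle, one can escape to
infinity in the plane along a ray that avoids the rectangle. -/
theorem exists_direction {s t : ℝ} (h : ¬ (0 ≤ s ∧ s ≤ 1 ∧ 0 ≤ t ∧ t ≤ 1)) :
    ∃ α β : ℝ, (α ≠ 0 ∨ β ≠ 0) ∧ ∀ τ : ℝ, 0 ≤ τ →
      ¬ (0 ≤ s + τ * α ∧ s + τ * α ≤ 1 ∧ 0 ≤ t + τ * β ∧ t + τ * β ≤ 1) := by
  by_cases h1 : 0 ≤ s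
  · by_cases h2 : s ≤ 1
    · by_cases h3 : 0 ≤ t
      · have h4 : ¬ t ≤ 1 := fun h4 => h ⟨h1, h2, h3, h4⟩
        exact ⟨0, 1, by simp, fun τ hτ h => by linarith [h.2.2.2]⟩
      · exact ⟨0, -1, by simp, fun τ hτ h => by linarith [h.2.2.1]⟩
    · exact ⟨1, 0, by simp, fun τ hτ h => by linarith [h.2.1]⟩
  · exact ⟨-1, 0, by simp, fun τ hτ h => by linarith [h.1]⟩

/-- The region enclosed by a rectangle, in the coordinates of its frame. -/
theorem mem_region_rect (hu : u ≠ 0) (hv : v ≠ 0) (huv : inner ℝ u v = 0) {x : E3} :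
    x ∈ (rect p u v).region ↔
      ∃ s t : ℝ, x = framePt p u v s t ∧ 0 ≤ s ∧ s ≤ 1 ∧ 0 ≤ t ∧ t ≤ 1 := by
  have huv' : inner ℝ v u = 0 := by rw [real_inner_comm]; exact huv
  have hu2 : (inner ℝ u u : ℝ) ≠ 0 := inner_self_ne_zero.mpr hu
  have hv2 : (inner ℝ v v : ℝ) ≠ 0 := inner_self_ne_zero.mpr hv
  set X : Set E3 := (affineSpan ℝ (rect p u v).vertexSet : Set E3) \ (rect p u v).2.boundary ℝ
    with hX
  constructor
  · rintro ⟨hx, hbd⟩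
    obtain ⟨s, t, rfl⟩ := mem_affineSpan_rect.1 hx
    by_contra hcon
    have hst : ¬ (0 ≤ s ∧ s ≤ 1 ∧ 0 ≤ t ∧ t ≤ 1) := fun h => hcon ⟨s, t, rfl, h⟩
    obtain ⟨α, β, hne, hray⟩ := exists_direction hst
    -- the ray is a connected part of the complement of the boundary, so it lies in the component
    have hsub : (fun τ : ℝ => framePt p u v (s + τ * α) (t + τ * β)) '' Set.Ici 0 ⊆
        connectedComponentIn X (framePt p u v s t) := by
      refine IsPreconnected.subset_connectedComponentIn ?_ ⟨0, by simp, by simp⟩ ?_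
      · refine isPreconnected_Ici.image _ (Continuous.continuousOn ?_)
        unfold framePt
        fun_prop
      · rintro _ ⟨τ, hτ, rfl⟩
        exact framePt_mem_compl_boundary hu hv huv (hray τ hτ)
    have hb := hbd.subset hsub
    obtain ⟨R, hR⟩ := hb.subset_closedBall (framePt p u v s t)
    have hw : α • u + β • v ≠ 0 := by
      intro h0
      have e : framePt p u v α β = framePt p u v 0 0 := by simp [framePt, h0]
      obtain ⟨h1, h2⟩ := framePt_inj hu hv huv e
      rcases hne with h | h
      exacts [h h1, h h2]
    have hn : 0 < ‖α • u + β • v‖ := norm_pos_iff.2 hw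
    have hR0 : 0 ≤ R := by
      have := hR ⟨0, by simp, rfl⟩
      rw [Metric.mem_closedBall] at this
      exact dist_nonneg.trans this
    have hτ : 0 ≤ (R + 1) / ‖α • u + β • v‖ := by positivity
    have := hR ⟨_, hτ, rfl⟩
    rw [Metric.mem_closedBall, dist_eq_norm] at this
    have e : framePt p u v (s + (R + 1) / ‖α • u + β • v‖ * α)
        (t + (R + 1) / ‖α • u + β • v‖ * β) - framePt p u v s t =
        ((R + 1) / ‖α • u + β • v‖) • (α • u + β • v) := by
      unfold framePt
      module
    rw [e, norm_smul, Real.norm_of_nonneg hτ, div_mul_cancel₀ _ hn.ne'] at this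
    linarith
  · rintro ⟨s, t, rfl, hs0, hs1, ht0, ht1⟩
    refine ⟨mem_affineSpan_rect.2 ⟨s, t, rfl⟩, ?_⟩
    rw [← hX]
    by_cases hb : framePt p u v s t ∈ X
    swap
    · rw [connectedComponentIn_eq_empty hb]
      exact Bornology.isBounded_empty
    have hstr : 0 < s ∧ s < 1 ∧ 0 < t ∧ t < 1 := by
      have h1 : ¬ (s = 0 ∨ s = 1 ∨ t = 0 ∨ t = 1) := fun h =>
        hb.2 (mem_boundary_rect.2 ⟨s, t, rfl, hs0, hs1, ht0, ht1, h⟩)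
      push Not at h1
      exact ⟨lt_of_le_of_ne hs0 h1.1.symm, lt_of_le_of_ne hs1 h1.2.1,
        lt_of_le_of_ne ht0 h1.2.2.1.symm, lt_of_le_of_ne ht1 h1.2.2.2⟩
    let f : E3 → ℝ := fun x => inner ℝ u (x - p) / inner ℝ u u
    let g : E3 → ℝ := fun x => inner ℝ v (x - p) / inner ℝ v v
    have hf : Continuous f := by fun_prop
    have hg : Continuous g := by fun_prop
    have hf' : ∀ a b, f (framePt p u v a b) = a := fun a b => by
      simp only [f, framePt, add_sub_cancel_left, inner_add_right, inner_smul_right, huv, mul_zero,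
        add_zero]
      field_simp
    have hg' : ∀ a b, g (framePt p u v a b) = b := fun a b => by
      simp only [g, framePt, add_sub_cancel_left, inner_add_right, inner_smul_right, huv', mul_zero,
        zero_add]
      field_simp
    -- the open rectangle and its exterior separate the complement of the boundary
    have hU : IsOpen {x : E3 | 0 < f x ∧ f x < 1 ∧ 0 < g x ∧ g x < 1} :=
      (isOpen_lt continuous_const hf).inter ((isOpen_lt hf continuous_const).inter
        ((isOpen_lt continuous_const hg).inter (isOpen_lt hg continuous_const)))
    have hV : IsOpen {x : E3 | f x < 0 ∨ 1 < f x ∨ g x < 0 ∨ 1 < g x} :=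
      (isOpen_lt hf continuous_const).union ((isOpen_lt continuous_const hf).union
        ((isOpen_lt hg continuous_const).union (isOpen_lt continuous_const hg)))
    have hsub := (isPreconnected_connectedComponentIn
      (F := X) (x := framePt p u v s t)).subset_left_of_subset_union hU hV
      (Set.disjoint_left.2 fun x h1 h2 => by
        simp only [Set.mem_ofPred_eq] at h1 h2
        rcases h2 with h | h | h | h <;> linarith [h1.1, h1.2.1, h1.2.2.1, h1.2.2.2])
      (fun x hx => by
        have hx := connectedComponentIn_subset _ _ hx
        obtain ⟨a, b, rfl⟩ := mem_affineSpan_rect.1 hx.1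
        simp only [Set.mem_union, Set.mem_ofPred_eq, hf', hg']
        by_contra hcon
        rw [not_or] at hcon
        obtain ⟨h1, h2⟩ := hcon
        push Not at h2
        refine hx.2 (mem_boundary_rect.2 ⟨a, b, rfl, h2.1, h2.2.1, h2.2.2.1, h2.2.2.2, ?_⟩)
        by_contra h3
        push Not at h3
        exact h1 ⟨lt_of_le_of_ne h2.1 h3.1.symm, lt_of_le_of_ne h2.2.1 h3.2.1,
          lt_of_le_of_ne h2.2.2.1 h3.2.2.1.symm, lt_of_le_of_ne h2.2.2.2 h3.2.2.2⟩)
      ⟨_, mem_connectedComponentIn hb, by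
        simp only [Set.mem_ofPred_eq, hf', hg']; exact hstr⟩
    refine (Metric.isBounded_closedBall (x := p) (r := ‖u‖ + ‖v‖)).subset fun x hx => ?_
    have h1 := hsub hx
    obtain ⟨a, b, rfl⟩ := mem_affineSpan_rect.1 (connectedComponentIn_subset _ _ hx).1
    simp only [Set.mem_ofPred_eq, hf', hg'] at h1
    rw [Metric.mem_closedBall, dist_eq_norm, framePt, add_sub_cancel_left]
    refine (norm_add_le _ _).trans (add_le_add ?_ ?_)
    · rw [norm_smul, Real.norm_of_nonneg h1.1.le]
      exact mul_le_of_le_one_left (norm_nonneg _) h1.2.1.le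
    · rw [norm_smul, Real.norm_of_nonneg h1.2.2.1.le]
      exact mul_le_of_le_one_left (norm_nonneg _) h1.2.2.2.le

theorem rect_region_eq_convexHull (hu : u ≠ 0) (hv : v ≠ 0) (huv : inner ℝ u v = 0) :
    (rect p u v).region = convexHull ℝ (rect p u v).vertexSet := by
  apply Set.Subset.antisymm
  · intro x hx
    obtain ⟨s, t, rfl, hs0, hs1, ht0, ht1⟩ := (mem_region_rect hu hv huv).1 hx
    rw [rect_vertexSet]
    have hc := convex_convexHull ℝ ({p, p + u, p + (u + v), p + v} : Set E3)
    have h0 : p ∈ convexHull ℝ ({p, p + u, p + (u + v), p + v} : Set E3) :=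
      subset_convexHull _ _ (by simp)
    have h1 : p + u ∈ convexHull ℝ ({p, p + u, p + (u + v), p + v} : Set E3) :=
      subset_convexHull _ _ (by simp)
    have h2 : p + (u + v) ∈ convexHull ℝ ({p, p + u, p + (u + v), p + v} : Set E3) :=
      subset_convexHull _ _ (by simp)
    have h3 : p + v ∈ convexHull ℝ ({p, p + u, p + (u + v), p + v} : Set E3) :=
      subset_convexHull _ _ (by simp)
    have h4 := hc h0 h1 (sub_nonneg.2 hs1) hs0 (sub_add_cancel 1 s)
    have h5 := hc h3 h2 (sub_nonneg.2 hs1) hs0 (sub_add_cancel 1 s)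
    have h6 := hc h4 h5 (sub_nonneg.2 ht1) ht0 (sub_add_cancel 1 t)
    have e : framePt p u v s t = (1 - t) • ((1 - s) • p + s • (p + u)) +
        t • ((1 - s) • (p + v) + s • (p + (u + v))) := by
      unfold framePt
      module
    rw [e]
    exact h6
  · refine convexHull_min ?_ ?_
    · rintro _ ⟨i, rfl⟩
      refine (mem_region_rect hu hv huv).2 ⟨_, _, rect_vert i, ?_⟩
      revert i
      change ∀ i : Fin 4, _
      intro i
      fin_cases i <;> simp
    · intro x hx y hy a b ha hb hab
      obtain ⟨s, t, rfl, hs0, hs1, ht0, ht1⟩ := (mem_region_rect hu hv huv).1 hx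
      obtain ⟨s', t', rfl, hs0', hs1', ht0', ht1'⟩ := (mem_region_rect hu hv huv).1 hy
      refine (mem_region_rect hu hv huv).2 ⟨a * s + b * s', a * t + b * t', ?_, by positivity,
        ?_, by positivity, ?_⟩
      · have : p = (a + b) • p := by rw [hab, one_smul]
        unfold framePt
        conv_rhs => rw [this]
        module
      · nlinarith
      · nlinarith

theorem rect_isRectangle (huv : inner ℝ u v = 0) : (rect p u v).IsRectangle := by
  have huv' : inner ℝ v u = 0 := by rw [real_inner_comm]; exact huv
  have key : ∀ a b c : E3, inner ℝ (a - b) (c - b) = 0 →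
      EuclideanGeometry.angle a b c = Real.pi / 2 := fun a b c h =>
    (InnerProductGeometry.inner_eq_zero_iff_angle_eq_pi_div_two _ _).1 h
  refine ⟨rfl, ?_⟩
  change ∀ i : Fin 4, _
  intro i
  fin_cases i
  · refine key (p + v) p (p + u) ?_
    simpa using huv'
  · refine key p (p + u) (p + (u + v)) ?_
    simpa using huv
  · refine key (p + u) (p + (u + v)) (p + v) ?_
    simpa using huv'
  · refine key (p + (u + v)) (p + v) p ?_
    simpa using huv

/-- The only inward normal at the first side is the direction of the second one. -/
theorem rect_isInward (hu : u ≠ 0) (hv : v ≠ 0) (huv : inner ℝ u v = 0) {w : E3} :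
    (rect p u v).IsInward p (p + u) w ↔ w = ‖v‖⁻¹ • v := by
  have huv' : inner ℝ v u = 0 := by rw [real_inner_comm]; exact huv
  have hm : midpoint ℝ p (p + u) = p + (2⁻¹ : ℝ) • u := by
    rw [midpoint_eq_smul_add, invOf_eq_inv]; module
  have hv0 : 0 < ‖v‖ := norm_pos_iff.2 hv
  unfold Face.IsInward
  rw [hm, add_sub_cancel_left]
  constructor
  · rintro ⟨h1, h2, h3⟩
    obtain ⟨τ, h4, hτ⟩ := (h3.and self_mem_nhdsWithin).exists
    have hτ : 0 < τ := hτ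
    obtain ⟨s, t, e, -, -, ht, -⟩ := (mem_region_rect hu hv huv).1 h4
    have e' : τ • w = (s - 2⁻¹) • u + t • v := by
      have := congrArg (fun x => x - (p + (2⁻¹ : ℝ) • u)) e
      simp only [add_sub_cancel_left] at this
      rw [this]
      unfold framePt
      module
    have hs : s - 2⁻¹ = 0 := by
      have := congrArg (fun x => inner ℝ x u) e'
      simp only [inner_add_left, real_inner_smul_left, h2, huv', mul_zero, add_zero] at this
      exact (mul_eq_zero.1 this.symm).resolve_right (inner_self_ne_zero.mpr hu)
    rw [hs, zero_smul, zero_add] at e'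
    have hn := congrArg norm e'
    rw [norm_smul, norm_smul, h1, mul_one, Real.norm_of_nonneg hτ.le, Real.norm_of_nonneg ht] at hn
    have : w = τ⁻¹ • (t • v) := by rw [← e', smul_smul, inv_mul_cancel₀ hτ.ne', one_smul]
    rw [this, smul_smul, hn]
    have ht0 : t ≠ 0 := by
      rintro rfl
      simp at hn
      exact hτ.ne' hn
    congr 1
    field_simp
  · rintro rfl
    refine ⟨?_, ?_, ?_⟩
    · rw [norm_smul, norm_inv, norm_norm, inv_mul_cancel₀ hv0.ne']
    · rw [real_inner_smul_left, huv', mul_zero]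
    · have : ∀ᶠ τ : ℝ in 𝓝[>] 0, τ < ‖v‖ :=
        nhdsWithin_le_nhds (eventually_lt_nhds hv0)
      filter_upwards [this, self_mem_nhdsWithin] with τ h1 h2
      have h2 : 0 < τ := h2
      refine (mem_region_rect hu hv huv).2 ⟨2⁻¹, τ * ‖v‖⁻¹, ?_, by norm_num, by norm_num,
        by positivity, ?_⟩
      · unfold framePt
        module
      · rw [← div_eq_mul_inv, div_le_one hv0]
        exact h1.le

end Rect

/-! ### Polyhedra from families of quadrilaterals -/

/-- If a linear functional separates two finite sets and every point of the first one on the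
separating plane belongs to the second one, then the convex hulls meet in the convex hull of the
common points. -/
theorem convexHull_inter_of_separated {A B : Set E3} (l : E3 →ₗ[ℝ] ℝ) (c : ℝ)
    (hA : ∀ x ∈ A, l x ≤ c) (hB : ∀ x ∈ B, c ≤ l x) (hZ : ∀ x ∈ A, l x = c → x ∈ B) :
    convexHull ℝ A ∩ convexHull ℝ B = convexHull ℝ (A ∩ B) := by
  apply Set.Subset.antisymm
  · rintro x ⟨hxA, hxB⟩
    have h1 : c ≤ l x :=
      convexHull_min (t := {y | c ≤ l y}) hB (convex_halfSpace_ge l.isLinear c) hxB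
    have h2 : x ∈ {y | l y ≤ c ∧ (l y = c → y ∈ convexHull ℝ (A ∩ B))} := by
      refine convexHull_min ?_ ?_ hxA
      · exact fun y hy => ⟨hA y hy, fun h => subset_convexHull _ _ ⟨hy, hZ y hy h⟩⟩
      · rintro y ⟨hy1, hy2⟩ z ⟨hz1, hz2⟩ a b ha hb hab
        have hl : l (a • y + b • z) = a * l y + b * l z := by simp
        refine ⟨?_, fun h => ?_⟩
        · calc l (a • y + b • z) = a * l y + b * l z := hl
            _ ≤ a * c + b * c := by gcongr
            _ = c := by rw [← add_mul, hab, one_mul]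
        rw [hl] at h
        have h0 : a * (c - l y) + b * (c - l z) = 0 := by linear_combination c * hab - h
        rcases ha.eq_or_lt with rfl | ha
        · obtain rfl : b = 1 := by linarith
          simp only [zero_mul, zero_add, one_mul] at h
          simpa using hz2 h
        rcases hb.eq_or_lt with rfl | hb
        · obtain rfl : a = 1 := by linarith
          simp only [zero_mul, add_zero, one_mul] at h
          simpa using hy2 h
        have ey : l y = c := by
          refine le_antisymm hy1 ?_
          have := mul_nonneg hb.le (sub_nonneg.2 hz1)
          exact sub_nonpos.1 (nonpos_of_mul_nonpos_right (by linarith) ha)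
        have ez : l z = c := by
          refine le_antisymm hz1 ?_
          have := mul_nonneg ha.le (sub_nonneg.2 hy1)
          exact sub_nonpos.1 (nonpos_of_mul_nonpos_right (by linarith) hb)
        exact convex_convexHull ℝ _ (hy2 ey) (hz2 ez) ha.le hb.le hab
    exact h2.2 (le_antisymm h2.1 h1)
  · exact Set.subset_inter (convexHull_mono Set.inter_subset_left)
      (convexHull_mono Set.inter_subset_right)

section QuadSurface

variable {ι V : Type}

/-- The quadrilaterals `F i`, given by their vertices in cyclic order, placed in space by `ρ`. -/
def realize (F : ι → Fin 4 → V) (ρ : V → E3) (i : ι) : Face := ⟨4, ⟨fun p => ρ (F i p)⟩⟩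

/-- The vertices `a` and `b` are consecutive in the `j`-th quadrilateral. -/
def HasSide (F : ι → Fin 4 → V) (j : ι) (a b : V) : Prop :=
  ∃ q, (F j q = a ∧ F j (q + 1) = b) ∨ (F j q = b ∧ F j (q + 1) = a)

/-- The neighbours of the `p`-th vertex of the `i`-th quadrilateral are `a` and `b`. -/
def IsCorner (F : ι → Fin 4 → V) (i : ι) (p : Fin 4) (a b : V) : Prop :=
  (F i (p + 1) = a ∧ F i (p + 3) = b) ∨ (F i (p + 3) = a ∧ F i (p + 1) = b)

/-- The common vertices of two quadrilaterals are none, or one, or the ends of a common side. -/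
def MeetProperly (F : ι → Fin 4 → V) (i j : ι) : Prop :=
  (∀ p q, F i p ≠ F j q) ∨
  (∃ p q, F i p = F j q ∧ ∀ p' q', F i p' = F j q' → p' = p) ∨
  (∃ p, HasSide F j (F i p) (F i (p + 1)) ∧ ∀ p' q', F i p' = F j q' → p' = p ∨ p' = p + 1)

/-- The side of the `i`-th quadrilateral that starts at its `p`-th vertex is a side of the `j`-th
one and of no others. -/
def IsMate (F : ι → Fin 4 → V) (i : ι) (p : Fin 4) (j : ι) : Prop :=
  (j ≠ i ∧ HasSide F j (F i p) (F i (p + 1))) ∧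
    ∀ j', HasSide F j' (F i p) (F i (p + 1)) → j' = i ∨ j' = j

/-- The corners at `v` of the quadrilaterals are exactly those between consecutive elements of the
cyclic sequence `c`. -/
def IsVertexCycle (F : ι → Fin 4 → V) (v : V) {n : ℕ} [NeZero n] (c : Fin n → V) : Prop :=
  (∀ k, ∃ i p, F i p = v ∧ IsCorner F i p (c k) (c (k + 1))) ∧
    ∀ i p, F i p = v → ∃ k, IsCorner F i p (c k) (c (k + 1))

/-- The incidence conditions on a family of quadrilaterals: the vertices of each one are distinct,
two of them have no common vertex, one common vertex or one common side, each side is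
shared by exactly two of them, and around each vertex they form a cycle. -/
structure IsClosedQuadSurface (F : ι → Fin 4 → V) : Prop where
  surj : ∀ v, ∃ i p, F i p = v
  inj : ∀ i p q, F i p = F i q → p = q
  common : ∀ i j, i ≠ j → MeetProperly F i j
  two : ∀ i p, ∃ j, IsMate F i p j
  cyc : ∀ v, ∃ (n : ℕ) (c : Fin (n + 3) → V), Function.Injective c ∧
    IsVertexCycle F v c

/-- The metric conditions on a family of quadrilaterals placed in space: each is a rectangle, and
any two are separated by a plane that contains no vertices of one of them other
than common ones. -/
structure IsRectangular (F : ι → Fin 4 → V) (ρ : V → E3) : Prop where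
  inj : Function.Injective ρ
  par : ∀ i, ρ (F i 2) = ρ (F i 1) + ρ (F i 3) - ρ (F i 0)
  perp : ∀ i, inner ℝ (ρ (F i 1) - ρ (F i 0)) (ρ (F i 3) - ρ (F i 0)) = 0
  sep : ∀ i j, i ≠ j → ∃ (l : E3 →ₗ[ℝ] ℝ) (c : ℝ), (∀ p, l (ρ (F i p)) ≤ c) ∧
    (∀ q, c ≤ l (ρ (F j q))) ∧ ((∀ p, l (ρ (F i p)) = c → ∃ q, F j q = F i p) ∨
      ∀ q, l (ρ (F j q)) = c → ∃ p, F i p = F j q)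

section Realize

variable {F : ι → Fin 4 → V} {ρ : V → E3}

theorem realize_vertexSet (i : ι) : (realize F ρ i).vertexSet = Set.range fun p => ρ (F i p) :=
  rfl

theorem mem_edges_realize {i : ι} {e : Sym2 E3} :
    e ∈ (realize F ρ i).edges ↔ ∃ p, e = s(ρ (F i p), ρ (F i (p + 1))) := by
  change (∃ p : Fin 4, e = s(ρ (F i p), ρ (F i (finRotate 4 p)))) ↔ _
  simp only [finRotate_apply]

theorem mk_mem_edges_realize (hρ : Function.Injective ρ) {i : ι} {a b : V} :
    s(ρ a, ρ b) ∈ (realize F ρ i).edges ↔ HasSide F i a b := by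
  rw [mem_edges_realize, HasSide]
  refine exists_congr fun p => ?_
  rw [Sym2.eq_iff, hρ.eq_iff, hρ.eq_iff, hρ.eq_iff, hρ.eq_iff]
  constructor
  · rintro (⟨rfl, rfl⟩ | ⟨rfl, rfl⟩) <;> simp
  · rintro (⟨rfl, rfl⟩ | ⟨rfl, rfl⟩) <;> simp

/-- A quadrilateral whose vertices satisfy the parallelogram law is a parallelogram. -/
theorem eq_rect_of_vert {f : Fin 4 → E3} (h : f 2 = f 1 + f 3 - f 0) :
    (⟨4, ⟨f⟩⟩ : Face) = rect (f 0) (f 1 - f 0) (f 3 - f 0) := by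
  have : f = ![f 0, f 0 + (f 1 - f 0), f 0 + ((f 1 - f 0) + (f 3 - f 0)), f 0 + (f 3 - f 0)] := by
    funext i
    fin_cases i
    · rfl
    · simp
    · simp only [Fin.reduceFinMk, Matrix.cons_val, h]; abel
    · simp
  unfold rect quad
  rw [← this]

namespace IsRectangular

variable (hR : IsRectangular F ρ) (hF : IsClosedQuadSurface F)
include hR hF

omit hF in
theorem realize_eq_rect (i : ι) : realize F ρ i =
    rect (ρ (F i 0)) (ρ (F i 1) - ρ (F i 0)) (ρ (F i 3) - ρ (F i 0)) :=
  eq_rect_of_vert (f := fun p => ρ (F i p)) (hR.par i)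

theorem sub_ne_zero (i : ι) {p q : Fin 4} (h : p ≠ q) : ρ (F i p) - ρ (F i q) ≠ 0 :=
  _root_.sub_ne_zero.2 fun e => h (hF.inj i p q (hR.inj e))

theorem isSimplePlanar (i : ι) : (realize F ρ i).IsSimplePlanar := by
  rw [hR.realize_eq_rect]
  exact rect_isSimplePlanar (hR.sub_ne_zero hF i (by decide)) (hR.sub_ne_zero hF i (by decide))
    (hR.perp i)

omit hF in
theorem isRectangle (i : ι) : (realize F ρ i).IsRectangle := by
  rw [hR.realize_eq_rect]
  exact rect_isRectangle (hR.perp i)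

theorem region_eq (i : ι) :
    (realize F ρ i).region = convexHull ℝ (Set.range fun p => ρ (F i p)) := by
  rw [← realize_vertexSet, hR.realize_eq_rect]
  exact rect_region_eq_convexHull (hR.sub_ne_zero hF i (by decide))
    (hR.sub_ne_zero hF i (by decide)) (hR.perp i)

/-- Two faces meet in the convex hull of their common vertices, because of the separating plane. -/
theorem region_inter {i j : ι} (hij : i ≠ j) :
    (realize F ρ i).region ∩ (realize F ρ j).region =
      convexHull ℝ ((Set.range fun p => ρ (F i p)) ∩ Set.range fun p => ρ (F j p)) := by
  rw [hR.region_eq hF, hR.region_eq hF]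
  obtain ⟨l, c, hi, hj, h | h⟩ := hR.sep i j hij
  · refine convexHull_inter_of_separated l c ?_ ?_ ?_
    · rintro _ ⟨p, rfl⟩; exact hi p
    · rintro _ ⟨p, rfl⟩; exact hj p
    · rintro _ ⟨p, rfl⟩ hp
      obtain ⟨q, hq⟩ := h p hp
      exact ⟨q, congrArg ρ hq⟩
  · rw [Set.inter_comm, Set.inter_comm (Set.range _)]
    refine convexHull_inter_of_separated (-l) (-c) ?_ ?_ ?_
    · rintro _ ⟨p, rfl⟩; simpa using hj p
    · rintro _ ⟨p, rfl⟩; simpa using hi p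
    · rintro _ ⟨p, rfl⟩ hp
      obtain ⟨q, hq⟩ := h p (by simpa using hp)
      exact ⟨q, congrArg ρ hq⟩

/-- The link of a vertex is isomorphic to the cycle formed by the neighbouring vertices. -/
theorem exists_link_iso (v : V) :
    ∃ n : ℕ, Nonempty (SimpleGraph.cycleGraph (n + 3) ≃g link (realize F ρ) (ρ v)) := by
  obtain ⟨n, c, hc, h1, h2⟩ := hF.cyc v
  have hedge : ∀ k, ∃ i, HasSide F i v (c k) := by
    intro k
    obtain ⟨i, p, rfl, (⟨h, -⟩ | ⟨h, -⟩)⟩ := h1 k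
    · exact ⟨i, p, Or.inl ⟨rfl, h⟩⟩
    · exact ⟨i, p + 3, Or.inr ⟨h, by rw [add_assoc]; simp⟩⟩
  have hnbr : ∀ i w, HasSide F i v w → ∃ p, F i p = v ∧ (F i (p + 1) = w ∨ F i (p + 3) = w) := by
    rintro i w ⟨q, (⟨h, h'⟩ | ⟨h, h'⟩)⟩
    · exact ⟨q, h, Or.inl h'⟩
    · exact ⟨q + 1, h', Or.inr (by rw [add_assoc]; simpa using h)⟩
  let f : Fin (n + 3) → {e : Sym2 E3 // e ∈ edges (realize F ρ) ∧ ρ v ∈ e} := fun k =>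
    ⟨s(ρ v, ρ (c k)), by
      obtain ⟨i, hi⟩ := hedge k
      exact Set.mem_iUnion.2 ⟨i, (mk_mem_edges_realize hR.inj).2 hi⟩, Sym2.mem_mk_left _ _⟩
  have hf : Function.Injective f := fun k l h =>
    hc (hR.inj (Sym2.congr_right.1 (congrArg Subtype.val h)))
  have hf' : Function.Surjective f := by
    rintro ⟨e, he, hv⟩
    obtain ⟨w, rfl⟩ := Sym2.mem_iff_exists.1 hv
    obtain ⟨i, hi⟩ := Set.mem_iUnion.1 he
    obtain ⟨w, rfl⟩ : ∃ w', w = ρ w' := by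
      obtain ⟨p, hp⟩ := mem_edges_realize.1 hi
      have : w ∈ s(ρ (F i p), ρ (F i (p + 1))) := hp ▸ Sym2.mem_mk_right _ _
      rcases Sym2.mem_iff.1 this with rfl | rfl
      exacts [⟨_, rfl⟩, ⟨_, rfl⟩]
    obtain ⟨p, hp, hw⟩ := hnbr i w ((mk_mem_edges_realize hR.inj).1 hi)
    have : ∃ k, c k = w := by
      obtain ⟨k, (⟨ha, hb⟩ | ⟨ha, hb⟩)⟩ := h2 i p hp
      · rcases hw with rfl | rfl
        exacts [⟨k, ha.symm⟩, ⟨k + 1, hb.symm⟩]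
      · rcases hw with rfl | rfl
        exacts [⟨k + 1, hb.symm⟩, ⟨k, ha.symm⟩]
    obtain ⟨k, rfl⟩ := this
    exact ⟨k, rfl⟩
  refine ⟨n, ⟨⟨Equiv.ofBijective f ⟨hf, hf'⟩, ?_⟩⟩⟩
  intro k l
  rw [SimpleGraph.cycleGraph_adj]
  change (f k ≠ f l ∧ ∃ i, (f k).1 ∈ (realize F ρ i).edges ∧ (f l).1 ∈ (realize F ρ i).edges) ↔ _
  simp only [f, mk_mem_edges_realize hR.inj]
  constructor
  · rintro ⟨hkl, i, hi, hi'⟩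
    have hkl : k ≠ l := fun h => hkl (by rw [h])
    obtain ⟨p, hp, hw⟩ := hnbr i _ hi
    obtain ⟨p', hp', hw'⟩ := hnbr i _ hi'
    obtain rfl := hF.inj i _ _ (hp.trans hp'.symm)
    obtain ⟨m, (⟨ha, hb⟩ | ⟨ha, hb⟩)⟩ := h2 i p hp <;> rw [ha, hb] at hw hw' <;>
      rcases hw with hw | hw <;> rcases hw' with hw' | hw' <;>
      have e := hc hw <;> have e' := hc hw' <;> subst e <;> first
        | exact absurd e' hkl
        | (subst e'; simp)
  · have key : ∀ k l : Fin (n + 3), l - k = 1 →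
        f k ≠ f l ∧ ∃ i, HasSide F i v (c k) ∧ HasSide F i v (c l) := by
      intro k l h
      obtain rfl : l = k + 1 := by rw [← h]; abel
      refine ⟨fun e => ?_, ?_⟩
      · have := hf e
        simp at this
      · obtain ⟨i, p, rfl, (⟨h, h'⟩ | ⟨h, h'⟩)⟩ := h1 k
        · exact ⟨i, ⟨p, Or.inl ⟨rfl, h⟩⟩, p + 3, Or.inr ⟨h', by rw [add_assoc]; simp⟩⟩
        · exact ⟨i, ⟨p + 3, Or.inr ⟨h, by rw [add_assoc]; simp⟩⟩, p, Or.inl ⟨rfl, h'⟩⟩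
    rintro (h | h)
    · obtain ⟨hne, i, hi, hi'⟩ := key l k h
      exact ⟨hne.symm, i, hi', hi⟩
    · exact key k l h

theorem isPolyhedron [Finite ι] : IsPolyhedron (realize F ρ) where
  finite := inferInstance
  simple := hR.isSimplePlanar hF
  inter := by
    intro i j hij
    rw [Set.disjoint_iff_inter_eq_empty, hR.region_inter hF hij]
    rcases hF.common i j hij with h | ⟨p, q, hpq, h⟩ | ⟨p, hs, h⟩
    · left
      have : ((Set.range fun p => ρ (F i p)) ∩ Set.range fun p => ρ (F j p)) = ∅ := by
        ext x
        simp only [Set.mem_inter_iff, Set.mem_range, Set.mem_empty_iff_false, iff_false]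
        rintro ⟨⟨p, rfl⟩, q, hq⟩
        exact h p q (hR.inj hq.symm)
      rw [this, convexHull_empty]
    · right; left
      refine ⟨ρ (F i p), ⟨p, rfl⟩, ⟨q, congrArg ρ hpq.symm⟩, ?_⟩
      have : ((Set.range fun p => ρ (F i p)) ∩ Set.range fun p => ρ (F j p)) = {ρ (F i p)} := by
        ext x
        simp only [Set.mem_inter_iff, Set.mem_range, Set.mem_singleton_iff]
        constructor
        · rintro ⟨⟨p', rfl⟩, q', hq⟩
          rw [h p' q' (hR.inj hq.symm)]
        · rintro rfl
          exact ⟨⟨p, rfl⟩, ⟨q, congrArg ρ hpq.symm⟩⟩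
      rw [this, convexHull_singleton]
    · right; right
      refine ⟨ρ (F i p), ρ (F i (p + 1)), (mk_mem_edges_realize hR.inj).2 ⟨p, Or.inl ⟨rfl, rfl⟩⟩,
        (mk_mem_edges_realize hR.inj).2 hs, ?_⟩
      have : ((Set.range fun p => ρ (F i p)) ∩ Set.range fun p => ρ (F j p)) =
          {ρ (F i p), ρ (F i (p + 1))} := by
        ext x
        simp only [Set.mem_inter_iff, Set.mem_range, Set.mem_insert_iff, Set.mem_singleton_iff]
        constructor
        · rintro ⟨⟨p', rfl⟩, q', hq⟩
          rcases h p' q' (hR.inj hq.symm) with rfl | rfl <;> simp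
        · obtain ⟨q, (⟨ha, hb⟩ | ⟨ha, hb⟩)⟩ := hs
          · rintro (rfl | rfl)
            exacts [⟨⟨p, rfl⟩, q, congrArg ρ ha⟩, ⟨⟨p + 1, rfl⟩, q + 1, congrArg ρ hb⟩]
          · rintro (rfl | rfl)
            exacts [⟨⟨p, rfl⟩, q + 1, congrArg ρ hb⟩, ⟨⟨p + 1, rfl⟩, q, congrArg ρ ha⟩]
      rw [this, convexHull_pair]
  two_faces := by
    intro e he
    obtain ⟨i, hi⟩ := Set.mem_iUnion.1 he
    obtain ⟨p, rfl⟩ := mem_edges_realize.1 hi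
    obtain ⟨j, ⟨hji, hj⟩, h⟩ := hF.two i p
    have h : ∀ j', HasSide F j' (F i p) (F i (p + 1)) → j' = i ∨ j' = j := h
    rw [Set.ncard_eq_two]
    refine ⟨i, j, hji.symm, ?_⟩
    ext j'
    simp only [Set.mem_ofPred_eq, mk_mem_edges_realize hR.inj, Set.mem_insert_iff,
      Set.mem_singleton_iff]
    constructor
    · exact h j'
    · rintro (rfl | rfl)
      exacts [⟨p, Or.inl ⟨rfl, rfl⟩⟩, hj]
  link_cycle := by
    intro x hx
    obtain ⟨i, p, rfl⟩ := Set.mem_iUnion.1 hx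
    obtain ⟨n, ⟨φ⟩⟩ := hR.exists_link_iso hF (F i p)
    refine ⟨φ.connected_iff.1 SimpleGraph.cycleGraph_connected, fun e => ?_⟩
    obtain ⟨k, rfl⟩ := φ.surjective e
    have h : (link (realize F ρ) (ρ (F i p))).neighborSet (φ k) =
        φ '' (SimpleGraph.cycleGraph (n + 3)).neighborSet k := by
      ext e
      obtain ⟨l, rfl⟩ := φ.surjective e
      simp [SimpleGraph.mem_neighborSet, φ.map_adj_iff]
    change ((link (realize F ρ) (ρ (F i p))).neighborSet (φ k)).ncard = 2
    rw [h, Set.ncard_image_of_injective _ φ.injective, Set.ncard_eq_toFinset_card']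
    rw [← SimpleGraph.neighborFinset_def, SimpleGraph.card_neighborFinset_eq_degree]
    exact SimpleGraph.cycleGraph_degree_three_le

omit hR in
theorem vertices_eq : vertices (realize F ρ) = Set.range ρ := by
  ext x
  simp only [vertices, Set.mem_iUnion, realize_vertexSet, Set.mem_range]
  constructor
  · rintro ⟨i, p, rfl⟩
    exact ⟨_, rfl⟩
  · rintro ⟨v, rfl⟩
    obtain ⟨i, p, rfl⟩ := hF.surj v
    exact ⟨i, p, rfl⟩

theorem ncard_vertices : (vertices (realize F ρ)).ncard = Nat.card V := by
  rw [vertices_eq hF, ← Set.image_univ, Set.ncard_image_of_injective _ hR.inj, Set.ncard_univ]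

/-- A union of rectangles is connected if each of them except one has a common vertex with one of
lower rank. -/
theorem isConnected_biUnion {t : Set ι} {r : ι} (hr : r ∈ t) (rank : ι → ℕ)
    (h : ∀ i ∈ t, i ≠ r → ∃ j ∈ t, rank j < rank i ∧ ∃ p q, F i p = F j q) :
    IsConnected (⋃ i ∈ t, (realize F ρ i).region) := by
  have hmem : ∀ i p, ρ (F i p) ∈ (realize F ρ i).region := fun i p => by
    rw [hR.region_eq hF]
    exact subset_convexHull _ _ ⟨p, rfl⟩
  have hinter : ∀ i j p q, F i p = F j q →
      ((realize F ρ i).region ∩ (realize F ρ j).region).Nonempty := fun i j p q e =>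
    ⟨ρ (F i p), hmem i p, e ▸ hmem j q⟩
  let R : ι → ι → Prop := fun i j =>
    ((realize F ρ i).region ∩ (realize F ρ j).region).Nonempty ∧ i ∈ t
  have hR1 : ∀ n i, rank i = n → i ∈ t → Relation.ReflTransGen R i r ∧
      Relation.ReflTransGen R r i := by
    intro n
    induction n using Nat.strong_induction_on with
    | _ n ih =>
      intro i hn hi
      by_cases hir : i = r
      · subst hir
        exact ⟨.refl, .refl⟩
      obtain ⟨j, hj, hlt, p, q, e⟩ := h i hi hir
      obtain ⟨h1, h2⟩ := ih _ (hn ▸ hlt) j rfl hj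
      exact ⟨.head ⟨hinter i j p q e, hi⟩ h1, h2.tail ⟨hinter j i q p e.symm, hj⟩⟩
  refine IsConnected.biUnion_of_reflTransGen ⟨r, hr⟩ (fun i _ => ?_) fun i hi j hj =>
    (hR1 _ i rfl hi).1.trans (hR1 _ j rfl hj).2
  refine ⟨⟨_, hmem i 0⟩, ?_⟩
  rw [hR.region_eq hF]
  exact (convex_convexHull ℝ _).isPreconnected

end IsRectangular
end Realize

end QuadSurface

/-! ### Edge counts and inward normals -/

/-- The number of edges of a polyhedron with quadrilateral faces is twice the number of faces. -/
theorem IsPolyhedron.ncard_edges {ι : Type} {P : ι → Face} (hP : IsPolyhedron P)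
    (h4 : ∀ i, (P i).1 = 4) : (edges P).Finite ∧ (edges P).ncard = 2 * Nat.card ι := by
  classical
  have := hP.finite
  have := Fintype.ofFinite ι
  have hface : ∀ f : Face, f.IsSimplePlanar → f.1 = 4 → f.edges.Finite ∧ f.edges.ncard = 4 := by
    rintro ⟨n, f⟩ hf rfl
    have hr : Face.edges ⟨4, f⟩ =
        Set.range fun p : Fin 4 => s(f.vertices p, f.vertices (p + 1)) := by
      ext e
      change (∃ p : Fin 4, e = s(f.vertices p, f.vertices (finRotate 4 p))) ↔ _
      simp only [finRotate_apply, Set.mem_range, eq_comm]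
    have hinj : Function.Injective fun p : Fin 4 => s(f.vertices p, f.vertices (p + 1)) := by
      have hi : Function.Injective f.vertices := hf.injective
      intro p q h
      rcases Sym2.eq_iff.1 h with ⟨h1, -⟩ | ⟨h1, h2⟩
      · exact hi h1
      · have h1 := hi h1
        have h2 := hi h2
        exact (by decide : ∀ p q : Fin 4, p = q + 1 → p + 1 = q → p = q) p q h1 h2
    rw [hr]
    refine ⟨Set.finite_range _, ?_⟩
    rw [← Set.image_univ, Set.ncard_image_of_injective _ hinj, Set.ncard_univ, Nat.card_fin]
  have hfin : (edges P).Finite := Set.finite_iUnion fun i => (hface _ (hP.simple i) (h4 i)).1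
  refine ⟨hfin, ?_⟩
  -- double counting: an edge lies in two faces, and a face has four edges
  have key := Finset.card_mul_eq_card_mul (s := hfin.toFinset) (t := (Finset.univ : Finset ι))
    (fun e i => e ∈ (P i).edges) (m := 2) (n := 4) ?_ ?_
  · rw [Set.ncard_eq_toFinset_card _ hfin, Nat.card_eq_fintype_card]
    rw [Finset.card_univ] at key
    omega
  · intro e he
    rw [Set.Finite.mem_toFinset] at he
    rw [← hP.two_faces e he, ← Set.ncard_coe_finset]
    congr 1
    ext i
    simp [Finset.bipartiteAbove]
  · intro i _
    rw [← (hface _ (hP.simple i) (h4 i)).2, ← Set.ncard_coe_finset]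
    congr 1
    ext e
    simp only [Finset.bipartiteBelow, Finset.coe_filter, Set.Finite.mem_toFinset,
      Set.mem_ofPred_eq, and_iff_right_iff_imp]
    exact fun h => Set.mem_iUnion.2 ⟨i, h⟩

section Metric

variable {ι V : Type} {F : ι → Fin 4 → V} {ρ : V → E3}

namespace IsRectangular
variable (hR : IsRectangular F ρ) (hF : IsClosedQuadSurface F)
include hR hF

/-- The inward normal of a face at the side starting at its `p`-th vertex points along the
preceding side. -/
theorem isInward_iff (i : ι) (p : Fin 4) {w : E3} :
    (realize F ρ i).IsInward (ρ (F i p)) (ρ (F i (p + 1))) w ↔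
      w = ‖ρ (F i (p + 3)) - ρ (F i p)‖⁻¹ • (ρ (F i (p + 3)) - ρ (F i p)) := by
  have par0 := hR.par i
  have perp0 := hR.perp i
  have h1 : ρ (F i (p + 1)) - ρ (F i p) ≠ 0 :=
    hR.sub_ne_zero hF i ((by decide : ∀ p : Fin 4, p + 1 ≠ p) p)
  have h3 : ρ (F i (p + 3)) - ρ (F i p) ≠ 0 :=
    hR.sub_ne_zero hF i ((by decide : ∀ p : Fin 4, p + 3 ≠ p) p)
  have hpar : ρ (F i (p + 2)) = ρ (F i (p + 1)) + ρ (F i (p + 3)) - ρ (F i p) := by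
    fin_cases p
    · exact par0
    · change ρ (F i 3) = ρ (F i 2) + ρ (F i 0) - ρ (F i 1)
      rw [par0]; abel
    · change ρ (F i 0) = ρ (F i 3) + ρ (F i 1) - ρ (F i 2)
      rw [par0]; abel
    · change ρ (F i 1) = ρ (F i 0) + ρ (F i 2) - ρ (F i 3)
      rw [par0]; abel
  have hperp : inner ℝ (ρ (F i (p + 1)) - ρ (F i p)) (ρ (F i (p + 3)) - ρ (F i p)) = 0 := by
    set u := ρ (F i 1) - ρ (F i 0)
    set v := ρ (F i 3) - ρ (F i 0)
    have h2u : ρ (F i 2) - ρ (F i 3) = u := by rw [par0]; simp only [u]; abel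
    have h2v : ρ (F i 2) - ρ (F i 1) = v := by rw [par0]; simp only [v]; abel
    fin_cases p
    · exact perp0
    · change inner ℝ (ρ (F i 2) - ρ (F i 1)) (ρ (F i 0) - ρ (F i 1)) = 0
      rw [h2v, ← neg_sub, inner_neg_right, real_inner_comm, perp0, neg_zero]
    · change inner ℝ (ρ (F i 3) - ρ (F i 2)) (ρ (F i 1) - ρ (F i 2)) = 0
      rw [← neg_sub, h2u, ← neg_sub, h2v, inner_neg_neg, perp0]
    · change inner ℝ (ρ (F i 0) - ρ (F i 3)) (ρ (F i 2) - ρ (F i 3)) = 0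
      rw [h2u, ← neg_sub, inner_neg_left, real_inner_comm, perp0, neg_zero]
  have hreg : (realize F ρ i).region = (rect (ρ (F i p)) (ρ (F i (p + 1)) - ρ (F i p))
      (ρ (F i (p + 3)) - ρ (F i p))).region := by
    rw [hR.region_eq hF, rect_region_eq_convexHull h1 h3 hperp, rect_vertexSet]
    congr 1
    have e1 : ρ (F i p) + (ρ (F i (p + 1)) - ρ (F i p)) = ρ (F i (p + 1)) := by abel
    have e2 : ρ (F i p) + (ρ (F i (p + 1)) - ρ (F i p) + (ρ (F i (p + 3)) - ρ (F i p))) =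
      ρ (F i (p + 2)) := by rw [hpar]; abel
    have e3 : ρ (F i p) + (ρ (F i (p + 3)) - ρ (F i p)) = ρ (F i (p + 3)) := by abel
    rw [e1, e2, e3]
    ext x
    simp only [Set.mem_range, Set.mem_insert_iff, Set.mem_singleton_iff]
    constructor
    · rintro ⟨q, rfl⟩
      have : q = p ∨ q = p + 1 ∨ q = p + 2 ∨ q = p + 3 :=
        (by decide : ∀ p q : Fin 4, q = p ∨ q = p + 1 ∨ q = p + 2 ∨ q = p + 3) p q
      rcases this with rfl | rfl | rfl | rfl <;> simp
    · rintro (rfl | rfl | rfl | rfl)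
      exacts [⟨_, rfl⟩, ⟨_, rfl⟩, ⟨_, rfl⟩, ⟨_, rfl⟩]
  rw [← rect_isInward (p := ρ (F i p)) h1 h3 hperp]
  unfold Face.IsInward
  rw [hreg, add_sub_cancel]

end IsRectangular

theorem isInward_comm {f : Face} {a b w : E3} : f.IsInward a b w ↔ f.IsInward b a w := by
  unfold Face.IsInward
  rw [midpoint_comm, ← neg_sub b a, inner_neg_right, neg_eq_zero]

/-- If neither the inner product of two vectors vanishes nor equality holds in the Cauchy-Schwarz
inequality for them, then their angle is not a multiple of a right angle. -/
theorem not_isRectilinear_angle {x y : E3} (h0 : inner ℝ x y ≠ 0)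
    (h1 : (inner ℝ x y : ℝ) ^ 2 ≠ inner ℝ x x * inner ℝ y y) :
    ¬ IsRectilinear (InnerProductGeometry.angle x y) := by
  rintro ⟨k, hk⟩
  have hc := InnerProductGeometry.cos_angle_mul_norm_mul_norm x y
  have hs : Real.sin (2 * InnerProductGeometry.angle x y) = 0 := by
    rw [hk, show 2 * ((k : ℝ) * (Real.pi / 2)) = k * Real.pi by ring]
    exact Real.sin_int_mul_pi k
  rw [Real.sin_two_mul] at hs
  rcases mul_eq_zero.1 hs with hs | hs
  · have hs : Real.sin (InnerProductGeometry.angle x y) = 0 := by linarith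
    have := Real.sin_sq_add_cos_sq (InnerProductGeometry.angle x y)
    apply h1
    rw [← hc, real_inner_self_eq_norm_sq, real_inner_self_eq_norm_sq]
    rw [hs] at this
    linear_combination (‖x‖ * ‖y‖) ^ 2 * this
  · rw [hs, zero_mul] at hc
    exact h0 hc.symm

end Metric

/-! ### Vertices with integral coefficients -/

/-- The value at `w` of the linear functional with coefficients `n`. -/
def dot (n w : Fin 3 → ℤ) : ℤ := n 0 * w 0 + n 1 * w 1 + n 2 * w 2

/-- The point `T + P / 2 + h Q`. -/
def latticePt (T : E3) (h : ℝ) (P Q : Fin 3 → ℤ) : E3 :=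
  T + WithLp.toLp 2 fun k => (P k : ℝ) / 2 + h * Q k

/-- The linear functional on space with integral coefficients `n`. -/
def dotL (n : Fin 3 → ℤ) : E3 →ₗ[ℝ] ℝ where
  toFun x := n 0 * x 0 + n 1 * x 1 + n 2 * x 2
  map_add' x y := by simp only [PiLp.add_apply]; ring
  map_smul' c x := by simp only [PiLp.smul_apply, smul_eq_mul, RingHom.id_apply]; ring

theorem dotL_latticePt (n : Fin 3 → ℤ) (T : E3) (h : ℝ) (P Q : Fin 3 → ℤ) :
    dotL n (latticePt T h P Q) = dotL n T + ((dot n P : ℤ) : ℝ) / 2 + h * (dot n Q : ℤ) := by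
  simp only [latticePt, map_add]
  simp only [dotL, dot, LinearMap.coe_mk, AddHom.coe_mk]
  push_cast
  ring

theorem inner_E3 (x y : E3) : inner ℝ x y = x 0 * y 0 + x 1 * y 1 + x 2 * y 2 := by
  simp [PiLp.inner_apply, Fin.sum_univ_three, mul_comm]

/-- The separation condition for the quadrilaterals `i` and `j`, with the plane on which the
functional with coefficients `n` takes the value `b / 2 + h c`. Inequalities between such values
are required to hold for the coefficients of `1 / 2` and of `h` separately, so that they hold for
all `h > 0`. -/
def IsSeparated {ι V : Type} (F : ι → Fin 4 → V) (P Q : V → Fin 3 → ℤ) (n : Fin 3 → ℤ) (b c : ℤ)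
    (i j : ι) : Prop :=
  (∀ p, dot n (P (F i p)) ≤ b ∧ dot n (Q (F i p)) ≤ c) ∧
  (∀ p, b ≤ dot n (P (F j p)) ∧ c ≤ dot n (Q (F j p))) ∧
  ((∀ p, dot n (P (F i p)) = b → dot n (Q (F i p)) = c → ∃ q, F j q = F i p) ∨
    (∀ p, dot n (P (F j p)) = b → dot n (Q (F j p)) = c → ∃ q, F i q = F j p))

/-- The metric conditions of `IsRectangular` for vertices of the form `T + P / 2 + h Q` with
integral `P` and `Q`, expressed in integers in such a way that they are independent of `h > 0`. In
`inj`, the coordinate `k` differs because its two differences do not have opposite signs. -/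
structure IsIntRectangular {ι V : Type} (F : ι → Fin 4 → V) (P Q : V → Fin 3 → ℤ) : Prop where
  inj : ∀ v w, v ≠ w → ∃ k, (P v k ≠ P w k ∨ Q v k ≠ Q w k) ∧
    0 ≤ (P v k - P w k) * (Q v k - Q w k)
  parP : ∀ i k, P (F i 2) k = P (F i 1) k + P (F i 3) k - P (F i 0) k
  parQ : ∀ i k, Q (F i 2) k = Q (F i 1) k + Q (F i 3) k - Q (F i 0) k
  perp : ∀ i, dot (P (F i 1) - P (F i 0)) (P (F i 3) - P (F i 0)) = 0 ∧
    dot (P (F i 1) - P (F i 0)) (Q (F i 3) - Q (F i 0)) +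
      dot (Q (F i 1) - Q (F i 0)) (P (F i 3) - P (F i 0)) = 0 ∧
    dot (Q (F i 1) - Q (F i 0)) (Q (F i 3) - Q (F i 0)) = 0
  sep : ∀ i j, i ≠ j → ∃ n b c, IsSeparated F P Q n b c i j

theorem IsIntRectangular.isRectangular {ι V : Type} {F : ι → Fin 4 → V} {P Q : V → Fin 3 → ℤ}
    (H : IsIntRectangular F P Q) (T : E3) {h : ℝ} (hh : 0 < h) :
    IsRectangular F (fun v => latticePt T h (P v) (Q v)) where
  inj := by
    intro v w e
    by_contra hvw
    obtain ⟨k, hne, hpos⟩ := H.inj v w hvw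
    have e := congrArg (fun x : E3 => x k) (add_left_cancel e)
    simp only at e
    have e' : ((P v k - P w k : ℤ) : ℝ) + (2 * h) * ((Q v k - Q w k : ℤ) : ℝ) = 0 := by
      push_cast
      linarith
    have hpos' : (0 : ℝ) ≤ ((P v k - P w k : ℤ) : ℝ) * ((Q v k - Q w k : ℤ) : ℝ) := by
      exact_mod_cast hpos
    have hq : ((Q v k - Q w k : ℤ) : ℝ) = 0 := by
      have h1 : ((P v k - P w k : ℤ) : ℝ) = - ((2 * h) * ((Q v k - Q w k : ℤ) : ℝ)) := by linarith
      rw [h1] at hpos'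
      have h2 : h * ((Q v k - Q w k : ℤ) : ℝ) ^ 2 ≤ 0 := by linarith
      exact pow_eq_zero_iff (two_ne_zero) |>.1
        (le_antisymm (nonpos_of_mul_nonpos_right h2 hh) (sq_nonneg _))
    have hp : ((P v k - P w k : ℤ) : ℝ) = 0 := by rw [hq] at e'; linarith
    rcases hne with hne | hne
    · exact hne (sub_eq_zero.1 (by exact_mod_cast hp))
    · exact hne (sub_eq_zero.1 (by exact_mod_cast hq))
  par := by
    intro i
    ext k
    have h1 : ((P (F i 2) k : ℤ) : ℝ) = P (F i 1) k + P (F i 3) k - P (F i 0) k := by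
      exact_mod_cast H.parP i k
    have h2 : ((Q (F i 2) k : ℤ) : ℝ) = Q (F i 1) k + Q (F i 3) k - Q (F i 0) k := by
      exact_mod_cast H.parQ i k
    simp only [latticePt, PiLp.add_apply, PiLp.sub_apply, h1, h2]
    ring
  perp := by
    intro i
    obtain ⟨h1, h2, h3⟩ := H.perp i
    simp only [dot, Pi.sub_apply] at h1 h2 h3
    rify at h1 h2 h3
    rw [inner_E3]
    simp only [latticePt, PiLp.add_apply, PiLp.sub_apply]
    linear_combination h1 / 4 + h * h2 / 2 + h ^ 2 * h3
  sep := by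
    intro i j hij
    obtain ⟨n, b, c, hi, hj, hz⟩ := H.sep i j hij
    have key : ∀ x y : ℤ, x ≤ b → y ≤ c → (x : ℝ) / 2 + h * y = b / 2 + h * c → x = b ∧ y = c := by
      intro x y hx hy e
      have hx' : (x : ℝ) ≤ b := by exact_mod_cast hx
      have hy' : (y : ℝ) ≤ c := by exact_mod_cast hy
      have := mul_le_mul_of_nonneg_left hy' hh.le
      have e1 : (x : ℝ) = b := by linarith
      have e2 : h * (y : ℝ) = h * c := by linarith
      exact ⟨by exact_mod_cast e1, by exact_mod_cast mul_left_cancel₀ hh.ne' e2⟩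
    have key' : ∀ x y : ℤ, b ≤ x → c ≤ y → (x : ℝ) / 2 + h * y = b / 2 + h * c → x = b ∧ y = c := by
      intro x y hx hy e
      have hx' : (b : ℝ) ≤ x := by exact_mod_cast hx
      have hy' : (c : ℝ) ≤ y := by exact_mod_cast hy
      have := mul_le_mul_of_nonneg_left hy' hh.le
      have e1 : (x : ℝ) = b := by linarith
      have e2 : h * (y : ℝ) = h * c := by linarith
      exact ⟨by exact_mod_cast e1, by exact_mod_cast mul_left_cancel₀ hh.ne' e2⟩
    refine ⟨dotL n, dotL n T + (b / 2 + h * c), fun p => ?_, fun p => ?_, ?_⟩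
    · rw [dotL_latticePt, add_assoc]
      obtain ⟨h1, h2⟩ := hi p
      have h1 : ((dot n (P (F i p)) : ℤ) : ℝ) ≤ b := by exact_mod_cast h1
      have h2 : ((dot n (Q (F i p)) : ℤ) : ℝ) ≤ c := by exact_mod_cast h2
      gcongr
    · rw [dotL_latticePt, add_assoc]
      obtain ⟨h1, h2⟩ := hj p
      have h1 : (b : ℝ) ≤ ((dot n (P (F j p)) : ℤ) : ℝ) := by exact_mod_cast h1
      have h2 : (c : ℝ) ≤ ((dot n (Q (F j p)) : ℤ) : ℝ) := by exact_mod_cast h2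
      gcongr
    · refine hz.imp (fun hz p e => ?_) (fun hz p e => ?_)
      · rw [dotL_latticePt, add_assoc, add_right_inj] at e
        obtain ⟨e1, e2⟩ := key _ _ (hi p).1 (hi p).2 e
        exact hz p e1 e2
      · rw [dotL_latticePt, add_assoc, add_right_inj] at e
        obtain ⟨e1, e2⟩ := key' _ _ (hj p).1 (hj p).2 e
        exact hz p e1 e2

/-! ### The incidence structure of the octahedral example -/

instance {ι V : Type} [DecidableEq V] (F : ι → Fin 4 → V) (j : ι) (a b : V) :
    Decidable (HasSide F j a b) := by unfold HasSide; infer_instance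

instance {ι V : Type} [DecidableEq V] (F : ι → Fin 4 → V) (i j : ι) :
    Decidable (MeetProperly F i j) := by unfold MeetProperly; infer_instance

instance {ι V : Type} [Fintype ι] [DecidableEq ι] [DecidableEq V] (F : ι → Fin 4 → V) (i : ι)
    (p : Fin 4) (j : ι) : Decidable (IsMate F i p j) := by unfold IsMate; infer_instance

instance {ι V : Type} [DecidableEq V] (F : ι → Fin 4 → V) (i : ι) (p : Fin 4) (a b : V) :
    Decidable (IsCorner F i p a b) := by unfold IsCorner; infer_instance

instance {ι V : Type} [Fintype ι] [DecidableEq V] (F : ι → Fin 4 → V) (v : V) {n : ℕ} [NeZero n]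
    (c : Fin n → V) :
    Decidable (IsVertexCycle F v c) := by unfold IsVertexCycle; infer_instance

instance {ι V : Type} [DecidableEq V] (F : ι → Fin 4 → V) (P Q : V → Fin 3 → ℤ)
    (n : Fin 3 → ℤ) (b c : ℤ) (i j : ι) : Decidable (IsSeparated F P Q n b c i j) := by
  unfold IsSeparated; infer_instance

-- the decidability instances of the statements checked below are deeply nested
set_option synthInstance.maxSize 1000

/-- The vertices of the octahedral example: `(k, a, none)` is the apex `a h e_k`, and
`(k, a, (s, t))` is the corner of the square perpendicular to `a e_k` whose coordinates along the
axes `k + 1` and `k + 2` have the signs `s` and `t`. -/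
abbrev OctVertex : Type := Fin 3 × ℤˣ × Option (ℤˣ × ℤˣ)

/-- The faces of the octahedral example by their vertices. -/
def octFace : OctIndex → Fin 4 → OctVertex
  | .inl (k, a) => ![(k, a, some (1, 1)), (k, a, some (1, -1)), (k, a, some (-1, -1)),
      (k, a, some (-1, 1))]
  | .inr (.inl (m, a, b)) => ![(m + 1, a, some (b, 1)), (m + 1, a, some (b, -1)),
      (m + 2, b, some (-1, a)), (m + 2, b, some (1, a))]
  | .inr (.inr (m, a, b, c)) => ![(m + 1, a, some (b, c)), (m + 2, b, some (c, a)),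
      (m + 2, b, none), (m + 1, a, none)]

/-- The integral vector with the given coordinates along the axes `k`, `k + 1`, `k + 2`. -/
def ipt (k : Fin 3) (x y z : ℤ) : Fin 3 → ℤ :=
  fun i => if i = k then x else if i = k + 1 then y else z

/-- Twice the part independent of `h` of the position of a vertex of the octahedral example. -/
def octP : OctVertex → Fin 3 → ℤ
  | (_, _, none) => fun _ => 0
  | (k, a, some (s, t)) => ipt k a s t

/-- The coefficient of `h` in the position of a vertex of the octahedral example. -/
def octQ : OctVertex → Fin 3 → ℤ
  | (k, a, _) => ipt k a 0 0

/-- The vertices surrounding an apex of the octahedral example. -/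
def apexLink (k : Fin 3) (a : ℤˣ) : Fin 8 → OctVertex :=
  ![(k + 1, 1, none), (k, a, some (1, 1)), (k + 2, 1, none), (k, a, some (-1, 1)),
    (k + 1, -1, none), (k, a, some (-1, -1)), (k + 2, -1, none), (k, a, some (1, -1))]

/-- The vertices surrounding a corner of one of the squares of the octahedral example. -/
def cornerLink (k : Fin 3) (a s t : ℤˣ) : Fin 5 → OctVertex :=
  ![(k, a, some (s, -t)), (k + 1, s, some (t, a)), (k, a, none), (k + 2, t, some (a, s)),
    (k, a, some (-s, t))]

/-- A vector associated with each face. For the squares and the outer prism faces it is an outer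
normal. For the inner prism faces it is the linear piece, on the cone over the face, of the convex
function `2 (|x₀| + |x₁| + |x₂|) - min (|x₀|, |x₁|, |x₂|)`, which is the maximum of these 24 linear
functions. -/
def octNormal : OctIndex → Fin 3 → ℤ
  | .inl (k, a) => ipt k a 0 0
  | .inr (.inl (m, a, b)) => ipt m 0 a b
  | .inr (.inr (m, a, b, c)) => ipt m c (2 * a) (2 * b)

theorem oct_surj : ∀ v, ∃ i p, octFace i p = v := by decide +kernel

theorem oct_inj : ∀ i p q, octFace i p = octFace i q → p = q := by decide +kernel

theorem oct_common : ∀ i j, i ≠ j → MeetProperly octFace i j := by decide +kernel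

/-- The face that shares with a given face a given side. -/
def octMate : OctIndex → Fin 4 → OctIndex
  | .inl (k, a) => ![.inr (.inl (k + 2, a, 1)), .inr (.inl (k + 1, -1, a)),
      .inr (.inl (k + 2, a, -1)), .inr (.inl (k + 1, 1, a))]
  | .inr (.inl (m, a, b)) => ![.inl (m + 1, a), .inr (.inr (m, a, b, -1)), .inl (m + 2, b),
      .inr (.inr (m, a, b, 1))]
  | .inr (.inr (m, a, b, c)) => ![.inr (.inl (m, a, b)), .inr (.inr (m + 1, b, c, a)),
      .inr (.inr (m, a, b, -c)), .inr (.inr (m + 2, c, a, b))]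

theorem oct_mate : ∀ i p, IsMate octFace i p (octMate i p) := by decide +kernel

theorem oct_cornerLink : ∀ k a s t, Function.Injective (cornerLink k a s t) ∧
    IsVertexCycle octFace (k, a, some (s, t)) (cornerLink k a s t) := by
  unfold Function.Injective
  decide +kernel

theorem oct_apexLink : ∀ k a, Function.Injective (apexLink k a) ∧
    IsVertexCycle octFace (k, a, none) (apexLink k a) := by
  unfold Function.Injective
  decide +kernel

/-- All faces lie on one side of the plane of a square. -/
theorem oct_sep_square : ∀ k a i, i ≠ .inl (k, a) →
    IsSeparated octFace octP octQ (octNormal (.inl (k, a))) 1 1 i (.inl (k, a)) := by decide +kernel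

/-- All faces lie on one side of the plane of an outer prism face. -/
theorem oct_sep_outer : ∀ m a b i, i ≠ .inr (.inl (m, a, b)) →
    IsSeparated octFace octP octQ (octNormal (.inr (.inl (m, a, b)))) 2 1 i
      (.inr (.inl (m, a, b))) := by decide +kernel

/-- Two inner prism faces are separated by the plane on which the linear pieces of the convex
function described at `octNormal` agree: each piece is the larger one on its own face. -/
theorem oct_sep_inner : ∀ x y, x ≠ y →
    IsSeparated octFace octP octQ (octNormal (.inr (.inr y)) - octNormal (.inr (.inr x))) 0 0
      (.inr (.inr x)) (.inr (.inr y)) := by decide +kernel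

/-! ### The octahedral example is a polyhedron of genus seven -/

/-- The squared length of a lattice vector, in terms of the three integers on which it depends. -/
theorem dist_latticePt (T : E3) (h : ℝ) (P Q P' Q' : Fin 3 → ℤ) :
    dist (latticePt T h P Q) (latticePt T h P' Q') ^ 2 =
      (dot (P - P') (P - P') : ℤ) / 4 + h * (dot (P - P') (Q - Q') : ℤ) +
        h ^ 2 * (dot (Q - Q') (Q - Q') : ℤ) := by
  rw [dist_eq_norm, ← real_inner_self_eq_norm_sq, inner_E3]
  simp only [latticePt, PiLp.add_apply, PiLp.sub_apply, dot, Pi.sub_apply]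
  push_cast
  ring

/-- A number assigned to the faces of the octahedral example such that each face except
`.inr (.inr (0, 1, 1, 1))` has a common vertex with a face of smaller rank. -/
def octRank : OctIndex → ℕ
  | .inr (.inr (m, a, b, c)) =>
      if a = 1 then if b = 1 ∧ c = 1 then if m = 0 then 0 else 1 else 2
      else if b = 1 then 3 else 4
  | _ => 5

/-- Different vertices differ in a coordinate for which the differences of the two coefficients do
not have opposite signs. -/
theorem oct_coord_inj : ∀ v w, v ≠ w → ∃ k, (octP v k ≠ octP w k ∨ octQ v k ≠ octQ w k) ∧
    0 ≤ (octP v k - octP w k) * (octQ v k - octQ w k) := by decide +kernel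

theorem oct_parP : ∀ i k, octP (octFace i 2) k =
    octP (octFace i 1) k + octP (octFace i 3) k - octP (octFace i 0) k := by decide +kernel

theorem oct_parQ : ∀ i k, octQ (octFace i 2) k =
    octQ (octFace i 1) k + octQ (octFace i 3) k - octQ (octFace i 0) k := by decide +kernel

theorem oct_perp : ∀ i,
    dot (octP (octFace i 1) - octP (octFace i 0)) (octP (octFace i 3) - octP (octFace i 0)) = 0 ∧
    dot (octP (octFace i 1) - octP (octFace i 0)) (octQ (octFace i 3) - octQ (octFace i 0)) +
      dot (octQ (octFace i 1) - octQ (octFace i 0)) (octP (octFace i 3) - octP (octFace i 0)) = 0 ∧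
    dot (octQ (octFace i 1) - octQ (octFace i 0)) (octQ (octFace i 3) - octQ (octFace i 0)) = 0 :=
  by decide +kernel

theorem oct_rank : ∀ i, i ≠ .inr (.inr (0, 1, 1, 1)) →
    ∃ j, j ≠ .inl (0, 1) ∧ octRank j < octRank i ∧ ∃ p q, octFace i p = octFace j q := by
  decide +kernel

theorem isSeparated_neg {ι V : Type} {F : ι → Fin 4 → V} {P Q : V → Fin 3 → ℤ} {n : Fin 3 → ℤ}
    {b c : ℤ} {i j : ι} (h : IsSeparated F P Q n b c i j) :
    IsSeparated F P Q (-n) (-b) (-c) j i := by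
  have e : ∀ w, dot (-n) w = - dot n w := fun w => by simp only [dot, Pi.neg_apply]; ring
  unfold IsSeparated at h ⊢
  simp only [e, neg_le_neg_iff, neg_inj]
  exact ⟨h.2.1, h.1, h.2.2.symm⟩

theorem oct_isClosedQuadSurface : IsClosedQuadSurface octFace where
  surj := oct_surj
  inj := oct_inj
  common := oct_common
  two i p := ⟨_, oct_mate i p⟩
  cyc v := by
    obtain ⟨k, a, _ | ⟨s, t⟩⟩ := v
    · exact ⟨5, apexLink k a, oct_apexLink k a⟩
    · exact ⟨2, cornerLink k a s t, oct_cornerLink k a s t⟩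

theorem oct_isIntRectangular : IsIntRectangular octFace octP octQ where
  inj := oct_coord_inj
  parP := oct_parP
  parQ := oct_parQ
  perp := oct_perp
  sep := by
    intro i j hij
    match i, j, hij with
    | i, .inl (k, a), hij => exact ⟨_, _, _, oct_sep_square k a i hij⟩
    | i, .inr (.inl (m, a, b)), hij => exact ⟨_, _, _, oct_sep_outer m a b i hij⟩
    | .inl (k, a), j, hij => exact ⟨_, _, _, isSeparated_neg (oct_sep_square k a j hij.symm)⟩
    | .inr (.inl (m, a, b)), j, hij =>
      exact ⟨_, _, _, isSeparated_neg (oct_sep_outer m a b j hij.symm)⟩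
    | .inr (.inr x), .inr (.inr y), hij =>
      exact ⟨_, _, _, oct_sep_inner x y fun h => hij (by rw [h])⟩

/-- The position of the vertices of the octahedral example. -/
def octPt (L : ℝ) (v : OctVertex) : E3 := latticePt 0 (L / √2) (octP v) (octQ v)

theorem octopus_eq_realize (L : ℝ) : octopus L = realize octFace (octPt L) := by
  have key : ∀ f g : Fin 4 → E3, f = g → (⟨4, ⟨f⟩⟩ : Face) = ⟨4, ⟨g⟩⟩ := fun _ _ h => by rw [h]
  have ht : ∀ x : ℝ, (x + 1 / 2 : ℝ) = 1 / 2 + x * 1 := fun x => by ring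
  funext i
  rcases i with ⟨k, a⟩ | ⟨m, a, b⟩ | ⟨m, a, b, c⟩ <;> refine key _ _ (funext fun p => ?_)
  · fin_cases k <;> fin_cases p <;> ext l <;> fin_cases l <;>
      simp [octPt, octFace, latticePt, octP, octQ, ipt, pt, sgn] <;> ring
  · fin_cases m <;> fin_cases p <;> ext l <;> fin_cases l <;>
      simp [octPt, octFace, latticePt, octP, octQ, ipt, pt, sgn] <;> ring
  · fin_cases m <;> fin_cases p <;> ext l <;> fin_cases l <;>
      simp [octPt, octFace, latticePt, octP, octQ, ipt, pt, sgn] <;> ring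

section
variable {L : ℝ} (hL : 0 < L)
include hL

theorem octPt_isRectangular : IsRectangular octFace (octPt L) :=
  oct_isIntRectangular.isRectangular 0 (div_pos hL (by positivity))

theorem octopus_isPolyhedron : IsPolyhedron (octopus L) := by
  rw [octopus_eq_realize]
  exact (octPt_isRectangular hL).isPolyhedron oct_isClosedQuadSurface

theorem octopus_isRectangle (i : OctIndex) : (octopus L i).IsRectangle := by
  rw [octopus_eq_realize]
  exact (octPt_isRectangular hL).isRectangle i

theorem octopus_ncard_vertices : (vertices (octopus L)).ncard = 30 := by
  rw [octopus_eq_realize, (octPt_isRectangular hL).ncard_vertices oct_isClosedQuadSurface,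
    Nat.card_eq_fintype_card]
  rfl

omit hL in
theorem card_octIndex : Nat.card OctIndex = 42 := by
  rw [Nat.card_eq_fintype_card]
  rfl

theorem octopus_ncard_edges : (edges (octopus L)).ncard = 84 := by
  rw [((octopus_isPolyhedron hL).ncard_edges fun i => (octopus_isRectangle hL i).1).2,
    card_octIndex]

/-- The surface of the octahedral example remains connected without one of the squares. -/
theorem octopus_isConnected_biUnion :
    IsConnected (⋃ i ∈ ({.inl (0, 1)}ᶜ : Set OctIndex), (octopus L i).region) := by
  rw [octopus_eq_realize]
  refine (octPt_isRectangular hL).isConnected_biUnion oct_isClosedQuadSurface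
    (r := .inr (.inr (0, 1, 1, 1))) (by simp) octRank fun i _ hir => ?_
  exact oct_rank i hir

theorem octopus_isConnected : IsConnected (surface (octopus L)) := by
  have := (octPt_isRectangular hL).isConnected_biUnion oct_isClosedQuadSurface
    (r := .inr (.inr (0, 1, 1, 1))) (Set.mem_univ _) octRank fun i _ hir => by
      obtain ⟨j, -, h⟩ := oct_rank i hir
      exact ⟨j, Set.mem_univ _, h⟩
  rw [Set.biUnion_univ] at this
  rwa [octopus_eq_realize]

theorem octopus_hasGenus : HasGenus (octopus L) 7 := by
  refine ⟨octopus_isConnected hL, ?_⟩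
  rw [octopus_ncard_vertices hL, octopus_ncard_edges hL, card_octIndex]
  norm_num

end

/-! ### Sizes and dihedral angles of the octahedral example -/

theorem isRectangleOfSize_realize {ι V : Type} {F : ι → Fin 4 → V} {ρ : V → E3} {i : ι} {a b : ℝ}
    (h : (realize F ρ i).IsRectangle) (p : Fin 4) (h1 : dist (ρ (F i p)) (ρ (F i (p + 1))) = a)
    (h2 : dist (ρ (F i (p + 1))) (ρ (F i (p + 2))) = b) :
    (realize F ρ i).IsRectangleOfSize a b := by
  refine ⟨h, (p + 1 : Fin 4), ?_, ?_⟩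
  · change dist (ρ (F i ((finRotate 4).symm (p + 1)))) _ = a
    have : (finRotate 4).symm (p + 1) = p := by
      rw [Equiv.symm_apply_eq, finRotate_apply]
    rw [this]
    exact h1
  · change dist _ (ρ (F i (finRotate 4 (p + 1)))) = b
    rw [finRotate_apply, add_assoc]
    exact h2

/-- The integers that determine the length of the side of a face of the octahedral example that
starts at its `p`-th vertex. -/
def octLengths (i : OctIndex) (p : Fin 4) : ℤ × ℤ × ℤ :=
  let dP := octP (octFace i p) - octP (octFace i (p + 1))
  let dQ := octQ (octFace i p) - octQ (octFace i (p + 1))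
  (dot dP dP, dot dP dQ, dot dQ dQ)

/-- With `octLengths_outer` and `octLengths_inner`, this gives the sizes of the faces: the squared
length given by `(p, q, r)` is `p / 4 + q h + r h ^ 2`. -/
theorem octLengths_square : ∀ x, octLengths (.inl x) 0 = (4, 0, 0) ∧
    octLengths (.inl x) 1 = (4, 0, 0) := by decide +kernel

theorem octLengths_outer : ∀ x, octLengths (.inr (.inl x)) 1 = (0, 0, 2) ∧
    octLengths (.inr (.inl x)) 2 = (4, 0, 0) := by decide +kernel

theorem octLengths_inner : ∀ x, octLengths (.inr (.inr x)) 0 = (0, 0, 2) ∧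
    octLengths (.inr (.inr x)) 1 = (3, 0, 0) := by decide +kernel

theorem dist_octPt (L : ℝ) (i : OctIndex) (p : Fin 4) :
    dist (octPt L (octFace i p)) (octPt L (octFace i (p + 1))) ^ 2 =
      ((octLengths i p).1 : ℝ) / 4 + L / √2 * (octLengths i p).2.1 +
        (L / √2) ^ 2 * (octLengths i p).2.2 :=
  dist_latticePt _ _ _ _ _ _

/-- The direction, as an integral vector, from the side of the `i`-th face that starts at the
`p`-th vertex to the opposite side. -/
def octInward (i : OctIndex) (p : Fin 4) : Fin 3 → ℤ :=
  (octP (octFace i (p + 3)) - octP (octFace i p)) + (octQ (octFace i (p + 3)) - octQ (octFace i p))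

/-- Each side of a face is an integral vector multiplied by `1 / 2` or by `h`. -/
theorem octInward_eq : ∀ i p, octP (octFace i (p + 3)) - octP (octFace i p) = 0 ∨
    octQ (octFace i (p + 3)) - octQ (octFace i p) = 0 := by decide +kernel

/-- The directions that two adjacent faces take at a common side are neither perpendicular nor
parallel. -/
theorem octInward_angle : ∀ i p q,
    (octFace (octMate i p) q = octFace i p ∧ octFace (octMate i p) (q + 1) = octFace i (p + 1)) ∨
    (octFace (octMate i p) q = octFace i (p + 1) ∧ octFace (octMate i p) (q + 1) = octFace i p) →
    dot (octInward i p) (octInward (octMate i p) q) ≠ 0 ∧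
    dot (octInward i p) (octInward (octMate i p) q) ^ 2 ≠
      dot (octInward i p) (octInward i p) *
        dot (octInward (octMate i p) q) (octInward (octMate i p) q) := by decide +kernel

/-- A vector with integral coordinates. -/
def intVec (w : Fin 3 → ℤ) : E3 := WithLp.toLp 2 fun k => (w k : ℝ)

theorem inner_intVec (v w : Fin 3 → ℤ) : inner ℝ (intVec v) (intVec w) = ((dot v w : ℤ) : ℝ) := by
  rw [inner_E3]
  simp [intVec, dot]

section
variable {L : ℝ} (hL : 0 < L)
include hL

theorem octopus_square_size (x) : (octopus L (.inl x)).IsRectangleOfSize 1 1 := by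
  have h := octopus_isRectangle hL (.inl x)
  rw [octopus_eq_realize] at h ⊢
  obtain ⟨h0, h1⟩ := octLengths_square x
  refine isRectangleOfSize_realize h 0 ?_ ?_
  · have := dist_octPt L (.inl x) 0
    rw [h0] at this
    refine (pow_left_inj₀ dist_nonneg zero_le_one two_ne_zero).1 (this.trans ?_)
    norm_num
  · have := dist_octPt L (.inl x) 1
    rw [h1] at this
    refine (pow_left_inj₀ dist_nonneg zero_le_one two_ne_zero).1 (this.trans ?_)
    norm_num

theorem octopus_outer_size (x) : (octopus L (.inr (.inl x))).IsRectangleOfSize L 1 := by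
  have h := octopus_isRectangle hL (.inr (.inl x))
  rw [octopus_eq_realize] at h ⊢
  obtain ⟨h0, h1⟩ := octLengths_outer x
  refine isRectangleOfSize_realize h 1 ?_ ?_
  · have := dist_octPt L (.inr (.inl x)) 1
    rw [h0] at this
    refine (pow_left_inj₀ dist_nonneg hL.le two_ne_zero).1 (this.trans ?_)
    rw [div_pow, Real.sq_sqrt zero_le_two]
    push_cast
    ring
  · have := dist_octPt L (.inr (.inl x)) 2
    rw [h1] at this
    refine (pow_left_inj₀ dist_nonneg zero_le_one two_ne_zero).1 (this.trans ?_)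
    norm_num

theorem octopus_inner_size (x) : (octopus L (.inr (.inr x))).IsRectangleOfSize L (√3 / 2) := by
  have h := octopus_isRectangle hL (.inr (.inr x))
  rw [octopus_eq_realize] at h ⊢
  obtain ⟨h0, h1⟩ := octLengths_inner x
  refine isRectangleOfSize_realize h 0 ?_ ?_
  · have := dist_octPt L (.inr (.inr x)) 0
    rw [h0] at this
    refine (pow_left_inj₀ dist_nonneg hL.le two_ne_zero).1 (this.trans ?_)
    rw [div_pow, Real.sq_sqrt zero_le_two]
    push_cast
    ring
  · have := dist_octPt L (.inr (.inr x)) 1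
    rw [h1] at this
    refine (pow_left_inj₀ dist_nonneg (by positivity) two_ne_zero).1 (this.trans ?_)
    rw [div_pow √3, Real.sq_sqrt zero_le_three]
    push_cast
    ring

theorem octPt_sub (i : OctIndex) (p : Fin 4) :
    ∃ c : ℝ, 0 < c ∧ octPt L (octFace i (p + 3)) - octPt L (octFace i p) =
      c • intVec (octInward i p) := by
  rcases octInward_eq i p with h | h
  · refine ⟨L / √2, div_pos hL (by positivity), ?_⟩
    ext k
    have hk := congrFun h k
    simp only [Pi.sub_apply, Pi.zero_apply] at hk
    rify at hk
    simp only [octPt, latticePt, octInward, intVec, PiLp.add_apply, PiLp.sub_apply,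
      PiLp.smul_apply, Pi.add_apply, Pi.sub_apply, smul_eq_mul]
    push_cast
    linear_combination (1 / 2 - L / √2) * hk
  · refine ⟨1 / 2, by norm_num, ?_⟩
    ext k
    have hk := congrFun h k
    simp only [Pi.sub_apply, Pi.zero_apply] at hk
    rify at hk
    simp only [octPt, latticePt, octInward, intVec, PiLp.add_apply, PiLp.sub_apply,
      PiLp.smul_apply, Pi.add_apply, Pi.sub_apply, smul_eq_mul]
    push_cast
    linear_combination (L / √2 - 1 / 2) * hk

theorem octopus_isInward (i : OctIndex) (p : Fin 4) {w : E3}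
    (h : (octopus L i).IsInward (octPt L (octFace i p)) (octPt L (octFace i (p + 1))) w) :
    ∃ c : ℝ, 0 < c ∧ w = c • intVec (octInward i p) := by
  rw [octopus_eq_realize, (octPt_isRectangular hL).isInward_iff oct_isClosedQuadSurface] at h
  obtain ⟨c, hc, e⟩ := octPt_sub hL i p
  have h0 : octPt L (octFace i (p + 3)) - octPt L (octFace i p) ≠ 0 :=
    (octPt_isRectangular hL).sub_ne_zero oct_isClosedQuadSurface i
      ((by decide : ∀ p : Fin 4, p + 3 ≠ p) p)
  have h1 := norm_pos_iff.2 h0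
  rw [e] at h h1
  rw [smul_smul] at h
  exact ⟨_, by positivity, h⟩

theorem octopus_dihedral (θ : ℝ) (hθ : IsDihedralAngle (octopus L) θ) : ¬ IsRectilinear θ := by
  obtain ⟨i, j, hij, a, b, u, w, hi, hj, hu, hw, rfl⟩ := hθ
  have hinj := (octPt_isRectangular hL).inj
  have hi' := hi
  rw [octopus_eq_realize] at hi'
  obtain ⟨p, hp⟩ := mem_edges_realize.1 hi'
  have hu : (octopus L i).IsInward (octPt L (octFace i p)) (octPt L (octFace i (p + 1))) u := by
    rcases Sym2.eq_iff.1 hp with ⟨rfl, rfl⟩ | ⟨rfl, rfl⟩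
    exacts [hu, isInward_comm.1 hu]
  have hw : (octopus L j).IsInward (octPt L (octFace i p)) (octPt L (octFace i (p + 1))) w := by
    rcases Sym2.eq_iff.1 hp with ⟨rfl, rfl⟩ | ⟨rfl, rfl⟩
    exacts [hw, isInward_comm.1 hw]
  rw [hp, octopus_eq_realize, mk_mem_edges_realize hinj] at hj
  obtain rfl : j = octMate i p := ((oct_mate i p).2 j hj).resolve_left hij.symm
  obtain ⟨q, hq⟩ := hj
  have hw : (octopus L (octMate i p)).IsInward (octPt L (octFace (octMate i p) q))
      (octPt L (octFace (octMate i p) (q + 1))) w := by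
    rcases hq with ⟨h1, h2⟩ | ⟨h1, h2⟩ <;> rw [h1, h2]
    exacts [hw, isInward_comm.1 hw]
  obtain ⟨c, hc, rfl⟩ := octopus_isInward hL i p hu
  obtain ⟨d, hd, rfl⟩ := octopus_isInward hL _ q hw
  rw [InnerProductGeometry.angle_smul_left_of_pos _ _ hc,
    InnerProductGeometry.angle_smul_right_of_pos _ _ hd]
  obtain ⟨h0, h1⟩ := octInward_angle i p q hq
  apply not_isRectilinear_angle
  · rw [inner_intVec]
    exact_mod_cast h0
  · rw [inner_intVec, inner_intVec, inner_intVec]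
    exact_mod_cast h1

/-- Two faces of the octahedral example, none of them a square, whose dihedral angle is not a
multiple of a right angle. -/
theorem octopus_exists_dihedral : ∃ x y, octopus L (.inr x) ≠ octopus L (.inr y) ∧
    ∃ a b u w : E3, s(a, b) ∈ (octopus L (.inr x)).edges ∧ s(a, b) ∈ (octopus L (.inr y)).edges ∧
      (octopus L (.inr x)).IsInward a b u ∧ (octopus L (.inr y)).IsInward a b w ∧
      ¬ IsRectilinear (InnerProductGeometry.angle u w) := by
  have hinj := (octPt_isRectangular hL).inj
  let x : (Fin 3 × ℤˣ × ℤˣ) ⊕ (Fin 3 × ℤˣ × ℤˣ × ℤˣ) := .inl (0, 1, 1)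
  let y : (Fin 3 × ℤˣ × ℤˣ) ⊕ (Fin 3 × ℤˣ × ℤˣ × ℤˣ) := .inr (0, 1, 1, 1)
  have hx : s(octPt L (octFace (.inr x) 3), octPt L (octFace (.inr x) (3 + 1))) ∈
      (octopus L (.inr x)).edges := by
    rw [octopus_eq_realize, mk_mem_edges_realize hinj]
    exact ⟨3, Or.inl ⟨rfl, rfl⟩⟩
  have e1 : octFace (.inr x) 3 = octFace (.inr y) (0 + 1) := by decide
  have e2 : octFace (.inr x) (3 + 1) = octFace (.inr y) 0 := by decide
  have hy : s(octPt L (octFace (.inr x) 3), octPt L (octFace (.inr x) (3 + 1))) ∈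
      (octopus L (.inr y)).edges := by
    rw [e1, e2, octopus_eq_realize, mk_mem_edges_realize hinj]
    exact ⟨0, Or.inr ⟨rfl, rfl⟩⟩
  have hne : octopus L (.inr x) ≠ octopus L (.inr y) := by
    intro h
    have hv := congrArg Face.vertexSet h
    rw [octopus_eq_realize, realize_vertexSet, realize_vertexSet] at hv
    have : octPt L (octFace (.inr y) 3) ∈ Set.range fun p => octPt L (octFace (.inr x) p) :=
      hv ▸ ⟨3, rfl⟩
    obtain ⟨p, hp⟩ := this
    exact (by decide : ∀ p, octFace (.inr x) p ≠ octFace (.inr y) 3) p (hinj hp)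
  have hu := ((octPt_isRectangular hL).isInward_iff oct_isClosedQuadSurface (.inr x) 3).2 rfl
  have hw := ((octPt_isRectangular hL).isInward_iff oct_isClosedQuadSurface (.inr y) 0).2 rfl
  rw [← octopus_eq_realize] at hu hw
  rw [← e1, ← e2] at hw
  refine ⟨x, y, hne, _, _, _, _, hx, hy, hu, isInward_comm.1 hw, ?_⟩
  exact octopus_dihedral hL _ ⟨_, _, fun h => hne (by rw [h]), _, _, _, _, hx, hy, hu,
    isInward_comm.1 hw, rfl⟩

theorem octopus_not_isOrthogonal : ¬ IsOrthogonal (octopus L) := by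
  obtain ⟨x, y, hne, a, b, u, w, hx, hy, hu, hw, h⟩ := octopus_exists_dihedral hL
  exact fun ho => h (ho _ ⟨_, _, fun h => hne (by rw [h]), a, b, u, w, hx, hy, hu, hw, rfl⟩)

end

/-! ### Symmetry of the octahedral example -/

/-- The reflection in coordinate planes that multiplies the coordinates by the signs `s`. -/
def signAct (s : Fin 3 → ℤˣ) (w : Fin 3 → ℤ) : Fin 3 → ℤ := fun k => s k * w k

/-- The permutation of the coordinates by `π`. -/
def permAct (π : Equiv.Perm (Fin 3)) (w : Fin 3 → ℤ) : Fin 3 → ℤ := w ∘ π.symm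

/-- The image of a face of the octahedral example under a reflection in coordinate planes. -/
def signFace (s : Fin 3 → ℤˣ) : OctIndex → OctIndex
  | .inl (k, a) => .inl (k, s k * a)
  | .inr (.inl (m, a, b)) => .inr (.inl (m, s (m + 1) * a, s (m + 2) * b))
  | .inr (.inr (m, a, b, c)) => .inr (.inr (m, s (m + 1) * a, s (m + 2) * b, s m * c))

/-- The image of a face of the octahedral example under a permutation of the coordinates. -/
def permFace (π : Equiv.Perm (Fin 3)) : OctIndex → OctIndex
  | .inl (k, a) => .inl (π k, a)
  | .inr (.inl (m, a, b)) => .inr (.inl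
      (if π (m + 1) = π m + 1 then (π m, a, b) else (π m, b, a)))
  | .inr (.inr (m, a, b, c)) => .inr (.inr
      (if π (m + 1) = π m + 1 then (π m, a, b, c) else (π m, b, a, c)))

/-- The map `g` of integral vectors takes the vertices of the face `i` to those of the face `j`. -/
def MapsFace (g : (Fin 3 → ℤ) → Fin 3 → ℤ) (i j : OctIndex) : Prop :=
  (∀ p, ∃ q, octP (octFace j q) = g (octP (octFace i p)) ∧
    octQ (octFace j q) = g (octQ (octFace i p))) ∧
  ∀ q, ∃ p, octP (octFace j q) = g (octP (octFace i p)) ∧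
    octQ (octFace j q) = g (octQ (octFace i p))

instance (g i j) : Decidable (MapsFace g i j) := by unfold MapsFace; infer_instance

theorem mapsFace_signAct : ∀ s i, MapsFace (signAct s) i (signFace s i) := by decide +kernel

theorem mapsFace_permAct : ∀ π i, MapsFace (permAct π) i (permFace π i) := by decide +kernel

theorem MapsFace.comp {g g' : (Fin 3 → ℤ) → Fin 3 → ℤ} {i j k : OctIndex} (h : MapsFace g i j)
    (h' : MapsFace g' j k) : MapsFace (g' ∘ g) i k := by
  constructor
  · intro p
    obtain ⟨q, h1, h2⟩ := h.1 p
    obtain ⟨r, h3, h4⟩ := h'.1 q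
    exact ⟨r, by rw [h3, h1, Function.comp], by rw [h4, h2, Function.comp]⟩
  · intro r
    obtain ⟨q, h3, h4⟩ := h'.2 r
    obtain ⟨p, h1, h2⟩ := h.2 q
    exact ⟨p, by rw [h3, h1, Function.comp], by rw [h4, h2, Function.comp]⟩

theorem inner_pt_axis (k : Fin 3) (c : ℝ) (x : E3) : inner ℝ (pt k c 0 0) x = c * x k := by
  rw [inner_E3]
  fin_cases k <;> simp [pt]

/-- A linear isometry that preserves the vertex set of the octahedron is a signed permutation of
the coordinates. -/
theorem exists_signed_perm (A : E3 ≃ₗᵢ[ℝ] E3) (hA : A '' octahedron = octahedron) :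
    ∃ (π : Equiv.Perm (Fin 3)) (s : Fin 3 → ℤˣ), ∀ x k, A x (π k) = ((s k : ℤ) : ℝ) * x k := by
  have h1 : ∀ k, ∃ (l : Fin 3) (a : ℤˣ), A (pt k 1 0 0) = pt l (sgn a) 0 0 := by
    intro k
    have : A (pt k 1 0 0) ∈ octahedron := hA ▸ ⟨pt k 1 0 0, ⟨k, 1, by simp [sgn]⟩, rfl⟩
    exact this
  choose f s hf using h1
  have hs : ∀ a : ℤˣ, sgn a * sgn a = 1 := fun a => by
    rcases Int.units_eq_one_or a with rfl | rfl <;> simp [sgn]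
  have key : ∀ x k, A x (f k) = sgn (s k) * x k := by
    intro x k
    have h2 := A.inner_map_map (pt k 1 0 0) x
    rw [hf, inner_pt_axis, inner_pt_axis, one_mul] at h2
    rw [← h2, ← mul_assoc, hs, one_mul]
  have hinj : Function.Injective f := by
    intro k l hkl
    by_contra hne
    have h2 := key (pt l 1 0 0) k
    rw [hkl, key (pt l 1 0 0) l] at h2
    have h3 : pt l 1 0 0 k = 0 := by
      simp only [pt, if_neg hne]
      split_ifs <;> rfl
    have h4 : pt l 1 0 0 l = 1 := by simp [pt]
    rw [h3, h4, mul_zero, mul_one] at h2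
    have := hs (s l)
    rw [h2] at this
    norm_num at this
  exact ⟨Equiv.ofBijective f (Finite.injective_iff_bijective.1 hinj), s, key⟩

/-- The symmetries of the octahedron permute the faces of the octahedral example. -/
theorem octopus_symm {L : ℝ} (hL : 0 < L) (A : E3 ≃ₗᵢ[ℝ] E3) (hA : A '' octahedron = octahedron)
    (i : OctIndex) : ∃ j, A '' (octopus L i).region = (octopus L j).region := by
  obtain ⟨π, s, h⟩ := exists_signed_perm A hA
  refine ⟨permFace π (signFace s i), ?_⟩
  have hm := (mapsFace_signAct s i).comp (mapsFace_permAct π (signFace s i))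
  have hAp : ∀ P Q, A (latticePt 0 (L / √2) P Q) =
      latticePt 0 (L / √2) ((permAct π ∘ signAct s) P) ((permAct π ∘ signAct s) Q) := by
    intro P Q
    ext m
    obtain ⟨k, rfl⟩ := π.surjective m
    rw [h]
    simp only [latticePt, permAct, signAct, Function.comp,
      Equiv.symm_apply_apply, zero_add]
    push_cast
    ring
  rw [octopus_eq_realize, (octPt_isRectangular hL).region_eq oct_isClosedQuadSurface,
    (octPt_isRectangular hL).region_eq oct_isClosedQuadSurface]
  have hlin := (A.toLinearEquiv : E3 →ₗ[ℝ] E3).image_convexHull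
    (Set.range fun p => octPt L (octFace i p))
  refine hlin.trans (congrArg _ ?_)
  ext x
  constructor
  · rintro ⟨_, ⟨p, rfl⟩, rfl⟩
    obtain ⟨q, h1, h2⟩ := hm.1 p
    refine ⟨q, ?_⟩
    change latticePt _ _ _ _ = A (latticePt _ _ _ _)
    rw [hAp, h1, h2]
  · rintro ⟨q, rfl⟩
    obtain ⟨p, h1, h2⟩ := hm.2 q
    refine ⟨_, ⟨p, rfl⟩, ?_⟩
    change A (latticePt _ _ _ _) = latticePt _ _ _ _
    rw [hAp, h1, h2]

/-! ### Common cells of simple polygons -/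

namespace Face

theorem vert_mem_region (f : Face) (i : Fin f.1) : f.vert i ∈ f.region := by
  refine ⟨subset_affineSpan _ _ ⟨i, rfl⟩, ?_⟩
  rw [connectedComponentIn_eq_empty]
  · exact Bornology.isBounded_empty
  · exact fun h => h.2 (Set.mem_iUnion.2 ⟨i, left_mem_affineSegment ℝ _ _⟩)

theorem vertexSet_subset_region (f : Face) : f.vertexSet ⊆ f.region := by
  rintro _ ⟨i, rfl⟩
  exact f.vert_mem_region i

theorem mem_vertexSet_of_mem_edge {f : Face} {e : Sym2 E3} (he : e ∈ f.edges) {v : E3}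
    (hv : v ∈ e) : v ∈ f.vertexSet := by
  obtain ⟨i, rfl⟩ := he
  rcases Sym2.mem_iff.1 hv with rfl | rfl
  exacts [⟨i, rfl⟩, ⟨_, rfl⟩]

theorem finite_edges (f : Face) : f.edges.Finite := by
  have : f.edges = Set.range fun i => s(f.vert i, f.next i) := by
    ext e
    simp only [edges, Set.mem_ofPred_eq, Set.mem_range, eq_comm]
  rw [this]
  exact Set.finite_range _

theorem finRotate_ne {n : ℕ} (hn : 3 ≤ n) (i : Fin n) : finRotate n i ≠ i := by
  obtain ⟨m, rfl⟩ := Nat.exists_eq_add_of_le' hn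
  rw [finRotate_apply]
  simp

theorem finRotate_finRotate_ne {n : ℕ} (hn : 3 ≤ n) (i : Fin n) :
    finRotate n (finRotate n i) ≠ i := by
  obtain ⟨m, rfl⟩ := Nat.exists_eq_add_of_le' hn
  rw [finRotate_apply, finRotate_apply, add_assoc]
  intro h
  have h := add_eq_left.1 h
  have h2 : (1 + 1 : Fin (m + 3)).val = 2 := by
    rw [Fin.val_add, Fin.val_one]
    exact Nat.mod_eq_of_lt (by omega)
  rw [h] at h2
  simp at h2

namespace IsSimplePlanar

variable {f : Face} (hf : f.IsSimplePlanar)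
include hf

theorem vert_eq_next_iff {i j : Fin f.1} : f.vert i = f.next j ↔ i = finRotate f.1 j :=
  hf.injective.eq_iff (a := i) (b := finRotate f.1 j)

theorem ne_of_mem_edges {a b : E3} (h : s(a, b) ∈ f.edges) : a ≠ b := by
  obtain ⟨i, hi⟩ := h
  have : f.vert i ≠ f.next i := fun h =>
    finRotate_ne hf.three_le i (hf.vert_eq_next_iff.1 h).symm
  rcases Sym2.eq_iff.1 hi with ⟨rfl, rfl⟩ | ⟨rfl, rfl⟩
  exacts [this, this.symm]

omit hf in
theorem exists_edgeSet {a b : E3} (h : s(a, b) ∈ f.edges) :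
    ∃ i, s(a, b) = s(f.vert i, f.next i) ∧ segment ℝ a b = f.2.edgeSet ℝ i := by
  obtain ⟨i, hi⟩ := h
  refine ⟨i, hi, ?_⟩
  rcases Sym2.eq_iff.1 hi with ⟨rfl, rfl⟩ | ⟨rfl, rfl⟩
  · exact (affineSegment_eq_segment ℝ _ _).symm
  · rw [segment_symm]
    exact (affineSegment_eq_segment ℝ _ _).symm

/-- Two different edges of a simple polygon are disjoint or meet in a common endpoint. -/
theorem segment_inter {a b c d : E3} (h : s(a, b) ∈ f.edges) (h' : s(c, d) ∈ f.edges)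
    (hne : s(a, b) ≠ s(c, d)) : segment ℝ a b ∩ segment ℝ c d = ∅ ∨
      ∃ v, v ∈ s(a, b) ∧ v ∈ s(c, d) ∧ segment ℝ a b ∩ segment ℝ c d = {v} := by
  obtain ⟨i, hi, ei⟩ := exists_edgeSet h
  obtain ⟨j, hj, ej⟩ := exists_edgeSet h'
  have hij : i ≠ j := by
    rintro rfl
    exact hne (hi.trans hj.symm)
  rw [ei, ej, hi, hj]
  rcases Set.eq_empty_or_nonempty (f.2.edgeSet ℝ i ∩ f.2.edgeSet ℝ j) with h0 | ⟨x, hx⟩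
  · exact Or.inl h0
  right
  refine ⟨x, ?_, ?_, Set.Subset.antisymm (fun z hz => ?_) (Set.singleton_subset_iff.2 hx)⟩
  · rcases hf.simple i j hij x hx with ⟨h1, rfl⟩ | ⟨h1, rfl⟩
    · rw [h1]; exact Sym2.mem_mk_right _ _
    · exact Sym2.mem_mk_left _ _
  · rcases hf.simple i j hij x hx with ⟨h1, rfl⟩ | ⟨h1, rfl⟩
    · exact Sym2.mem_mk_left _ _
    · rw [h1]; exact Sym2.mem_mk_right _ _
  · rcases hf.simple i j hij x hx with ⟨h1, rfl⟩ | ⟨h1, rfl⟩ <;>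
      rcases hf.simple i j hij z hz with ⟨h2, rfl⟩ | ⟨h2, rfl⟩
    · rfl
    · rw [h1] at h2
      exact absurd h2.symm (finRotate_finRotate_ne hf.three_le i)
    · rw [h1] at h2
      exact absurd h2.symm (finRotate_finRotate_ne hf.three_le j)
    · rfl

/-- A vertex of a simple polygon lies on no edges other than those ending in it. -/
theorem mem_edge_of_mem_segment {v a b : E3} (hv : v ∈ f.vertexSet) (h : s(a, b) ∈ f.edges)
    (hab : v ∈ segment ℝ a b) : v ∈ s(a, b) := by
  obtain ⟨i, rfl⟩ := hv
  by_cases hne : s(a, b) = s(f.vert i, f.next i)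
  · rw [hne]
    exact Sym2.mem_mk_left _ _
  have hi : f.vert i ∈ segment ℝ a b ∩ segment ℝ (f.vert i) (f.next i) :=
    ⟨hab, left_mem_segment ℝ _ _⟩
  rcases hf.segment_inter h ⟨i, rfl⟩ hne with h0 | ⟨w, hw, -, h0⟩
  · rw [h0] at hi
    exact hi.elim
  · rw [h0] at hi
    obtain rfl := hi
    exact hw

/-- Exactly two edges of a simple polygon end in a given vertex. -/
theorem exists_edges_at {v : E3} (hv : v ∈ f.vertexSet) :
    ∃ e₁ e₂, e₁ ≠ e₂ ∧ ∀ e, (e ∈ f.edges ∧ v ∈ e) ↔ (e = e₁ ∨ e = e₂) := by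
  obtain ⟨i, rfl⟩ := hv
  obtain ⟨j, rfl⟩ := (finRotate f.1).surjective i
  refine ⟨s(f.vert j, f.next j), s(f.vert (finRotate f.1 j), f.next (finRotate f.1 j)),
    fun h => ?_, fun e => ⟨?_, ?_⟩⟩
  · rcases Sym2.eq_iff.1 h with ⟨h1, -⟩ | ⟨h1, -⟩
    · exact finRotate_ne hf.three_le j (hf.injective h1).symm
    · exact finRotate_finRotate_ne hf.three_le j (hf.vert_eq_next_iff.1 h1).symm
  · rintro ⟨⟨k, rfl⟩, hk⟩
    rcases Sym2.mem_iff.1 hk with h | h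
    · right
      rw [hf.injective h]
    · left
      rw [(finRotate f.1).injective (hf.vert_eq_next_iff.1 h)]
  · rintro (rfl | rfl)
    · exact ⟨⟨_, rfl⟩, Sym2.mem_mk_right _ _⟩
    · exact ⟨⟨_, rfl⟩, Sym2.mem_mk_left _ _⟩

end IsSimplePlanar
end Face

/-- The set `S` is empty, a common vertex, or a common edge of two faces. -/
def IsCommonCell (f g : Face) (S : Set E3) : Prop :=
  S = ∅ ∨ (∃ v, v ∈ f.vertexSet ∧ v ∈ g.vertexSet ∧ S = {v}) ∨
    ∃ a b, s(a, b) ∈ f.edges ∧ s(a, b) ∈ g.edges ∧ S = segment ℝ a b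

theorem IsPolyhedron.isCommonCell {ι : Type} {P : ι → Face} (hP : IsPolyhedron P) {i j : ι}
    (hij : i ≠ j) : IsCommonCell (P i) (P j) ((P i).region ∩ (P j).region) := by
  rw [IsCommonCell, ← Set.disjoint_iff_inter_eq_empty]
  exact hP.inter i j hij

namespace IsCommonCell

variable {f g F : Face} {S T : Set E3}

theorem symm (h : IsCommonCell f g S) : IsCommonCell g f S := by
  rcases h with h | ⟨v, h1, h2, h3⟩ | ⟨a, b, h1, h2, h3⟩
  exacts [Or.inl h, Or.inr (Or.inl ⟨v, h2, h1, h3⟩), Or.inr (Or.inr ⟨a, b, h2, h1, h3⟩)]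

theorem mem_vertexSet (hf : f.IsSimplePlanar) (h : IsCommonCell f F S) {v : E3} (hv : v ∈ S)
    (hvf : v ∈ f.vertexSet) : v ∈ F.vertexSet := by
  rcases h with rfl | ⟨w, h1, h2, rfl⟩ | ⟨a, b, h1, h2, rfl⟩
  · exact hv.elim
  · obtain rfl := hv
    exact h2
  · exact Face.mem_vertexSet_of_mem_edge h2 (hf.mem_edge_of_mem_segment hvf h1 hv)

/-- An edge of `f` contained in the common cell of `f` and `F` is that cell, so it is an edge of
`F`. -/
theorem edge_eq (hf : f.IsSimplePlanar) (h : IsCommonCell f F S) {a b : E3}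
    (hab : s(a, b) ∈ f.edges) (ha : a ∈ S) (hb : b ∈ S) :
    s(a, b) ∈ F.edges ∧ S = segment ℝ a b := by
  have hne := hf.ne_of_mem_edges hab
  rcases h with rfl | ⟨w, h1, h2, rfl⟩ | ⟨c, d, h1, h2, rfl⟩
  · exact ha.elim
  · exact absurd (Eq.trans ha (Eq.symm hb)) hne
  · have hac := hf.mem_edge_of_mem_segment
      (Face.mem_vertexSet_of_mem_edge hab (Sym2.mem_mk_left _ _)) h1 ha
    have hbc := hf.mem_edge_of_mem_segment
      (Face.mem_vertexSet_of_mem_edge hab (Sym2.mem_mk_right _ _)) h1 hb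
    have e : s(a, b) = s(c, d) := ((Sym2.mem_and_mem_iff hne).1 ⟨hac, hbc⟩).symm
    rw [e]
    refine ⟨h2, ?_⟩
    rcases Sym2.eq_iff.1 e with ⟨rfl, rfl⟩ | ⟨rfl, rfl⟩
    exacts [rfl, segment_symm ℝ _ _]

/-- Two cells of a face `F` meet in a cell. -/
theorem inter (hF : F.IsSimplePlanar) (hS : IsCommonCell f F S) (hT : IsCommonCell g F T) :
    IsCommonCell f g (S ∩ T) := by
  rcases hS with rfl | ⟨v, h1, h2, rfl⟩ | ⟨a, b, h1, h2, rfl⟩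
  · exact Or.inl (Set.empty_inter _)
  · by_cases hv : v ∈ T
    swap
    · exact Or.inl (Set.singleton_inter_eq_empty.2 hv)
    refine Or.inr (Or.inl ⟨v, h1, ?_, Set.inter_eq_left.2 (Set.singleton_subset_iff.2 hv)⟩)
    rcases hT with rfl | ⟨w, h3, h4, rfl⟩ | ⟨c, d, h3, h4, rfl⟩
    · exact hv.elim
    · obtain rfl := hv
      exact h3
    · exact Face.mem_vertexSet_of_mem_edge h3 (hF.mem_edge_of_mem_segment h2 h4 hv)
  · rcases hT with rfl | ⟨w, h3, h4, rfl⟩ | ⟨c, d, h3, h4, rfl⟩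
    · exact Or.inl (Set.inter_empty _)
    · by_cases hw : w ∈ segment ℝ a b
      swap
      · exact Or.inl (Set.inter_singleton_eq_empty.2 hw)
      exact Or.inr (Or.inl ⟨w, Face.mem_vertexSet_of_mem_edge h1
        (hF.mem_edge_of_mem_segment h4 h2 hw), h3,
        Set.inter_eq_right.2 (Set.singleton_subset_iff.2 hw)⟩)
    · by_cases hne : s(a, b) = s(c, d)
      · refine Or.inr (Or.inr ⟨a, b, h1, hne ▸ h3, ?_⟩)
        have : segment ℝ c d = segment ℝ a b := by
          rcases Sym2.eq_iff.1 hne with ⟨rfl, rfl⟩ | ⟨rfl, rfl⟩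
          exacts [rfl, segment_symm ℝ _ _]
        rw [this, Set.inter_self]
      · rcases hF.segment_inter h2 h4 hne with h | ⟨v, hv, hv', h⟩
        · exact Or.inl h
        · exact Or.inr (Or.inl ⟨v, Face.mem_vertexSet_of_mem_edge h1 hv,
            Face.mem_vertexSet_of_mem_edge h3 hv', h⟩)

end IsCommonCell

/-! ### Links of vertices -/

namespace IsPolyhedron

variable {ι : Type} {P : ι → Face} (hP : IsPolyhedron P)
include hP

theorem finite_edges : (edges P).Finite :=
  have := hP.finite
  Set.finite_iUnion fun i => (P i).finite_edges

/-- Two faces of a polyhedron have at most one common edge. -/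
theorem eq_of_mem_edges {i j : ι} (hij : i ≠ j) {e e' : Sym2 E3} (h1 : e ∈ (P i).edges)
    (h2 : e ∈ (P j).edges) (h3 : e' ∈ (P i).edges) (h4 : e' ∈ (P j).edges) : e = e' := by
  have hmem : ∀ {e : Sym2 E3} {a : E3}, e ∈ (P i).edges → e ∈ (P j).edges → a ∈ e →
      a ∈ (P i).region ∩ (P j).region := fun h h' ha =>
    ⟨(P i).vertexSet_subset_region (Face.mem_vertexSet_of_mem_edge h ha),
      (P j).vertexSet_subset_region (Face.mem_vertexSet_of_mem_edge h' ha)⟩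
  induction e with | _ a b
  induction e' with | _ c d
  have hc := hP.isCommonCell hij
  obtain ⟨-, h5⟩ := hc.edge_eq (hP.simple i) h1 (hmem h1 h2 (Sym2.mem_mk_left _ _))
    (hmem h1 h2 (Sym2.mem_mk_right _ _))
  have hc' := hmem h3 h4 (Sym2.mem_mk_left _ _)
  have hd' := hmem h3 h4 (Sym2.mem_mk_right _ _)
  rw [h5] at hc' hd'
  have := (hP.simple i).mem_edge_of_mem_segment
    (Face.mem_vertexSet_of_mem_edge h3 (Sym2.mem_mk_left _ _)) h1 hc'
  have := (hP.simple i).mem_edge_of_mem_segment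
    (Face.mem_vertexSet_of_mem_edge h3 (Sym2.mem_mk_right _ _)) h1 hd'
  exact (Sym2.mem_and_mem_iff ((hP.simple i).ne_of_mem_edges h3)).1 ⟨‹_›, ‹_›⟩

theorem exists_other_face {x : ι} {e : Sym2 E3} (he : e ∈ (P x).edges) :
    ∃ i, i ≠ x ∧ e ∈ (P i).edges := by
  have h := hP.two_faces e (Set.mem_iUnion.2 ⟨x, he⟩)
  have h1 : 1 < {i | e ∈ (P i).edges}.ncard := by omega
  obtain ⟨i, hi, hix⟩ := Set.exists_ne_of_one_lt_ncard h1 x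
  exact ⟨i, hix, hi⟩

end IsPolyhedron

section LinkGraph

variable {ι : Type}

/-- The link of `v`, as a graph on the set of all pairs of points. The pairs that are not edges at
`v` are isolated; in this form, links in different surfaces have the same set of nodes. -/
def linkGraph (P : ι → Face) (v : E3) : SimpleGraph (Sym2 E3) where
  Adj e e' := e ≠ e' ∧ v ∈ e ∧ v ∈ e' ∧ ∃ i, e ∈ (P i).edges ∧ e' ∈ (P i).edges
  symm := ⟨fun _ _ h => ⟨h.1.symm, h.2.2.1, h.2.1, h.2.2.2.imp fun _ hi => ⟨hi.2, hi.1⟩⟩⟩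
  loopless := ⟨fun _ h => h.1 rfl⟩

/-- The link of `v` is a nonempty cycle, in terms of `linkGraph`. -/
structure IsLinkCycle (P : ι → Face) (v : E3) : Prop where
  nonempty : ∃ e ∈ edges P, v ∈ e
  reachable : ∀ e e', e ∈ edges P → v ∈ e → e' ∈ edges P → v ∈ e' →
    (linkGraph P v).Reachable e e'
  degree : ∀ e, e ∈ edges P → v ∈ e → ((linkGraph P v).neighborSet e).ncard = 2

theorem link_eq_comap (P : ι → Face) (v : E3) :
    link P v = (linkGraph P v).comap Subtype.val := by
  ext ⟨e, he, hv⟩ ⟨e', he', hv'⟩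
  change (_ ∧ _) ↔ (_ ∧ _ ∧ _ ∧ _)
  simp [hv, hv', Subtype.ext_iff]

theorem linkGraph_neighborSet (P : ι → Face) (v : E3) (e : {e // e ∈ edges P ∧ v ∈ e}) :
    (linkGraph P v).neighborSet e = Subtype.val '' (link P v).neighborSet e := by
  ext e'
  simp only [SimpleGraph.mem_neighborSet, Set.mem_image, link_eq_comap, SimpleGraph.comap_adj]
  constructor
  · intro h
    exact ⟨⟨e', Set.mem_iUnion.2 (h.2.2.2.imp fun i hi => hi.2), h.2.2.1⟩, h, rfl⟩
  · rintro ⟨e'', h, rfl⟩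
    exact h

theorem isLinkCycle_iff (P : ι → Face) (v : E3) : IsLinkCycle P v ↔
    (link P v).Connected ∧ ∀ e, ((link P v).neighborSet e).ncard = 2 := by
  have hn : ∀ e : {e // e ∈ edges P ∧ v ∈ e},
      ((linkGraph P v).neighborSet e).ncard = ((link P v).neighborSet e).ncard := fun e => by
    rw [linkGraph_neighborSet, Set.ncard_image_of_injective _ Subtype.val_injective]
  constructor
  · rintro ⟨⟨e₀, h₀, h₀'⟩, h1, h2⟩
    refine ⟨?_, fun e => (hn e).symm.trans (h2 _ e.2.1 e.2.2)⟩
    have : Nonempty {e // e ∈ edges P ∧ v ∈ e} := ⟨⟨e₀, h₀, h₀'⟩⟩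
    refine SimpleGraph.Connected.mk fun ⟨e, he, hv⟩ ⟨e', he', hv'⟩ => ?_
    obtain ⟨w⟩ := h1 e e' he hv he' hv'
    clear hn h1 h2
    induction w with
    | nil => exact .refl _
    | cons hadj w ih =>
      have hmid := Set.mem_iUnion.2 (hadj.2.2.2.imp fun i hi => hi.2)
      have h3 := ih hmid hadj.2.2.1 he' hv'
      refine SimpleGraph.Reachable.trans (SimpleGraph.Adj.reachable ?_) h3
      rw [link_eq_comap]
      exact hadj
  · rintro ⟨h1, h2⟩
    obtain ⟨⟨e₀, h₀, h₀'⟩⟩ := h1.nonempty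
    refine ⟨⟨e₀, h₀, h₀'⟩, fun e e' he hv he' hv' => ?_, fun e he hv =>
      (hn ⟨e, he, hv⟩).trans (h2 _)⟩
    have h3 := h1.preconnected ⟨e, he, hv⟩ ⟨e', he', hv'⟩
    rw [link_eq_comap] at h3
    exact h3.map (SimpleGraph.Hom.comap Subtype.val (linkGraph P v))

/-- Removing an edge from a cycle leaves a connected graph. -/
theorem connected_deleteEdges_of_cycle {V : Type*} [Finite V] {G : SimpleGraph V}
    (hG : G.Connected) (h2 : ∀ e, (G.neighborSet e).ncard = 2) {a b : V} (hab : G.Adj a b) :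
    (G.deleteEdges {s(a, b)}).Connected := by
  have hc : G.IsCycles := fun v _ => h2 v
  have := hc.reachable_deleteEdges hab
  apply hG.connected_delete_edge_of_not_isBridge
  rw [SimpleGraph.isBridge_iff]
  exact fun h => h this

end LinkGraph

/-! ### Gluing polyhedra along a face -/

/-- `R` consists of the faces of `P` other than the `x`-th one and the faces of `Q` other than the
`y`-th one, where these two faces coincide and contain all common points of the two surfaces. -/
structure IsGluing {ι κ μ : Type} (P : ι → Face) (x : ι) (Q : κ → Face) (y : κ) (R : μ → Face) :
    Prop where
  left : IsPolyhedron P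
  right : IsPolyhedron Q
  eq : P x = Q y
  surface_inter : surface P ∩ surface Q ⊆ (P x).region
  cover : ∀ k, (∃ i, i ≠ x ∧ R k = P i) ∨ ∃ j, j ≠ y ∧ R k = Q j
  exists_left : ∀ i, i ≠ x → ∃ k, R k = P i
  exists_right : ∀ j, j ≠ y → ∃ k, R k = Q j

namespace IsGluing

variable {ι κ μ : Type} {P : ι → Face} {x : ι} {Q : κ → Face} {y : κ} {R : μ → Face}
  (h : IsGluing P x Q y R)
include h

theorem symm : IsGluing Q y P x R where
  left := h.right
  right := h.left
  eq := h.eq.symm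
  surface_inter := by
    rw [Set.inter_comm, ← h.eq]
    exact h.surface_inter
  cover k := (h.cover k).symm
  exists_left := h.exists_right
  exists_right := h.exists_left

theorem mem_region {i : ι} {j : κ} {p : E3} (hi : p ∈ (P i).region) (hj : p ∈ (Q j).region) :
    p ∈ (P x).region :=
  h.surface_inter ⟨Set.mem_iUnion.2 ⟨i, hi⟩, Set.mem_iUnion.2 ⟨j, hj⟩⟩

/-- A common edge of the two surfaces is an edge of the common face. -/
theorem mem_face_edges {e : Sym2 E3} (hP : e ∈ edges P) (hQ : e ∈ edges Q) :
    e ∈ (P x).edges := by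
  obtain ⟨i, hi⟩ := Set.mem_iUnion.1 hP
  obtain ⟨j, hj⟩ := Set.mem_iUnion.1 hQ
  by_cases hix : i = x
  · exact hix ▸ hi
  have hmem : ∀ a ∈ e, a ∈ (P i).region ∩ (P x).region := fun a ha => by
    have h1 := (P i).vertexSet_subset_region (Face.mem_vertexSet_of_mem_edge hi ha)
    exact ⟨h1, h.mem_region h1
      ((Q j).vertexSet_subset_region (Face.mem_vertexSet_of_mem_edge hj ha))⟩
  induction e with | _ a b
  exact ((h.left.isCommonCell hix).edge_eq (h.left.simple i) hi (hmem a (Sym2.mem_mk_left _ _))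
    (hmem b (Sym2.mem_mk_right _ _))).1

theorem mem_face_vertexSet {v : E3} (hP : v ∈ vertices P) (hQ : v ∈ vertices Q) :
    v ∈ (P x).vertexSet := by
  obtain ⟨i, hi⟩ := Set.mem_iUnion.1 hP
  obtain ⟨j, hj⟩ := Set.mem_iUnion.1 hQ
  by_cases hix : i = x
  · exact hix ▸ hi
  have h1 := (P i).vertexSet_subset_region hi
  exact (h.left.isCommonCell hix).mem_vertexSet (h.left.simple i)
    ⟨h1, h.mem_region h1 ((Q j).vertexSet_subset_region hj)⟩ hi

/-- No edges are lost by the removal of the common face: each of its edges lies in another face. -/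
theorem edges_subset_left : edges P ⊆ edges R := by
  intro e he
  obtain ⟨i, hi⟩ := Set.mem_iUnion.1 he
  obtain ⟨i', hix, hi'⟩ : ∃ i', i' ≠ x ∧ e ∈ (P i').edges := by
    by_cases hix : i = x
    · exact h.left.exists_other_face (hix ▸ hi)
    · exact ⟨i, hix, hi⟩
  obtain ⟨k, hk⟩ := h.exists_left i' hix
  exact Set.mem_iUnion.2 ⟨k, hk ▸ hi'⟩

theorem edges_eq : edges R = edges P ∪ edges Q := by
  refine Set.Subset.antisymm (fun e he => ?_)
    (Set.union_subset h.edges_subset_left h.symm.edges_subset_left)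
  obtain ⟨k, hk⟩ := Set.mem_iUnion.1 he
  rcases h.cover k with ⟨i, -, hi⟩ | ⟨j, -, hj⟩
  · exact Or.inl (Set.mem_iUnion.2 ⟨i, hi ▸ hk⟩)
  · exact Or.inr (Set.mem_iUnion.2 ⟨j, hj ▸ hk⟩)

theorem vertices_subset_left : vertices P ⊆ vertices R := by
  intro v hv
  obtain ⟨i, hi⟩ := Set.mem_iUnion.1 hv
  obtain ⟨e₁, _, _, he⟩ := (h.left.simple i).exists_edges_at hi
  obtain ⟨h1, h2⟩ := (he e₁).2 (Or.inl rfl)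
  obtain ⟨k, hk⟩ := Set.mem_iUnion.1 (h.edges_subset_left (Set.mem_iUnion.2 ⟨i, h1⟩))
  exact Set.mem_iUnion.2 ⟨k, Face.mem_vertexSet_of_mem_edge hk h2⟩

theorem vertices_eq : vertices R = vertices P ∪ vertices Q := by
  refine Set.Subset.antisymm (fun e he => ?_)
    (Set.union_subset h.vertices_subset_left h.symm.vertices_subset_left)
  obtain ⟨k, hk⟩ := Set.mem_iUnion.1 he
  rcases h.cover k with ⟨i, -, hi⟩ | ⟨j, -, hj⟩
  · exact Or.inl (Set.mem_iUnion.2 ⟨i, hi ▸ hk⟩)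
  · exact Or.inr (Set.mem_iUnion.2 ⟨j, hj ▸ hk⟩)

theorem vertices_inter : vertices P ∩ vertices Q = (P x).vertexSet :=
  Set.Subset.antisymm (fun _ hv => h.mem_face_vertexSet hv.1 hv.2) fun _ hv =>
    ⟨Set.mem_iUnion.2 ⟨x, hv⟩, Set.mem_iUnion.2 ⟨y, h.eq ▸ hv⟩⟩

theorem adj_iff {v : E3} {e e' : Sym2 E3} : (linkGraph R v).Adj e e' ↔
    e ≠ e' ∧ v ∈ e ∧ v ∈ e' ∧ ((∃ i, i ≠ x ∧ e ∈ (P i).edges ∧ e' ∈ (P i).edges) ∨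
      ∃ j, j ≠ y ∧ e ∈ (Q j).edges ∧ e' ∈ (Q j).edges) := by
  refine and_congr_right fun _ => and_congr_right fun _ => and_congr_right fun _ => ?_
  constructor
  · rintro ⟨k, hk, hk'⟩
    rcases h.cover k with ⟨i, hi, e⟩ | ⟨j, hj, e⟩
    · exact Or.inl ⟨i, hi, e ▸ hk, e ▸ hk'⟩
    · exact Or.inr ⟨j, hj, e ▸ hk, e ▸ hk'⟩
  · rintro (⟨i, hi, h1, h2⟩ | ⟨j, hj, h1, h2⟩)
    · obtain ⟨k, hk⟩ := h.exists_left i hi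
      exact ⟨k, hk ▸ h1, hk ▸ h2⟩
    · obtain ⟨k, hk⟩ := h.exists_right j hj
      exact ⟨k, hk ▸ h1, hk ▸ h2⟩

/-- Away from the common face, the links do not change. -/
theorem isLinkCycle_of_notMem {v : E3} (hv : v ∈ vertices P) (hx : v ∉ (P x).vertexSet) :
    IsLinkCycle R v := by
  have hQ : ∀ e ∈ edges Q, v ∉ e := fun e he hve => by
    obtain ⟨j, hj⟩ := Set.mem_iUnion.1 he
    exact hx (h.mem_face_vertexSet hv
      (Set.mem_iUnion.2 ⟨j, Face.mem_vertexSet_of_mem_edge hj hve⟩))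
  have hlink : linkGraph R v = linkGraph P v := by
    ext e e'
    rw [h.adj_iff]
    refine and_congr_right fun _ => and_congr_right fun h1 => and_congr_right fun _ => ?_
    constructor
    · rintro (⟨i, -, hi⟩ | ⟨j, -, hj, -⟩)
      · exact ⟨i, hi⟩
      · exact (hQ e (Set.mem_iUnion.2 ⟨j, hj⟩) h1).elim
    · rintro ⟨i, hi⟩
      refine Or.inl ⟨i, ?_, hi⟩
      rintro rfl
      exact hx (Face.mem_vertexSet_of_mem_edge hi.1 h1)
  have hmem : ∀ e ∈ edges R, v ∈ e → e ∈ edges P := fun e he hve =>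
    ((h.edges_eq ▸ he : e ∈ edges P ∪ edges Q)).resolve_right fun h' => hQ e h' hve
  obtain ⟨⟨e₀, h0, h0'⟩, h1, h2⟩ := (isLinkCycle_iff P v).2 (h.left.link_cycle v hv)
  refine ⟨⟨e₀, h.edges_subset_left h0, h0'⟩, fun e e' he hve he' hve' => ?_, fun e he hve => ?_⟩
  · rw [hlink]
    exact h1 e e' (hmem e he hve) hve (hmem e' he' hve') hve'
  · rw [hlink]
    exact h2 e (hmem e he hve) hve

/-- At a vertex of the common face, with edges `e₁` and `e₂` of that face, the link of `P` without
the pair `e₁ e₂` is a path in the link of the glued surface. -/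
theorem reachable_left {v : E3} {e₁ e₂ : Sym2 E3} (hne : e₁ ≠ e₂)
    (he : ∀ e, (e ∈ (P x).edges ∧ v ∈ e) ↔ (e = e₁ ∨ e = e₂)) {e : Sym2 E3} (heP : e ∈ edges P)
    (hve : v ∈ e) : (linkGraph R v).Reachable e e₁ := by
  obtain ⟨h1, hv1⟩ := (he e₁).2 (Or.inl rfl)
  obtain ⟨h2, hv2⟩ := (he e₂).2 (Or.inr rfl)
  have hv : v ∈ vertices P :=
    Set.mem_iUnion.2 ⟨x, Face.mem_vertexSet_of_mem_edge h1 hv1⟩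
  obtain ⟨hc, hd⟩ := h.left.link_cycle v hv
  have : Finite {e // e ∈ edges P ∧ v ∈ e} :=
    (h.left.finite_edges.subset fun e he => he.1).to_subtype
  let a : {e // e ∈ edges P ∧ v ∈ e} := ⟨e₁, Set.mem_iUnion.2 ⟨x, h1⟩, hv1⟩
  let b : {e // e ∈ edges P ∧ v ∈ e} := ⟨e₂, Set.mem_iUnion.2 ⟨x, h2⟩, hv2⟩
  have hab : (link P v).Adj a b := ⟨fun e => hne (congrArg Subtype.val e), x, h1, h2⟩
  have hcon := connected_deleteEdges_of_cycle hc hd hab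
  let φ : (link P v).deleteEdges {s(a, b)} →g linkGraph R v :=
    { toFun := Subtype.val
      map_rel' := by
        rintro ⟨e, heP, hve⟩ ⟨e', heP', hve'⟩ hadj
        rw [SimpleGraph.deleteEdges_adj] at hadj
        obtain ⟨⟨hne', i, hi, hi'⟩, hdel⟩ := hadj
        refine h.adj_iff.2 ⟨fun h => hne' (Subtype.ext h), hve, hve', Or.inl ⟨i, ?_, hi, hi'⟩⟩
        rintro rfl
        apply hdel
        have hee' : e ≠ e' := fun h => hne' (Subtype.ext h)
        rcases (he e).1 ⟨hi, hve⟩ with rfl | rfl <;> rcases (he e').1 ⟨hi', hve'⟩ with rfl | rfl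
        · exact (hee' rfl).elim
        · rfl
        · exact Sym2.eq_swap
        · exact (hee' rfl).elim }
  exact (hcon.preconnected ⟨e, heP, hve⟩ a).map φ

/-- The neighbours, in the link of the glued surface, that come from faces of `P`. -/
theorem mem_left_iff {v : E3} {e₁ e₂ : Sym2 E3} (hne : e₁ ≠ e₂)
    (he : ∀ e, (e ∈ (P x).edges ∧ v ∈ e) ↔ (e = e₁ ∨ e = e₂)) {e e' : Sym2 E3} :
    (e ≠ e' ∧ v ∈ e ∧ v ∈ e' ∧ ∃ i, i ≠ x ∧ e ∈ (P i).edges ∧ e' ∈ (P i).edges) ↔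
      (linkGraph P v).Adj e e' ∧ ¬ ((e = e₁ ∧ e' = e₂) ∨ (e = e₂ ∧ e' = e₁)) := by
  constructor
  · rintro ⟨h1, h2, h3, i, hix, hi, hi'⟩
    refine ⟨⟨h1, h2, h3, i, hi, hi'⟩, fun hor => h1 ?_⟩
    have hee : e ∈ (P x).edges ∧ e' ∈ (P x).edges := by
      rcases hor with ⟨rfl, rfl⟩ | ⟨rfl, rfl⟩
      · exact ⟨((he _).2 (Or.inl rfl)).1, ((he _).2 (Or.inr rfl)).1⟩
      · exact ⟨((he _).2 (Or.inr rfl)).1, ((he _).2 (Or.inl rfl)).1⟩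
    exact h.left.eq_of_mem_edges hix hi hee.1 hi' hee.2
  · rintro ⟨⟨h1, h2, h3, i, hi, hi'⟩, hor⟩
    refine ⟨h1, h2, h3, i, ?_, hi, hi'⟩
    rintro rfl
    rcases (he e).1 ⟨hi, h2⟩ with rfl | rfl <;> rcases (he e').1 ⟨hi', h3⟩ with rfl | rfl
    · exact h1 rfl
    · exact hor (Or.inl ⟨rfl, rfl⟩)
    · exact hor (Or.inr ⟨rfl, rfl⟩)
    · exact h1 rfl

/-- An edge at `v` that is not an edge of the common face keeps its neighbours in the link. -/
theorem degree_left {v : E3} {e₁ e₂ : Sym2 E3} (hne : e₁ ≠ e₂)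
    (he : ∀ e, (e ∈ (P x).edges ∧ v ∈ e) ↔ (e = e₁ ∨ e = e₂)) {e : Sym2 E3} (heP : e ∈ edges P)
    (hve : v ∈ e) (hn : e ≠ e₁ ∧ e ≠ e₂) : ((linkGraph R v).neighborSet e).ncard = 2 := by
  have hv : v ∈ vertices P := by
    obtain ⟨i, hi⟩ := Set.mem_iUnion.1 heP
    exact Set.mem_iUnion.2 ⟨i, Face.mem_vertexSet_of_mem_edge hi hve⟩
  rw [← ((isLinkCycle_iff P v).2 (h.left.link_cycle v hv)).degree e heP hve]
  congr 1
  ext e'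
  rw [SimpleGraph.mem_neighborSet, SimpleGraph.mem_neighborSet, h.adj_iff]
  have key := h.mem_left_iff hne he (e := e) (e' := e')
  constructor
  · rintro ⟨h1, h2, h3, h4 | ⟨j, -, hj, -⟩⟩
    · exact (key.1 ⟨h1, h2, h3, h4⟩).1
    · have := (he e).1 ⟨h.mem_face_edges heP (Set.mem_iUnion.2 ⟨j, hj⟩), hve⟩
      tauto
  · intro hadj
    obtain ⟨h1, h2, h3, h4⟩ := key.2 ⟨hadj, by tauto⟩
    exact ⟨h1, h2, h3, Or.inl h4⟩

/-- For an edge `e₁` of the common face, the neighbour `e₂` in the link is lost on both sides, so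
one neighbour from each of the two surfaces remains. -/
theorem degree_common {v : E3} {e₁ e₂ : Sym2 E3} (hne : e₁ ≠ e₂)
    (he : ∀ e, (e ∈ (P x).edges ∧ v ∈ e) ↔ (e = e₁ ∨ e = e₂)) :
    ((linkGraph R v).neighborSet e₁).ncard = 2 := by
  obtain ⟨h1, hv1⟩ := (he e₁).2 (Or.inl rfl)
  obtain ⟨h2, hv2⟩ := (he e₂).2 (Or.inr rfl)
  have h1' : e₁ ∈ (Q y).edges := h.eq ▸ h1
  have h2' : e₂ ∈ (Q y).edges := h.eq ▸ h2
  have heQ : ∀ e, (e ∈ (Q y).edges ∧ v ∈ e) ↔ (e = e₁ ∨ e = e₂) := h.eq ▸ he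
  have hP := ((isLinkCycle_iff P v).2 (h.left.link_cycle v
    (Set.mem_iUnion.2 ⟨x, Face.mem_vertexSet_of_mem_edge h1 hv1⟩))).degree e₁
    (Set.mem_iUnion.2 ⟨x, h1⟩) hv1
  have hQ := ((isLinkCycle_iff Q v).2 (h.right.link_cycle v
    (Set.mem_iUnion.2 ⟨y, Face.mem_vertexSet_of_mem_edge h1' hv1⟩))).degree e₁
    (Set.mem_iUnion.2 ⟨y, h1'⟩) hv1
  have hset : (linkGraph R v).neighborSet e₁ = ((linkGraph P v).neighborSet e₁ \ {e₂}) ∪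
      ((linkGraph Q v).neighborSet e₁ \ {e₂}) := by
    ext e'
    have k1 := h.mem_left_iff hne he (e := e₁) (e' := e')
    have k2 := h.symm.mem_left_iff hne heQ (e := e₁) (e' := e')
    simp only [SimpleGraph.mem_neighborSet, h.adj_iff, Set.mem_union, Set.mem_sdiff,
      Set.mem_singleton_iff]
    constructor
    · rintro ⟨h3, h4, h5, h6 | h6⟩
      · obtain ⟨h7, h8⟩ := k1.1 ⟨h3, h4, h5, h6⟩
        exact Or.inl ⟨h7, fun e => h8 (Or.inl ⟨rfl, e⟩)⟩
      · obtain ⟨h7, h8⟩ := k2.1 ⟨h3, h4, h5, h6⟩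
        exact Or.inr ⟨h7, fun e => h8 (Or.inl ⟨rfl, e⟩)⟩
    · have hn : e' ≠ e₂ → ¬ ((e₁ = e₁ ∧ e' = e₂) ∨ (e₁ = e₂ ∧ e' = e₁)) := by
        rintro h3 (⟨-, e⟩ | ⟨e, -⟩)
        exacts [h3 e, hne e]
      rintro (⟨h3, h4⟩ | ⟨h3, h4⟩)
      · obtain ⟨h5, h6, h7, h8⟩ := k1.2 ⟨h3, hn h4⟩
        exact ⟨h5, h6, h7, Or.inl h8⟩
      · obtain ⟨h5, h6, h7, h8⟩ := k2.2 ⟨h3, hn h4⟩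
        exact ⟨h5, h6, h7, Or.inr h8⟩
  have hdisj : Disjoint ((linkGraph P v).neighborSet e₁ \ {e₂})
      ((linkGraph Q v).neighborSet e₁ \ {e₂}) := by
    rw [Set.disjoint_left]
    rintro e' ⟨hadj, hne'⟩ ⟨hadj', -⟩
    have hadj : (linkGraph P v).Adj e₁ e' := hadj
    have hadj' : (linkGraph Q v).Adj e₁ e' := hadj'
    have hF := h.mem_face_edges (Set.mem_iUnion.2 (hadj.2.2.2.imp fun i hi => hi.2))
      (Set.mem_iUnion.2 (hadj'.2.2.2.imp fun i hi => hi.2))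
    rcases (he e').1 ⟨hF, hadj.2.2.1⟩ with rfl | rfl
    · exact hadj.1 rfl
    · exact hne' rfl
  have hfP := Set.finite_of_ncard_ne_zero (hP.trans_ne two_ne_zero)
  have hfQ := Set.finite_of_ncard_ne_zero (hQ.trans_ne two_ne_zero)
  rw [hset, Set.ncard_union_eq hdisj hfP.sdiff hfQ.sdiff,
    Set.ncard_sdiff_singleton_of_mem (show e₂ ∈ (linkGraph P v).neighborSet e₁ from
      ⟨hne, hv1, hv2, x, h1, h2⟩),
    Set.ncard_sdiff_singleton_of_mem (show e₂ ∈ (linkGraph Q v).neighborSet e₁ from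
      ⟨hne, hv1, hv2, y, h1', h2'⟩), hP, hQ]

/-- At a vertex of the common face, the two links, which are cycles, are joined along the edge that
corresponds to that face, and the edge is removed. -/
theorem isLinkCycle_of_mem {v : E3} (hx : v ∈ (P x).vertexSet) : IsLinkCycle R v := by
  obtain ⟨e₁, e₂, hne, he⟩ := (h.left.simple x).exists_edges_at hx
  have heQ : ∀ e, (e ∈ (Q y).edges ∧ v ∈ e) ↔ (e = e₁ ∨ e = e₂) := h.eq ▸ he
  obtain ⟨h1, hv1⟩ := (he e₁).2 (Or.inl rfl)
  have hr : ∀ e ∈ edges R, v ∈ e → (linkGraph R v).Reachable e e₁ := by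
    intro e heR hve
    rw [h.edges_eq] at heR
    rcases heR with heP | heQ'
    · exact h.reachable_left hne he heP hve
    · exact h.symm.reachable_left hne heQ heQ' hve
  refine ⟨⟨e₁, h.edges_subset_left (Set.mem_iUnion.2 ⟨x, h1⟩), hv1⟩,
    fun e e' heR hve heR' hve' => (hr e heR hve).trans (hr e' heR' hve').symm, ?_⟩
  intro e heR hve
  by_cases e1 : e = e₁
  · rw [e1]
    exact h.degree_common hne he
  by_cases e2 : e = e₂
  · rw [e2]
    exact h.degree_common hne.symm fun e => (he e).trans or_comm
  rw [h.edges_eq] at heR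
  rcases heR with heP | heQ'
  · exact h.degree_left hne he heP hve ⟨e1, e2⟩
  · exact h.symm.degree_left hne heQ heQ' hve ⟨e1, e2⟩

theorem link_cycle {v : E3} (hv : v ∈ vertices R) :
    (link R v).Connected ∧ ∀ e, ((link R v).neighborSet e).ncard = 2 := by
  rw [← isLinkCycle_iff]
  by_cases hx : v ∈ (P x).vertexSet
  · exact h.isLinkCycle_of_mem hx
  rw [h.vertices_eq] at hv
  rcases hv with hP | hQ
  · exact h.isLinkCycle_of_notMem hP hx
  · exact h.symm.isLinkCycle_of_notMem hQ (h.eq ▸ hx)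

end IsGluing

section Glue

variable {ι κ : Type}

/-- The faces of `P` other than the `x`-th one, together with the faces of `Q` other than the
`y`-th one. -/
def glue (P : ι → Face) (x : ι) (Q : κ → Face) (y : κ) :
    {i // i ≠ x} ⊕ {j // j ≠ y} → Face :=
  Sum.elim (fun i => P i) (fun j => Q j)

variable {P : ι → Face} {x : ι} {Q : κ → Face} {y : κ}

theorem isGluing_glue (hP : IsPolyhedron P) (hQ : IsPolyhedron Q) (hxy : P x = Q y)
    (hs : surface P ∩ surface Q ⊆ (P x).region) : IsGluing P x Q y (glue P x Q y) where
  left := hP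
  right := hQ
  eq := hxy
  surface_inter := hs
  cover := by
    rintro (⟨i, hi⟩ | ⟨j, hj⟩)
    exacts [Or.inl ⟨i, hi, rfl⟩, Or.inr ⟨j, hj, rfl⟩]
  exists_left i hi := ⟨.inl ⟨i, hi⟩, rfl⟩
  exists_right j hj := ⟨.inr ⟨j, hj⟩, rfl⟩

/-- Two polyhedra whose surfaces have just one face in common can be glued along that face. -/
theorem IsPolyhedron.glue (hP : IsPolyhedron P) (hQ : IsPolyhedron Q) (hxy : P x = Q y)
    (hs : surface P ∩ surface Q ⊆ (P x).region) : IsPolyhedron (glue P x Q y) := by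
  have h := isGluing_glue hP hQ hxy hs
  have := hP.finite
  have := hQ.finite
  have hmixed : ∀ i j, i ≠ x → j ≠ y →
      IsCommonCell (P i) (Q j) ((P i).region ∩ (Q j).region) := by
    intro i j hi hj
    have h1 := hP.isCommonCell hi
    have h2 := hQ.isCommonCell hj
    rw [← hxy] at h2
    have h3 := h1.inter (hP.simple x) h2
    have e : ((P i).region ∩ (P x).region) ∩ ((Q j).region ∩ (P x).region) =
        (P i).region ∩ (Q j).region := by
      ext p
      constructor
      · rintro ⟨⟨hp, -⟩, hp', -⟩
        exact ⟨hp, hp'⟩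
      · rintro ⟨hp, hp'⟩
        have := h.mem_region hp hp'
        exact ⟨⟨hp, this⟩, hp', this⟩
    rwa [e] at h3
  have hcell : ∀ k l, k ≠ l → IsCommonCell (RectangularPolyhedra.glue P x Q y k)
      (RectangularPolyhedra.glue P x Q y l) ((RectangularPolyhedra.glue P x Q y k).region ∩
        (RectangularPolyhedra.glue P x Q y l).region) := by
    rintro (⟨i, hi⟩ | ⟨j, hj⟩) (⟨i', hi'⟩ | ⟨j', hj'⟩) hkl
    · exact hP.isCommonCell fun e => hkl (by subst e; rfl)
    · exact hmixed i j' hi hj'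
    · have := (hmixed i' j hi' hj).symm
      rw [Set.inter_comm] at this
      exact this
    · exact hQ.isCommonCell fun e => hkl (by subst e; rfl)
  refine ⟨inferInstance, ?_, ?_, ?_, fun v hv => h.link_cycle hv⟩
  · rintro (i | j)
    exacts [hP.simple i, hQ.simple j]
  · intro k l hkl
    have := hcell k l hkl
    rwa [IsCommonCell, ← Set.disjoint_iff_inter_eq_empty] at this
  · intro e he
    have hsplit : {k | e ∈ (RectangularPolyhedra.glue P x Q y k).edges} =
        Sum.inl '' {i : {i // i ≠ x} | e ∈ (P i).edges} ∪
          Sum.inr '' {j : {j // j ≠ y} | e ∈ (Q j).edges} := by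
      ext (i | j) <;> simp [RectangularPolyhedra.glue]
    have hl : ∀ {α : Type} (p : α → Prop) (z : α), {a : {a // a ≠ z} | p a}.ncard =
        ({a | p a} \ {z}).ncard := by
      intro α p z
      rw [← Set.ncard_image_of_injective _ Subtype.val_injective]
      congr 1
      ext a
      simp [and_comm]
    rw [hsplit, Set.ncard_union_eq (by
        rw [Set.disjoint_left]
        rintro _ ⟨a, -, rfl⟩ ⟨b, -, hb⟩
        exact absurd hb (by simp)),
      Set.ncard_image_of_injective _ Sum.inl_injective,
      Set.ncard_image_of_injective _ Sum.inr_injective, hl (fun i => e ∈ (P i).edges) x,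
      hl (fun j => e ∈ (Q j).edges) y]
    by_cases hx : e ∈ (P x).edges
    · have hy : e ∈ (Q y).edges := hxy ▸ hx
      rw [Set.ncard_sdiff_singleton_of_mem (show x ∈ {i | e ∈ (P i).edges} from hx),
        Set.ncard_sdiff_singleton_of_mem (show y ∈ {j | e ∈ (Q j).edges} from hy),
        hP.two_faces e (Set.mem_iUnion.2 ⟨x, hx⟩), hQ.two_faces e (Set.mem_iUnion.2 ⟨y, hy⟩)]
    · have hy : e ∉ (Q y).edges := hxy ▸ hx
      rw [Set.sdiff_singleton_eq_self (show x ∉ {i | e ∈ (P i).edges} from hx),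
        Set.sdiff_singleton_eq_self (show y ∉ {j | e ∈ (Q j).edges} from hy)]
      have hempty : ∀ {α : Type} (S : α → Face), e ∉ edges S → {a | e ∈ (S a).edges} = ∅ := by
        intro α S hS
        ext a
        simp only [Set.mem_ofPred_eq, Set.mem_empty_iff_false, iff_false]
        exact fun ha => hS (Set.mem_iUnion.2 ⟨a, ha⟩)
      rw [h.edges_eq] at he
      rcases he with heP | heQ
      · rw [hP.two_faces e heP, hempty Q fun heQ => hx (h.mem_face_edges heP heQ),
          Set.ncard_empty]
      · rw [hQ.two_faces e heQ, hempty P fun heP => hx (h.mem_face_edges heP heQ),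
          Set.ncard_empty]

theorem finite_vertices [Finite ι] (P : ι → Face) : (vertices P).Finite :=
  Set.finite_iUnion fun _ => Set.finite_range _

theorem ncard_vertices_glue (hP : IsPolyhedron P) (hQ : IsPolyhedron Q) (hxy : P x = Q y)
    (hs : surface P ∩ surface Q ⊆ (P x).region) (h4 : (P x).1 = 4) :
    (vertices (glue P x Q y)).ncard + 4 = (vertices P).ncard + (vertices Q).ncard := by
  have h := isGluing_glue hP hQ hxy hs
  have := hP.finite
  have := hQ.finite
  have hc : (P x).vertexSet.ncard = 4 := by
    rw [Face.vertexSet, ← Set.image_univ,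
      Set.ncard_image_of_injective _ (hP.simple x).injective, Set.ncard_univ, Nat.card_fin, h4]
  rw [h.vertices_eq, ← hc, ← h.vertices_inter]
  exact Set.ncard_union_add_ncard_inter _ _ (finite_vertices P) (finite_vertices Q)

theorem card_glue [Finite ι] [Finite κ] (x : ι) (y : κ) :
    Nat.card ({i // i ≠ x} ⊕ {j // j ≠ y}) + 2 = Nat.card ι + Nat.card κ := by
  have key : ∀ {α : Type} [Finite α] (z : α), Nat.card {a // a ≠ z} + 1 = Nat.card α := by
    intro α _ z
    have := Fintype.ofFinite α
    classical
    rw [Nat.card_eq_fintype_card, Nat.card_eq_fintype_card, Fintype.card_subtype_compl,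
      Fintype.card_subtype_eq]
    have := Fintype.card_pos_iff.2 ⟨z⟩
    omega
  rw [Nat.card_sum]
  have := key x
  have := key y
  omega

end Glue

/-! ### The incidence structure of the orthogonal torus -/

/-- The vertices of the orthogonal torus, the boundary of the union of nine unit cubes, which is
the product of a planar pattern of nine unit squares with a unit interval. The first component
numbers the vertices of the pattern, the second one distinguishes the two translates of it. -/
abbrev TorusVertex : Type := Fin 18 × Fin 2

/-- The faces of the orthogonal torus: two copies of each of the nine squares, and one face for
each of the eighteen boundary edges of the pattern. -/
abbrev TorusIndex : Type := (Fin 9 × Fin 2) ⊕ Fin 18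

/-- Heights of the vertices of the planar pattern. -/
def patternZ : Fin 18 → ℤ := ![0, 0, 1, 1, 1, 1, 2, 2, 2, 2, 3, 3, 3, 3, 4, 4, 4, 4]

/-- Horizontal coordinates of the vertices of the planar pattern. -/
def patternX : Fin 18 → ℤ := ![0, 1, -1, 0, 1, 2, -1, 0, 1, 2, -1, 0, 1, 2, -1, 0, 1, 2]

/-- The squares of the planar pattern: a single one at height zero, carrying a ring of eight. -/
def patternCell : Fin 9 → Fin 4 → Fin 18 :=
  ![![0, 1, 4, 3], ![3, 4, 8, 7], ![2, 3, 7, 6], ![4, 5, 9, 8], ![6, 7, 11, 10], ![8, 9, 13, 12],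
    ![10, 11, 15, 14], ![12, 13, 17, 16], ![11, 12, 16, 15]]

/-- The boundary edges of the planar pattern. The first one is the bottom edge, the last one is the
middle one of the three top edges. -/
def patternEdge : Fin 18 → Fin 18 × Fin 18 :=
  ![(0, 1), (1, 4), (2, 3), (3, 0), (4, 5), (5, 9), (6, 2), (7, 11), (8, 7), (9, 13), (10, 6),
    (11, 12), (12, 8), (13, 17), (14, 10), (15, 14), (17, 16), (15, 16)]

/-- The neighbours of each vertex of the planar pattern, from one side of the pattern to the
other. -/
def patternLink : Fin 18 → List (Fin 18) :=
  ![[1, 3], [0, 4], [3, 6], [2, 7, 4, 0], [1, 3, 8, 5], [4, 9], [2, 7, 10], [11, 6, 3, 8],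
    [7, 4, 9, 12], [5, 8, 13], [6, 11, 14], [7, 10, 15, 12], [11, 16, 13, 8], [9, 12, 17],
    [10, 15], [14, 11, 16], [17, 12, 15], [13, 16]]

/-- The faces of the orthogonal torus by their vertices. -/
def torusFace : TorusIndex → Fin 4 → TorusVertex
  | .inl (c, y), p => (patternCell c p, y)
  | .inr e, p => ![((patternEdge e).2, 1), ((patternEdge e).2, 0), ((patternEdge e).1, 0),
      ((patternEdge e).1, 1)] p

/-- Twice the coordinates of the vertices of the orthogonal torus. -/
def torusP (v : TorusVertex) : Fin 3 → ℤ :=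
  ![2 * patternZ v.1, 2 * patternX v.1, if v.2 = 0 then 0 else 2]

/-- The vertices surrounding a vertex of the orthogonal torus. -/
def torusLink (v : TorusVertex) (k : Fin ((patternLink v.1).length - 2 + 3)) : TorusVertex :=
  if k.1 = 0 then (v.1, 1 - v.2) else ((patternLink v.1).getD (k.1 - 1) 0, v.2)

/-- The sum of the coordinate vectors of the vertices of a face, a multiple of its centre. -/
def torusCentre (i : TorusIndex) : Fin 3 → ℤ :=
  torusP (torusFace i 0) + torusP (torusFace i 1) + torusP (torusFace i 2) + torusP (torusFace i 3)

/-- The maximum of the linear functional with coefficients `n` over a face. -/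
def torusMax (n : Fin 3 → ℤ) (i : TorusIndex) : ℤ :=
  max (max (dot n (torusP (torusFace i 0))) (dot n (torusP (torusFace i 1))))
    (max (dot n (torusP (torusFace i 2))) (dot n (torusP (torusFace i 3))))

/-- A number assigned to the faces of the orthogonal torus. Among the faces other than the bottom
one and the middle top one, each except `.inl (0, 0)` has a common vertex with one of smaller
rank. -/
def torusRank : TorusIndex → ℕ
  | .inl (c, y) => if y = 0 then c else 10
  | .inr _ => 9

theorem torus_surj : ∀ v, ∃ i p, torusFace i p = v := by decide +kernel

theorem torus_inj : ∀ i p q, torusFace i p = torusFace i q → p = q := by decide +kernel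

theorem torus_common : ∀ i j, i ≠ j → MeetProperly torusFace i j := by decide +kernel

theorem torus_mate : ∀ i p, ∃ j, IsMate torusFace i p j := by decide +kernel

theorem torus_link : ∀ v, Function.Injective (torusLink v) ∧
    IsVertexCycle torusFace v (torusLink v) := by
  unfold Function.Injective
  decide +kernel

theorem torusP_inj : ∀ v w, v ≠ w → ∃ k, torusP v k ≠ torusP w k := by decide +kernel

theorem torus_par : ∀ i k, torusP (torusFace i 2) k =
    torusP (torusFace i 1) k + torusP (torusFace i 3) k - torusP (torusFace i 0) k := by
  decide +kernel

theorem torus_perp : ∀ i, dot (torusP (torusFace i 1) - torusP (torusFace i 0))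
    (torusP (torusFace i 3) - torusP (torusFace i 0)) = 0 := by decide +kernel

/-- The plane perpendicular to the segment between the centres of two faces that supports the first
of the faces separates them. -/
theorem torus_sep : ∀ i j, i ≠ j → IsSeparated torusFace torusP (fun _ => 0)
    (torusCentre j - torusCentre i) (torusMax (torusCentre j - torusCentre i) i) 0 i j := by
  decide +kernel

theorem torus_axisParallel : ∀ i p, ∃ k, ∀ l, l ≠ k →
    torusP (torusFace i (p + 1)) l = torusP (torusFace i p) l := by decide +kernel

theorem torus_rank : ∀ i, i ≠ .inr 0 → i ≠ .inr 17 → i ≠ .inl (0, 0) →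
    ∃ j, (j ≠ .inr 0 ∧ j ≠ .inr 17) ∧ torusRank j < torusRank i ∧
      ∃ p q, torusFace i p = torusFace j q := by decide +kernel

theorem torus_height : ∀ v, 0 ≤ torusP v 0 ∧ torusP v 0 ≤ 8 := by decide +kernel

theorem torus_height_zero : ∀ v, torusP v 0 = 0 → ∃ p, torusFace (.inr 0) p = v := by
  decide +kernel

/-! ### Towers of orthogonal tori -/

theorem torus_isClosedQuadSurface : IsClosedQuadSurface torusFace where
  surj := torus_surj
  inj := torus_inj
  common := torus_common
  two := torus_mate
  cyc v := ⟨_, torusLink v, torus_link v⟩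

theorem torus_isIntRectangular : IsIntRectangular torusFace torusP fun _ _ => 0 where
  inj v w h := (torusP_inj v w h).imp fun k hk => ⟨Or.inl hk, by simp⟩
  parP := torus_par
  parQ _ _ := rfl
  perp i := ⟨torus_perp i, by simp [dot], by simp [dot]⟩
  sep i j h := ⟨_, _, _, torus_sep i j h⟩

/-- The position of the vertices of the orthogonal torus that stands on the plane at height `t`. -/
def torusPt (t : ℝ) (v : TorusVertex) : E3 :=
  latticePt (pt 0 t (-1 / 2) (-1 / 2)) 1 (torusP v) fun _ => 0

theorem torusPt_isRectangular (t : ℝ) : IsRectangular torusFace (torusPt t) :=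
  torus_isIntRectangular.isRectangular _ one_pos

/-- The orthogonal torus that stands on the plane at height `t`. -/
def torus (t : ℝ) : TorusIndex → Face := realize torusFace (torusPt t)

theorem torus_isPolyhedron (t : ℝ) : IsPolyhedron (torus t) :=
  (torusPt_isRectangular t).isPolyhedron torus_isClosedQuadSurface

theorem torus_isRectangle (t : ℝ) (j : TorusIndex) : (torus t j).IsRectangle :=
  (torusPt_isRectangular t).isRectangle j

theorem torusPt_apply (t : ℝ) (v : TorusVertex) (l : Fin 3) :
    torusPt t v l = (if l = 0 then t else -1 / 2) + torusP v l / 2 := by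
  simp [torusPt, latticePt, pt]

theorem torus_isAxisParallel (t : ℝ) (j : TorusIndex) : (torus t j).IsAxisParallel := by
  have key : ∀ p : Fin 4, ∃ k : Fin 3, ∀ l, l ≠ k →
      torusPt t (torusFace j (finRotate 4 p)) l = torusPt t (torusFace j p) l := by
    intro p
    obtain ⟨k, hk⟩ := torus_axisParallel j p
    refine ⟨k, fun l hl => ?_⟩
    rw [finRotate_apply, torusPt_apply, torusPt_apply, hk l hl]
  exact key

theorem torus_ncard_vertices (t : ℝ) : (vertices (torus t)).ncard = 36 := by
  rw [torus, (torusPt_isRectangular t).ncard_vertices torus_isClosedQuadSurface,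
    Nat.card_eq_fintype_card]
  rfl

theorem card_torusIndex : Nat.card TorusIndex = 36 := by
  rw [Nat.card_eq_fintype_card]
  rfl

theorem torus_region (t : ℝ) (j : TorusIndex) :
    (torus t j).region = convexHull ℝ (Set.range fun p => torusPt t (torusFace j p)) :=
  (torusPt_isRectangular t).region_eq torus_isClosedQuadSurface j

theorem convex_le_height (t : ℝ) : Convex ℝ {p : E3 | p 0 ≤ t} :=
  convex_halfSpace_le (EuclideanSpace.proj (𝕜 := ℝ) (0 : Fin 3)).isLinear t

theorem convex_height_ge (t : ℝ) : Convex ℝ {p : E3 | t ≤ p 0} :=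
  convex_halfSpace_ge (EuclideanSpace.proj (𝕜 := ℝ) (0 : Fin 3)).isLinear t

theorem torus_region_le (t : ℝ) (j : TorusIndex) {p : E3} (hp : p ∈ (torus t j).region) :
    p 0 ≤ t + 4 := by
  rw [torus_region] at hp
  refine convexHull_min ?_ (convex_le_height (t + 4)) hp
  rintro _ ⟨q, rfl⟩
  have h : ((torusP (torusFace j q) 0 : ℤ) : ℝ) ≤ 8 := by
    exact_mod_cast (torus_height (torusFace j q)).2
  simp only [Set.mem_ofPred_eq, torusPt_apply, if_true]
  linarith

/-- The torus meets the half-space below the plane on which it stands in its bottom face. -/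
theorem torus_region_bottom (t : ℝ) (j : TorusIndex) {p : E3} (hp : p ∈ (torus t j).region)
    (ht : p 0 ≤ t) : p ∈ (torus t (.inr 0)).region := by
  rw [torus_region] at hp ⊢
  by_contra hcon
  -- minus the height separates the face from the half-space, so that they meet in the hull of those
  -- vertices of the face that lie on the plane
  have h2 := convexHull_inter_of_separated (A := Set.range fun p => torusPt t (torusFace j p))
    (B := {q : E3 | q 0 ≤ t}) (-(EuclideanSpace.proj (𝕜 := ℝ) (0 : Fin 3)).toLinearMap) (-t)
    (by
      rintro _ ⟨q, rfl⟩
      have h : (0 : ℝ) ≤ ((torusP (torusFace j q) 0 : ℤ) : ℝ) := by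
        exact_mod_cast (torus_height (torusFace j q)).1
      change -(torusPt t (torusFace j q) 0) ≤ -t
      rw [torusPt_apply, if_pos rfl]
      linarith)
    (fun x hx => neg_le_neg hx) (fun x _ hx => le_of_eq (neg_injective hx))
  rw [(convex_le_height t).convexHull_eq] at h2
  have h3 := h2.subset ⟨hp, ht⟩
  refine hcon (convexHull_mono ?_ h3)
  rintro _ ⟨⟨q, rfl⟩, hq⟩
  have hq : torusPt t (torusFace j q) 0 ≤ t := hq
  rw [torusPt_apply, if_pos rfl] at hq
  have h : torusP (torusFace j q) 0 ≤ 0 := by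
    have : ((torusP (torusFace j q) 0 : ℤ) : ℝ) ≤ 0 := by linarith
    exact_mod_cast this
  obtain ⟨r, hr⟩ := torus_height_zero (torusFace j q)
    (le_antisymm h (torus_height (torusFace j q)).1)
  exact ⟨r, congrArg (torusPt t) hr⟩

/-- The torus remains connected without its bottom face and the middle top face. -/
theorem torus_isConnected_biUnion (t : ℝ) :
    IsConnected (⋃ j ∈ {j : TorusIndex | j ≠ .inr 0 ∧ j ≠ .inr 17}, (torus t j).region) :=
  (torusPt_isRectangular t).isConnected_biUnion torus_isClosedQuadSurface (r := .inl (0, 0))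
    (by simp) torusRank fun i hi hir => torus_rank i hi.1 hi.2 hir

/-- The unit square centred on the first coordinate axis and perpendicular to it, at height `t`. -/
def unitSquare (t : ℝ) : Face :=
  quad (pt 0 t (1 / 2) (1 / 2)) (pt 0 t (1 / 2) (-1 / 2)) (pt 0 t (-1 / 2) (-1 / 2))
    (pt 0 t (-1 / 2) (1 / 2))

theorem octopus_top (L : ℝ) : octopus L (.inl (0, 1)) = unitSquare (L / √2 + 1 / 2) := by
  simp [octopus, unitSquare, sgn]

theorem torus_eq_unitSquare (t s : ℝ) (e : Fin 18)
    (h : ∀ p, torusPt t (torusFace (.inr e) p) =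
      ![pt 0 s (1 / 2) (1 / 2), pt 0 s (1 / 2) (-1 / 2), pt 0 s (-1 / 2) (-1 / 2),
        pt 0 s (-1 / 2) (1 / 2)] p) : torus t (.inr e) = unitSquare s := by
  have : (fun p => torusPt t (torusFace (.inr e) p)) = _ := funext h
  unfold torus realize
  rw [this]
  rfl

theorem torus_bottom (t : ℝ) : torus t (.inr 0) = unitSquare t := by
  apply torus_eq_unitSquare
  intro p
  ext l
  rw [torusPt_apply]
  fin_cases p <;> fin_cases l <;>
    simp [torusFace, torusP, patternEdge, patternX, patternZ, pt] <;> norm_num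

theorem torus_top (t : ℝ) : torus t (.inr 17) = unitSquare (t + 4) := by
  apply torus_eq_unitSquare
  intro p
  ext l
  rw [torusPt_apply]
  fin_cases p <;> fin_cases l <;>
    simp [torusFace, torusP, patternEdge, patternX, patternZ, pt] <;> norm_num

/-- `P` is a polyhedron with rectangular faces obtained from the octahedral example by replacing the
top square by axis-parallel faces, and its `x`-th face is a unit square at the maximal height `t`,
without which the surface remains connected. The number `g` is its genus; in the formula for it, the
number of edges is expressed as twice the number of faces. -/
structure IsTower (L : ℝ) (g : ℕ) {ι : Type} (P : ι → Face) (x : ι) (t : ℝ) : Prop where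
  isPolyhedron : IsPolyhedron P
  isRectangle : ∀ i, (P i).IsRectangle
  euler : ((vertices P).ncard : ℤ) - Nat.card ι = 2 - 2 * g
  top : P x = unitSquare t
  le_top : ∀ i, ∀ p ∈ (P i).region, p 0 ≤ t
  isConnected : IsConnected (⋃ i ∈ ({x}ᶜ : Set ι), (P i).region)
  exists_face : ∀ i, i ≠ .inl (0, 1) → ∃ j, j ≠ x ∧ P j = octopus L i
  face : ∀ j, (∃ i, P j = octopus L i) ∨ (P j).IsAxisParallel

theorem octopus_region_le {L : ℝ} (hL : 0 < L) (i : OctIndex) {p : E3}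
    (hp : p ∈ (octopus L i).region) : p 0 ≤ L / √2 + 1 / 2 := by
  have hh : 0 < L / √2 := div_pos hL (by positivity)
  rw [octopus_eq_realize, (octPt_isRectangular hL).region_eq oct_isClosedQuadSurface] at hp
  refine convexHull_min ?_ (convex_le_height _) hp
  rintro _ ⟨q, rfl⟩
  have h : ∀ v, octP v 0 ≤ 1 ∧ octQ v 0 ≤ 1 := by decide +kernel
  obtain ⟨h1, h2⟩ := h (octFace i q)
  have h1 : ((octP (octFace i q) 0 : ℤ) : ℝ) ≤ 1 := by exact_mod_cast h1
  have h2 : ((octQ (octFace i q) 0 : ℤ) : ℝ) ≤ 1 := by exact_mod_cast h2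
  have h3 := mul_le_mul_of_nonneg_left h2 hh.le
  simp only [Set.mem_ofPred_eq, octPt, latticePt, zero_add]
  linarith

theorem octopus_isTower {L : ℝ} (hL : 0 < L) :
    IsTower L 7 (octopus L) (.inl (0, 1)) (L / √2 + 1 / 2) where
  isPolyhedron := octopus_isPolyhedron hL
  isRectangle := octopus_isRectangle hL
  euler := by
    rw [octopus_ncard_vertices hL, card_octIndex]
    norm_num
  top := octopus_top L
  le_top i _ hp := octopus_region_le hL i hp
  isConnected := octopus_isConnected_biUnion hL
  exists_face i hi := ⟨i, hi, rfl⟩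
  face j := Or.inl ⟨j, rfl⟩

namespace IsTower

variable {L : ℝ} {g : ℕ} {ι : Type} {P : ι → Face} {x : ι} {t : ℝ}

/-- The tower and the torus on top of it lie on different sides of the plane at height `t`. -/
theorem surface_inter (h : IsTower L g P x t) :
    surface P ∩ surface (torus t) ⊆ (P x).region := by
  rintro p ⟨hp, hq⟩
  obtain ⟨i, hi⟩ := Set.mem_iUnion.1 hp
  obtain ⟨j, hj⟩ := Set.mem_iUnion.1 hq
  rw [h.top, ← torus_bottom]
  exact torus_region_bottom t j hj (h.le_top i p hi)

/-- Gluing an orthogonal torus to the top square increases the genus by one. -/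
theorem glue_torus (h : IsTower L g P x t) :
    IsTower L (g + 1) (glue P x (torus t) (.inr 0)) (.inr ⟨.inr 17, by decide⟩) (t + 4) := by
  have hxy : P x = torus t (.inr 0) := h.top.trans (torus_bottom t).symm
  have := h.isPolyhedron.finite
  refine ⟨h.isPolyhedron.glue (torus_isPolyhedron t) hxy h.surface_inter, ?_, ?_, torus_top t,
    ?_, ?_, ?_, ?_⟩
  · rintro (i | j)
    exacts [h.isRectangle i, torus_isRectangle t j]
  · have h1 := ncard_vertices_glue h.isPolyhedron (torus_isPolyhedron t) hxy h.surface_inter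
      (h.isRectangle x).1
    have h2 := card_glue (ι := ι) (κ := TorusIndex) x (.inr 0)
    have h3 := h.euler
    rw [torus_ncard_vertices] at h1
    rw [card_torusIndex] at h2
    push_cast
    omega
  · rintro (i | j) p hp
    · have := h.le_top i p hp
      linarith
    · exact torus_region_le t j hp
  · have hset : (⋃ k ∈ ({.inr ⟨.inr 17, by decide⟩}ᶜ :
        Set ({i // i ≠ x} ⊕ {j : TorusIndex // j ≠ .inr 0})),
        (glue P x (torus t) (.inr 0) k).region) =
        (⋃ i ∈ ({x}ᶜ : Set ι), (P i).region) ∪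
          ⋃ j ∈ {j : TorusIndex | j ≠ .inr 0 ∧ j ≠ .inr 17}, (torus t j).region := by
      ext p
      simp only [Set.mem_iUnion, Set.mem_union, exists_prop]
      constructor
      · rintro ⟨⟨i, hi⟩ | ⟨j, hj⟩, hk, hp⟩
        · exact Or.inl ⟨i, hi, hp⟩
        · exact Or.inr ⟨j, ⟨hj, fun e => hk (by subst e; rfl)⟩, hp⟩
      · rintro (⟨i, hi, hp⟩ | ⟨j, ⟨hj, hj'⟩, hp⟩)
        · exact ⟨.inl ⟨i, hi⟩, by simp, hp⟩
        · refine ⟨.inr ⟨j, hj⟩, ?_, hp⟩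
          simpa using hj'
    rw [hset]
    refine IsConnected.union ?_ h.isConnected (torus_isConnected_biUnion t)
    -- the two parts share the vertices of the common face
    obtain ⟨e, e', -, he⟩ := (h.isPolyhedron.simple x).exists_edges_at
      (v := (P x).vert (Fin.cast (h.isRectangle x).1.symm 0)) ⟨_, rfl⟩
    obtain ⟨he1, hve⟩ := (he e).2 (Or.inl rfl)
    obtain ⟨i, hi, hie⟩ := h.isPolyhedron.exists_other_face he1
    obtain ⟨j, hj, hje⟩ := (torus_isPolyhedron t).exists_other_face (hxy ▸ he1)
    -- the middle top face is not adjacent to the bottom face, being at height `t + 4`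
    have hj17 : j ≠ .inr 17 := by
      rintro rfl
      have hm := (torus t (.inr 17)).vertexSet_subset_region
        (Face.mem_vertexSet_of_mem_edge hje hve)
      have hm' := (P x).vertexSet_subset_region (Face.mem_vertexSet_of_mem_edge he1 hve)
      have h4 := h.le_top x _ hm'
      rw [torus_region] at hm
      have h5 : t + 4 ≤ ((P x).vert (Fin.cast (h.isRectangle x).1.symm 0)) 0 := by
        refine convexHull_min ?_ (convex_height_ge (t + 4)) hm
        rintro _ ⟨q, rfl⟩
        have : torusP (torusFace (.inr 17) q) 0 = 8 :=
          (by decide : ∀ q, torusP (torusFace (.inr 17) q) 0 = 8) q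
        simp only [Set.mem_ofPred_eq, torusPt_apply, this, if_true]
        norm_num
      linarith
    exact ⟨_, Set.mem_biUnion (show i ∈ ({x}ᶜ : Set ι) from hi)
      ((P i).vertexSet_subset_region (Face.mem_vertexSet_of_mem_edge hie hve)),
      Set.mem_biUnion (show j ∈ {j : TorusIndex | j ≠ .inr 0 ∧ j ≠ .inr 17} from ⟨hj, hj17⟩)
      ((torus t j).vertexSet_subset_region (Face.mem_vertexSet_of_mem_edge hje hve))⟩
  · intro i hi
    obtain ⟨j, hj, e⟩ := h.exists_face i hi
    exact ⟨.inl ⟨j, hj⟩, by simp, e⟩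
  · rintro (j | j)
    exacts [h.face j, Or.inr (torus_isAxisParallel t j)]

theorem hasGenus (h : IsTower L g P x t) : HasGenus P g := by
  have hne : (⋃ i ∈ ({x}ᶜ : Set ι), (P i).region) ∪ (P x).region = surface P := by
    ext p
    simp only [surface, Set.mem_union, Set.mem_iUnion, exists_prop]
    constructor
    · rintro (⟨i, -, hp⟩ | hp)
      exacts [⟨i, hp⟩, ⟨x, hp⟩]
    · rintro ⟨i, hp⟩
      by_cases hi : i = x
      · exact Or.inr (hi ▸ hp)
      · exact Or.inl ⟨i, hi, hp⟩
  refine ⟨?_, ?_⟩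
  · rw [← hne]
    obtain ⟨e, e', -, he⟩ := (h.isPolyhedron.simple x).exists_edges_at
      (v := (P x).vert (Fin.cast (h.isRectangle x).1.symm 0)) ⟨_, rfl⟩
    obtain ⟨he1, hve⟩ := (he e).2 (Or.inl rfl)
    obtain ⟨i, hi, hie⟩ := h.isPolyhedron.exists_other_face he1
    refine IsConnected.union ⟨_, Set.mem_biUnion (show i ∈ ({x}ᶜ : Set ι) from hi)
      ((P i).vertexSet_subset_region (Face.mem_vertexSet_of_mem_edge hie hve)),
      (P x).vert_mem_region _⟩ h.isConnected ?_
    rw [h.top, ← torus_bottom, torus_region]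
    exact (convex_convexHull ℝ _).isConnected ⟨_, subset_convexHull ℝ _ ⟨0, rfl⟩⟩
  · rw [(h.isPolyhedron.ncard_edges fun i => (h.isRectangle i).1).2]
    have := h.euler
    push_cast
    linarith

/-- The dihedral angle between two prism faces persists, since only the square is replaced. -/
theorem not_isOrthogonal (hL : 0 < L) (h : IsTower L g P x t) : ¬ IsOrthogonal P := by
  obtain ⟨i, j, hne, a, b, u, w, hi, hj, hu, hw, hθ⟩ := octopus_exists_dihedral hL
  obtain ⟨i', -, ei⟩ := h.exists_face (.inr i) (by simp)
  obtain ⟨j', -, ej⟩ := h.exists_face (.inr j) (by simp)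
  rw [← ei] at hi hu hne
  rw [← ej] at hj hw hne
  exact fun ho => hθ (ho _ ⟨i', j', fun e => hne (by rw [e]), a, b, u, w, hi, hj, hu, hw, rfl⟩)

end IsTower

theorem exists_isTower {L : ℝ} (hL : 0 < L) (k : ℕ) :
    ∃ (ι : Type) (P : ι → Face) (x : ι) (t : ℝ), IsTower L (7 + k) P x t := by
  induction k with
  | zero => exact ⟨_, _, _, _, octopus_isTower hL⟩
  | succ k ih =>
    obtain ⟨ι, P, x, t, h⟩ := ih
    exact ⟨_, _, _, _, h.glue_torus⟩

section Reindex

variable {ι κ : Type} (e : κ ≃ ι) (P : ι → Face)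

theorem vertices_reindex : vertices (P ∘ e) = vertices P :=
  e.surjective.iUnion_comp fun i => (P i).vertexSet

theorem edges_reindex : edges (P ∘ e) = edges P :=
  e.surjective.iUnion_comp fun i => (P i).edges

theorem surface_reindex : surface (P ∘ e) = surface P :=
  e.surjective.iUnion_comp fun i => (P i).region

theorem linkGraph_reindex (v : E3) : linkGraph (P ∘ e) v = linkGraph P v := by
  ext a b
  refine and_congr_right fun _ => and_congr_right fun _ => and_congr_right fun _ => ?_
  exact e.surjective.exists (p := fun i => a ∈ (P i).edges ∧ b ∈ (P i).edges) |>.symm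

variable {P}

theorem IsPolyhedron.reindex (hP : IsPolyhedron P) : IsPolyhedron (P ∘ e) where
  finite := have := hP.finite; Finite.of_equiv ι e.symm
  simple k := hP.simple (e k)
  inter k l hkl := hP.inter (e k) (e l) (e.injective.ne hkl)
  two_faces a ha := by
    rw [edges_reindex] at ha
    rw [← hP.two_faces a ha, ← Set.ncard_image_of_injective _ e.injective]
    congr 1
    ext i
    constructor
    · rintro ⟨k, hk, rfl⟩
      exact hk
    · intro hi
      exact ⟨e.symm i, by simpa using hi, by simp⟩
  link_cycle v hv := by
    rw [vertices_reindex] at hv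
    have h := (isLinkCycle_iff P v).2 (hP.link_cycle v hv)
    rw [← isLinkCycle_iff]
    refine ⟨?_, ?_, ?_⟩
    · rw [edges_reindex]; exact h.nonempty
    · rw [edges_reindex, linkGraph_reindex]; exact h.reachable
    · rw [edges_reindex, linkGraph_reindex]; exact h.degree

theorem HasGenus.reindex {g : ℕ} (h : HasGenus P g) : HasGenus (P ∘ e) g := by
  unfold HasGenus
  rw [surface_reindex, vertices_reindex, edges_reindex, Nat.card_congr e]
  exact h

theorem isOrthogonal_reindex : IsOrthogonal (P ∘ e) ↔ IsOrthogonal P := by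
  refine forall_congr' fun θ => imp_congr_left ⟨?_, ?_⟩
  · rintro ⟨i, j, hij, h⟩
    exact ⟨e i, e j, e.injective.ne hij, h⟩
  · rintro ⟨i, j, hij, h⟩
    refine ⟨e.symm i, e.symm j, e.symm.injective.ne hij, ?_⟩
    simpa using h

end Reindex

/-- Nonorthogonal polyhedra of all genera from seven on, obtained from the octahedral example by
attaching tori to the top square. -/
theorem exists_polyhedron_of_genus {L : ℝ} (hL : 0 < L) {g : ℕ} (hg : 7 ≤ g) :
    ∃ (m : ℕ) (P : Fin m → Face), IsPolyhedron P ∧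
      (∀ i, (P i).IsRectangle) ∧ ¬ IsOrthogonal P ∧ HasGenus P g ∧
      (∀ i, i ≠ .inl (0, 1) → ∃ j, P j = octopus L i) ∧
        ∀ j, (∃ i, P j = octopus L i) ∨ (P j).IsAxisParallel := by
  obtain ⟨k, rfl⟩ := Nat.exists_eq_add_of_le hg
  obtain ⟨ι, P, x, t, h⟩ := exists_isTower hL k
  have := h.isPolyhedron.finite
  let e := (Finite.equivFin ι).symm
  refine ⟨Nat.card ι, P ∘ e, h.isPolyhedron.reindex e, fun i => h.isRectangle _,
    fun ho => h.not_isOrthogonal hL ((isOrthogonal_reindex e).1 ho), h.hasGenus.reindex e, ?_,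
    fun j => h.face _⟩
  intro i hi
  obtain ⟨j, -, hj⟩ := h.exists_face i hi
  exact ⟨e.symm j, by simpa using hj⟩

end RectangularPolyhedra

end

open RectangularPolyhedra

theorem mainTheorem2 :
    -- nonorthogonal polyhedra with rectangular faces exist in every genus from seven on
    (∀ g : ℕ, 7 ≤ g → ∃ (m : ℕ) (P : Fin m → Face), IsPolyhedron P ∧
      (∀ i, (P i).IsRectangle) ∧ ¬ IsOrthogonal P ∧ HasGenus P g) ∧
    -- the octahedral example, for every prism length
    (∀ L : ℝ, 0 < L →
      IsPolyhedron (octopus L) ∧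
      (∀ x, (octopus L (.inl x)).IsRectangleOfSize 1 1) ∧
      (∀ x, (octopus L (.inr (.inl x))).IsRectangleOfSize L 1) ∧
      (∀ x, (octopus L (.inr (.inr x))).IsRectangleOfSize L (√3 / 2)) ∧
      ¬ IsOrthogonal (octopus L) ∧
      (∀ θ, IsDihedralAngle (octopus L) θ → ¬ IsRectilinear θ) ∧
      (∀ A : E3 ≃ₗᵢ[ℝ] E3, A '' octahedron = octahedron →
        ∀ i, ∃ j, A '' (octopus L i).region = (octopus L j).region) ∧
      (vertices (octopus L)).ncard = 30 ∧
      (edges (octopus L)).ncard = 84 ∧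
      Nat.card OctIndex = 42 ∧
      HasGenus (octopus L) 7) ∧
    -- higher genus by replacing one square by an axis-parallel rectangular surface
    (∀ L : ℝ, 0 < L → ∀ g : ℕ, 7 ≤ g → ∃ (m : ℕ) (P : Fin m → Face), IsPolyhedron P ∧
      (∀ i, (P i).IsRectangle) ∧ ¬ IsOrthogonal P ∧ HasGenus P g ∧
      ∃ x, (∀ i, i ≠ .inl x → ∃ j, P j = octopus L i) ∧
        ∀ j, (∃ i, P j = octopus L i) ∨ (P j).IsAxisParallel) := by
  refine ⟨fun g hg => ?_, fun L hL => ?_, fun L hL g hg => ?_⟩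
  · obtain ⟨m, P, h1, h2, h3, h4, -⟩ := exists_polyhedron_of_genus one_pos hg
    exact ⟨m, P, h1, h2, h3, h4⟩
  · exact ⟨octopus_isPolyhedron hL, octopus_square_size hL, octopus_outer_size hL,
      octopus_inner_size hL, octopus_not_isOrthogonal hL, octopus_dihedral hL, octopus_symm hL,
      octopus_ncard_vertices hL, octopus_ncard_edges hL, card_octIndex, octopus_hasGenus hL⟩
  · obtain ⟨m, P, h1, h2, h3, h4, h5, h6⟩ := exists_polyhedron_of_genus hL hg
    exact ⟨m, P, h1, h2, h3, h4, (0, 1), h5, h6⟩
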